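/- **Model.** A *protocol* consists of an initial state and six deterministic callbacks (start, run, join, remove, packet, broadcast); each maps the local state to a new state and a finite list of multicasts (one content, a finite non-empty set of targets). A *computation* consists of: a sequence of $N\le\infty$ finite views $V_0,V_1,\dots$, consecutive views differing by the addition or the removal of one process, such that the views containing a process $P$ form an interval $j(P)\le i<r(P)$ ($P$ is *removed* if $r(P)<N$), and such that every process with $j(P)>0$ has a parent in $V_{j(P)-1}$; a set of halting processes; for each process a set of broadcast requests; packets, each of which may be sent, and if sent may be received (sent but not received is *dropped*); for each process $P$ the notifications $n_i(P)$ of its own joining ($i=j(P)$), of the view changes $j(P)<i<r(P)$, and of its own removal ($i=r(P)$, if $P$ is removed, or halts with $r(P)=N<\infty$), some of which may be dropped; and a set of events: the queuing of a multicast, the dequeuing of a packet, of a notification $n_i(P)$, or of a request. Events carry a weak order $\preceq$, linear on the set $E_P$ of events of each process $P$. A computation is *generated by the protocol* if each $E_P$ is a sequence of transactions (a trigger, i.e. a dequeuing event, followed by the queuing of the multicasts issued by the corresponding callback in the current state), all complete except perhaps the last one of a halting process, where a joining process starts in the state in which its parent dequeues the notification of the joining. A *history* of the protocol is a computation generated by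 it that satisfies the model axioms: packets are queued before being dequeued; channels are FIFO; notifications are dequeued in order and without gaps, and $n_0(P)$ is dequeued for every $P\in V_0$; if a process with parent $E$ and join view $j>0$ dequeues its join notification, then $E$ dequeues its notification of view $j$, and the two events are contemporaneous; $P$ queues packets only to processes that appear live to it, i.e. that are in $V_{j(P)}$ or whose join notification it has dequeued, and whose removal notification it has not dequeued (*Process Liveness Axiom*); if $P$ has $i\le j(P)$ or has dequeued $n_i(P)$ before queuing a packet to $Q$, then $i\le j(Q)$ or $Q$ dequeues $n_i(Q)$ before it dequeues that packet; a packet from $P$ to itself queued before $n_i(P)$ is dequeued is dequeued before it too; each event of $E_P$ has finitely many predecessors in $E_P$, the first event of a non-empty $E_P$ is the dequeuing of $n_{j(P)}(P)$, and the dequeuing of $n_{r(P)}(P)$ (the *halting event*) is the last if it exists; $\preceq$ is generated by the local orders, queuing before dequeuing, and the contemporaneity of join events; a halting process has finitely many events and finitely many requests; a dropped notification is not dequeued, and a non-halting process dequeues every notification up to which none is dropped; a non-halting process sends all its packets, an unreceived packet is not dequeued, and between two non-halting processes a packet that is received together with all earlier packets of its channel is dequeued; a non-halting process dequeues all its requests.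 A computation is *conforming* if: whenever only finitely many packets from $P$ to $Q$ are dequeued, $P$ is removed or $Q$ halts; $P$ dequeues no packet from $Q$ after the notification of the removal of $Q$; if $n_i(P)$ is dropped then $P$ halts; if $P$ halts then $r(P)<\infty$; a process without events is the parent of no process; removed processes halt. It is *stunted* if it has finitely many processes and all of them halt. A channel from $P$ to $Q$ is *downstream* if $r(P)>r(Q)$ or $P=Q$, and *upstream* otherwise. A history is *lossless* if no packet and no notification is dropped, all received upstream packets are dequeued, and all downstream packets are sent. It is *transactional* if it is conforming and lossless, and all notifications, all requests and all received packets are dequeued and processed to completion (their transactions are complete). Let the *causal successors* of an event be those reached from it by steps $e\to f$ where $e$ precedes $f$ at the same process, or $e$ and $f$ are the queuing and the dequeuing of a packet, or $f$ is the join event of a process and $e$ is its parent's dequeuing of the notification of that joining. An event at a halting process is a *vacuum event* if it has finitely many causal successors, all at halting processes; a packet is a *vacuum packet* if its queuing event is a vacuum event. Two histories are *fault equivalent* if they have the same views, parents, halting processes and requests, the same non-vacuum events in the same order, and the same non-vacuum packets with the same contents. The *vacuum loop* at a halting process $P$ of a lossless history (where $P\in V_0$ or the parent of $P$ dequeues the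 notification of the joining of $P$) takes back the halting event, if any, completes the current transaction, and then repeats, with $v$ the highest view processed by $P$ (initially $j(P)-1$ if $E_P=\emptyset$): (a) if $v\ge j(P)$, process all pending requests; (b) if $v=r(P)-1$, process all packets in the receive queues of the channels from other processes; (c) process the packets in the receive queue of the self channel until it is empty, where new self-channel packets are appended to this queue as they arise; (d) increment $v$; if $v=r(P)$, append the halting event and stop, otherwise process $n_v(P)$. The protocol is *vacuum convergent* if this loop terminates, whatever the order in which the items of (a) and (b) are taken (FIFO in each channel), for each such $P$ in every lossless conforming history of the protocol. **Theorem (Fault Theorem).** Suppose that a protocol is vacuum convergent and that it respects liveness, i.e. every conforming computation generated by the protocol that satisfies all the other model axioms satisfies the Process Liveness Axiom. Then every conforming history $H$ of the protocol extends to a transactional history $\mathrm{tr}(H)$ that is fault equivalent to $H$. Here "extends" means that $\mathrm{tr}(H)$ has the same views, parents, halting processes and requests, that it contains all events and packets of $H$, in the same order, and that no new event has an event of $H$ as a causal successor, except that new events of a process precede its halting event. Moreover, either $\mathrm{tr}(H)$ is stunted, or a process of $\mathrm{tr}(H)$ halts if and only if it is removed. -/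

import Mathlib

/-! ## Protocols -/

/-- One side effect of a callback: the same content is appended to the send queues of the
channels leading to one or more targets. -/
structure Multicast (Pid Content : Type*) where
  targets : Finset Pid
  nonempty : targets.Nonempty
  content : Content

/-- A protocol is a (common) initial state and six non-blocking, deterministic callbacks.  Each
callback maps the current state of the local process to its new state and the finite list of
multicasts that it issues. -/
structure Protocol (Pid Content Msg State : Type*) where
  init : State
  /-- called with the initial roster and the local identifier, at the members of view zero -/
  start : Finset Pid → Pid → State → State × List (Multicast Pid Content)
  /-- called with the local identifier at a process that has just been forked by its parent -/
  run : Pid → State → State × List (Multicast Pid Content)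
  /-- called with the joining process and its parent -/
  join : Pid → Pid → State → State × List (Multicast Pid Content)
  /-- called with the removed process -/
  remove : Pid → State → State × List (Multicast Pid Content)
  /-- called with the content and the sender of a dequeued packet -/
  packet : Content → Pid → State → State × List (Multicast Pid Content)
  /-- called with the content of a message broadcast request -/
  broadcast : Msg → State → State × List (Multicast Pid Content)

/-! ## Views -/

/-- The sequence of views of the group, of length `numViews` (possibly infinite).  The values of
`view i` for `i ≥ numViews`, and those of the other functions outside the set of processes, are
irrelevant. -/
structure GroupViews (Pid : Type*) where
  numViews : ℕ∞
  view : ℕ → Finset Pid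
  joinView : Pid → ℕ
  removalView : Pid → ℕ∞
  parent : Pid → Pid
  numViews_pos : 0 < numViews
  /-- View Interval Axiom (a process is a member of at least one view) -/
  view_interval : ∀ P, (∃ i : ℕ, (i : ℕ∞) < numViews ∧ P ∈ view i) →
    ∀ i : ℕ, ((i : ℕ∞) < numViews ∧ P ∈ view i) ↔ (joinView P ≤ i ∧ (i : ℕ∞) < removalView P)
  /-- View Change Axiom -/
  view_change : ∀ i : ℕ, ((i + 1 : ℕ) : ℕ∞) < numViews →
    (∃ J, J ∉ view i ∧ (view (i + 1) : Set Pid) = insert J (view i : Set Pid)) ∨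
    (∃ R, R ∈ view i ∧ (view (i + 1) : Set Pid) = (view i : Set Pid) \ {R})
  /-- the parent of a joining process is an existing member of the group -/
  parent_mem : ∀ P, (∃ i : ℕ, (i : ℕ∞) < numViews ∧ P ∈ view i) →
    ∀ i : ℕ, joinView P = i + 1 → parent P ∈ view i

/-- The set of all processes. -/
def GroupViews.procs {Pid : Type*} (M : GroupViews Pid) : Set Pid :=
  {P | ∃ i : ℕ, (i : ℕ∞) < M.numViews ∧ P ∈ M.view i}

/-- `P` is removed from the group at some view. -/
def GroupViews.Removed {Pid : Type*} (M : GroupViews Pid) (P : Pid) : Prop :=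
  M.removalView P < M.numViews

/-! ## Packets, notifications, events -/

/-- A packet is the copy, addressed to `tgt`, of the multicast of `src` with the given serial
number.  Serial numbers are mere names of multicasts; they need not follow the order of events. -/
@[ext] structure Packet (Pid : Type*) where
  src : Pid
  serial : ℕ
  tgt : Pid

/-- Contents of the notifications of the group membership service. -/
inductive Note (Pid : Type*) where
  | removed (R : Pid)
  | joined (J E : Pid)
  | new (P : Pid)
  | dead

/-- Possible events: queuing of a multicast, dequeuing of a packet, of the notification of a view,
and of a request. -/
inductive Event (Pid : Type*) where
  | queue (P : Pid) (n : ℕ)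
  | dequeue (k : Packet Pid)
  | notify (P : Pid) (i : ℕ)
  | request (P : Pid) (r : ℕ)

/-- The process at which an event occurs. -/
def Event.proc {Pid : Type*} : Event Pid → Pid
  | .queue P _ => P
  | .dequeue k => k.tgt
  | .notify P _ => P
  | .request P _ => P

/-- The raw data of a group computation.  `targets P n` and `content P n` describe the `n`-th
multicast of `P` (if it exists), `requests P` is the set of (names of) broadcast requests issued at
`P`, `dropped` is the set of dropped notifications, `le` is the weak order of events. -/
structure GroupComputation (Pid Content Msg : Type*) where
  mem : GroupViews Pid
  halting : Set Pid
  requests : Pid → Set ℕ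
  reqContent : Pid → ℕ → Msg
  targets : Pid → ℕ → Finset Pid
  content : Pid → ℕ → Content
  sent : Set (Packet Pid)
  received : Set (Packet Pid)
  dropped : Set (Pid × ℕ)
  events : Set (Event Pid)
  le : Event Pid → Event Pid → Prop

namespace GroupComputation

variable {Pid Content Msg : Type*} (H : GroupComputation Pid Content Msg)

/-- The set of all packets; each has a queuing event, shared with the rest of its multicast. -/
def packets : Set (Packet Pid) :=
  {k | Event.queue k.src k.serial ∈ H.events ∧ k.tgt ∈ H.targets k.src k.serial}

/-- The set of events that occur at `P`. -/
def eventsAt (P : Pid) : Set (Event Pid) := {e | e ∈ H.events ∧ e.proc = P}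

/-- Strict precedence. -/
def lt (e f : Event Pid) : Prop := H.le e f ∧ ¬ H.le f e

/-- `IsNote P i c`: the notification of view `i` for `P` exists and has content `c`.  The
notification of view zero at an original process, and the one of view `numViews` at a halting
process that is not removed, are artificial. -/
inductive IsNote : Pid → ℕ → Note Pid → Prop
  | new (P : Pid) (hP : P ∈ H.mem.procs) : IsNote P (H.mem.joinView P) (.new P)
  | joined (P J : Pid) (hP : P ∈ H.mem.procs) (hJ : J ∈ H.mem.procs)
      (h₁ : H.mem.joinView P < H.mem.joinView J)
      (h₂ : (H.mem.joinView J : ℕ∞) < H.mem.removalView P) :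
      IsNote P (H.mem.joinView J) (.joined J (H.mem.parent J))
  | removed (P R : Pid) (i : ℕ) (hP : P ∈ H.mem.procs) (hR : R ∈ H.mem.procs)
      (hi : H.mem.removalView R = i) (h₁ : H.mem.joinView P < i)
      (h₂ : (i : ℕ∞) < H.mem.removalView P) : IsNote P i (.removed R)
  | dead (P : Pid) (i : ℕ) (hP : P ∈ H.mem.procs) (hi : H.mem.removalView P = i)
      (h : H.mem.Removed P ∨ P ∈ H.halting) : IsNote P i .dead

/-- The notification of view `i` for `P` exists. -/
def HasNote (P : Pid) (i : ℕ) : Prop := ∃ c, H.IsNote P i c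

/-- `e` is the processing of the parent's notification of the joining of a process, and `f` is the
join event of that process. -/
def Fork (e f : Event Pid) : Prop :=
  ∃ J ∈ H.mem.procs, 0 < H.mem.joinView J ∧
    e = .notify (H.mem.parent J) (H.mem.joinView J) ∧ f = .notify J (H.mem.joinView J)

/-- The primitive causal relations: local precedence, from queuing to dequeuing of a packet, from
the parent to the child. -/
def Primitive (e f : Event Pid) : Prop :=
  e ∈ H.events ∧ f ∈ H.events ∧
    ((e.proc = f.proc ∧ H.le e f) ∨
      (∃ k ∈ H.packets, e = .queue k.src k.serial ∧ f = .dequeue k) ∨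
      H.Fork e f)

/-- `f` is a causal successor of `e` (or equal to `e`). -/
def Reaches : Event Pid → Event Pid → Prop := Relation.ReflTransGen H.Primitive

/-- `e` immediately precedes `f` at their common process. -/
def Pred (e f : Event Pid) : Prop :=
  e ∈ H.events ∧ f ∈ H.events ∧ e.proc = f.proc ∧ H.lt e f ∧
    ∀ g ∈ H.eventsAt e.proc, ¬ (H.lt e g ∧ H.lt g f)

/-! ### Model axioms -/

/-- Events, faults and requests refer to existing items. -/
structure WellFormed : Prop where
  halting_sub : H.halting ⊆ H.mem.procs
  proc_mem : ∀ e ∈ H.events, e.proc ∈ H.mem.procs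
  dequeue_mem : ∀ k, Event.dequeue k ∈ H.events → k ∈ H.packets
  notify_mem : ∀ P i, Event.notify P i ∈ H.events → H.HasNote P i
  request_mem : ∀ P r, Event.request P r ∈ H.events → r ∈ H.requests P
  sent_sub : H.sent ⊆ H.packets
  received_sub : H.received ⊆ H.sent
  dropped_sub : ∀ P i, (P, i) ∈ H.dropped → H.HasNote P i
  original : ∀ P ∈ H.mem.procs, H.mem.joinView P = 0 → Event.notify P 0 ∈ H.events

def PacketEventAxiom : Prop :=
  ∀ k, Event.dequeue k ∈ H.events → H.lt (.queue k.src k.serial) (.dequeue k)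

def PacketOrderAxiom : Prop :=
  ∀ P Q m n, ⟨P, m, Q⟩ ∈ H.packets → ⟨P, n, Q⟩ ∈ H.packets →
    H.lt (.queue P m) (.queue P n) → Event.dequeue ⟨P, n, Q⟩ ∈ H.events →
    Event.dequeue ⟨P, m, Q⟩ ∈ H.events ∧ H.lt (.dequeue ⟨P, m, Q⟩) (.dequeue ⟨P, n, Q⟩)

def NotificationOrderAxiom : Prop :=
  ∀ P (i i' : ℕ), H.mem.joinView P ≤ i → i < i' → (i' : ℕ∞) ≤ H.mem.removalView P →
    Event.notify P i' ∈ H.events →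
    Event.notify P i ∈ H.events ∧ H.lt (.notify P i) (.notify P i')

def ParentAxiom : Prop :=
  ∀ e f, H.Fork e f → f ∈ H.events → e ∈ H.events ∧ H.le e f ∧ H.le f e

/-- The order is linear at each process. -/
def LocalOrderAxiom : Prop :=
  ∀ e ∈ H.events, ∀ f ∈ H.events, e.proc = f.proc →
    (H.le e f ∨ H.le f e) ∧ (H.le e f → H.le f e → e = f)

/-- A process queues packets only to processes that appear live to it. -/
def LivenessAxiom : Prop :=
  ∀ P n Q, ⟨P, n, Q⟩ ∈ H.packets →
    Q ∈ H.mem.procs ∧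
    (Q ∈ H.mem.view (H.mem.joinView P) ∨
      (Event.notify P (H.mem.joinView Q) ∈ H.events ∧
        H.lt (.notify P (H.mem.joinView Q)) (.queue P n))) ∧
    ∀ i : ℕ, H.mem.removalView Q = i → Event.notify P i ∈ H.events →
      H.lt (.queue P n) (.notify P i)

def PiggybackAxiom : Prop :=
  ∀ P n Q, Event.dequeue ⟨P, n, Q⟩ ∈ H.events → ∀ i : ℕ,
    (i ≤ H.mem.joinView P ∨
      (Event.notify P i ∈ H.events ∧ H.lt (.notify P i) (.queue P n))) →
    (i ≤ H.mem.joinView Q ∨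
      (Event.notify Q i ∈ H.events ∧ H.lt (.notify Q i) (.dequeue ⟨P, n, Q⟩)))

def SelfChannelAxiom : Prop :=
  ∀ P n i, ⟨P, n, P⟩ ∈ H.packets → Event.notify P i ∈ H.events →
    H.lt (.queue P n) (.notify P i) →
    Event.dequeue ⟨P, n, P⟩ ∈ H.events ∧ H.lt (.dequeue ⟨P, n, P⟩) (.notify P i)

structure OrderFoundationAxiom : Prop where
  finite : ∀ e ∈ H.events, {f | f ∈ H.eventsAt e.proc ∧ H.lt f e}.Finite
  join_first : ∀ e ∈ H.events, Event.notify e.proc (H.mem.joinView e.proc) ∈ H.events ∧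
    H.le (.notify e.proc (H.mem.joinView e.proc)) e
  halt_last : ∀ P (i : ℕ), H.mem.removalView P = i → Event.notify P i ∈ H.events →
    ∀ e ∈ H.eventsAt P, H.le e (.notify P i)

/-- The order is generated by the local orders, the order between the queuing and the dequeuing of
a packet, and the contemporaneity of a join event with the parent's notification event. -/
def MinimalOrderAxiom : Prop :=
  ∀ e f, H.le e f ↔ e ∈ H.events ∧ f ∈ H.events ∧
    Relation.ReflTransGen (fun a b => H.Primitive a b ∨ (H.Primitive b a ∧ H.Fork b a)) e f

/-- A halting process has finitely many events; and only finitely many requests can have been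
placed in its receive queue. -/
def FirstHaltingAxiom : Prop :=
  ∀ P ∈ H.halting, (H.eventsAt P).Finite ∧ (H.requests P).Finite

def SecondHaltingAxiom : Prop :=
  (∀ P i, (P, i) ∈ H.dropped → Event.notify P i ∉ H.events) ∧
  ∀ P ∈ H.mem.procs, P ∉ H.halting → ∀ i, H.HasNote P i →
    (∀ j ≤ i, (P, j) ∉ H.dropped) → Event.notify P i ∈ H.events

structure ThirdHaltingAxiom : Prop where
  sent : ∀ k ∈ H.packets, k.src ∉ H.halting → k ∈ H.sent
  dequeue : ∀ k, Event.dequeue k ∈ H.events → k ∈ H.received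
  progress : ∀ P n Q, Q ∈ H.mem.procs → ⟨P, n, Q⟩ ∈ H.packets → P ∉ H.halting → Q ∉ H.halting →
    (∀ m, ⟨P, m, Q⟩ ∈ H.packets → H.le (.queue P m) (.queue P n) → ⟨P, m, Q⟩ ∈ H.received) →
    Event.dequeue ⟨P, n, Q⟩ ∈ H.events

def FourthHaltingAxiom : Prop :=
  ∀ P ∈ H.mem.procs, P ∉ H.halting → ∀ r ∈ H.requests P, Event.request P r ∈ H.events

/-- All the model axioms on the history, with the exception of the Process Liveness Axiom. -/
structure BasicAxioms : Prop where
  wellFormed : H.WellFormed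
  packetEvent : H.PacketEventAxiom
  packetOrder : H.PacketOrderAxiom
  notificationOrder : H.NotificationOrderAxiom
  parent : H.ParentAxiom
  localOrder : H.LocalOrderAxiom
  piggyback : H.PiggybackAxiom
  selfChannel : H.SelfChannelAxiom
  orderFoundation : H.OrderFoundationAxiom
  minimalOrder : H.MinimalOrderAxiom
  firstHalting : H.FirstHaltingAxiom
  secondHalting : H.SecondHaltingAxiom
  thirdHalting : H.ThirdHaltingAxiom
  fourthHalting : H.FourthHaltingAxiom

/-! ### Conforming axioms -/

structure Conforming : Prop where
  channel : ∀ P ∈ H.mem.procs, ∀ Q ∈ H.mem.procs,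
    {n | Event.dequeue ⟨P, n, Q⟩ ∈ H.events}.Finite → H.mem.Removed P ∨ Q ∈ H.halting
  packet : ∀ P n Q i, H.IsNote P i (.removed Q) → Event.notify P i ∈ H.events →
    Event.dequeue ⟨Q, n, P⟩ ∈ H.events → ¬ H.lt (.notify P i) (.dequeue ⟨Q, n, P⟩)
  notification : ∀ P i, (P, i) ∈ H.dropped → P ∈ H.halting
  gms : ∀ P ∈ H.halting, H.mem.removalView P ≠ ⊤
  parent : ∀ P ∈ H.mem.procs, H.eventsAt P = ∅ →
    ∀ J ∈ H.mem.procs, 0 < H.mem.joinView J → H.mem.parent J ≠ P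
  halt : ∀ P ∈ H.mem.procs, H.mem.Removed P → P ∈ H.halting

/-- A stunted history has finitely many processes, and all of them halt. -/
def Stunted : Prop := H.mem.procs.Finite ∧ H.mem.procs ⊆ H.halting

/-! ### Lossless histories and fault equivalence -/

def Downstream (P Q : Pid) : Prop := H.mem.removalView Q < H.mem.removalView P ∨ P = Q

def Upstream (P Q : Pid) : Prop := H.mem.removalView P ≤ H.mem.removalView Q ∧ P ≠ Q

structure Lossless : Prop where
  no_dropped_packets : H.sent ⊆ H.received
  no_dropped_notifications : H.dropped = ∅
  upstream : ∀ k ∈ H.received, H.Upstream k.src k.tgt → Event.dequeue k ∈ H.events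
  downstream : ∀ k ∈ H.packets, H.Downstream k.src k.tgt → k ∈ H.sent

/-- A vacuum event occurs at a halting process and has finitely many causal successors, all at
halting processes. -/
def IsVacuum (e : Event Pid) : Prop :=
  e.proc ∈ H.halting ∧ {f | H.Reaches e f}.Finite ∧ ∀ f, H.Reaches e f → f.proc ∈ H.halting

def nonVacuumEvents : Set (Event Pid) := {e | e ∈ H.events ∧ ¬ H.IsVacuum e}

def nonVacuumPackets : Set (Packet Pid) :=
  {k | k ∈ H.packets ∧ ¬ H.IsVacuum (.queue k.src k.serial)}

/-- The two computations have the same views, parents, halting processes and requests (and hence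
the same notifications). -/
structure SameFrame (H H' : GroupComputation Pid Content Msg) : Prop where
  mem : H.mem = H'.mem
  halting : H.halting = H'.halting
  requests : H.requests = H'.requests
  reqContent : ∀ P, ∀ r ∈ H.requests P, H.reqContent P r = H'.reqContent P r

/-- The two computations are identical, except for the faults of packets and notifications and for
vacuum events and vacuum packets. -/
structure FaultEquivalent (H H' : GroupComputation Pid Content Msg) : Prop where
  frame : SameFrame H H'
  events : H.nonVacuumEvents = H'.nonVacuumEvents
  packets : H.nonVacuumPackets = H'.nonVacuumPackets
  content : ∀ k ∈ H.nonVacuumPackets, H.content k.src k.serial = H'.content k.src k.serial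
  order : ∀ e ∈ H.nonVacuumEvents, ∀ f ∈ H.nonVacuumEvents, H.le e f ↔ H'.le e f

/-- The event in which a process dequeues the notification that it is no longer a member. -/
def IsHaltEvent (e : Event Pid) : Prop :=
  ∃ P, ∃ i : ℕ, H.mem.removalView P = i ∧ e = .notify P i

/-- `H'` extends `H`: it contains the events and the packets of `H`, in the same order, and it has
no new event that is causally followed by an event of `H`.  The only exception is that new events of
a process are inserted before its halting event. -/
structure Extends (H H' : GroupComputation Pid Content Msg) : Prop where
  frame : SameFrame H H'
  events : H.events ⊆ H'.events
  multicast : ∀ P n, Event.queue P n ∈ H.events →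
    H.targets P n = H'.targets P n ∧ H.content P n = H'.content P n
  order : ∀ e ∈ H.events, ∀ f ∈ H.events, H.le e f → H'.le e f
  order_back : ∀ e ∈ H.events, ∀ f ∈ H.events, ¬ H.IsHaltEvent f → H'.le e f → H.le e f
  closed : ∀ e ∈ H'.events, ∀ f ∈ H.events, ¬ H.IsHaltEvent f → H'.Reaches e f → e ∈ H.events

end GroupComputation

/-! ## Computations generated by a protocol -/

namespace Protocol

variable {Pid Content Msg State : Type*} (A : Protocol Pid Content Msg State)

/-- The callback that is invoked when a notification is dequeued. -/
def onNote (M : GroupViews Pid) : Note Pid → State → State × List (Multicast Pid Content)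
  | .removed R, s => A.remove R s
  | .joined J E, s => A.join J E s
  | .new P, s => if M.joinView P = 0 then A.start (M.view 0) P s else A.run P s
  | .dead, s => (s, [])

/-- `Handles H e s x`: processing the trigger event `e` in the state `s` results in `x`, which is
the new state together with the multicasts that have to be queued. -/
inductive Handles (H : GroupComputation Pid Content Msg) :
    Event Pid → State → State × List (Multicast Pid Content) → Prop
  | notify (P : Pid) (i : ℕ) (c : Note Pid) (s : State) (hc : H.IsNote P i c) :
      Handles H (.notify P i) s (A.onNote H.mem c s)
  | dequeue (k : Packet Pid) (s : State) :
      Handles H (.dequeue k) s (A.packet (H.content k.src k.serial) k.src s)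
  | request (P : Pid) (r : ℕ) (s : State) :
      Handles H (.request P r) s (A.broadcast (H.reqContent P r) s)

/-- One event at a process.  A local configuration is the state together with the multicasts of the
current transaction that are still to be queued.  A trigger can be processed only when the
previous transaction is complete. -/
inductive LocalStep (H : GroupComputation Pid Content Msg) :
    State × List (Multicast Pid Content) → Event Pid →
    State × List (Multicast Pid Content) → Prop
  | trigger (s : State) (e : Event Pid) (x : State × List (Multicast Pid Content))
      (h : A.Handles H e s x) : LocalStep H (s, []) e x
  | queue (s : State) (m : Multicast Pid Content) (l : List (Multicast Pid Content))
      (P : Pid) (n : ℕ) (ht : H.targets P n = m.targets) (hc : H.content P n = m.content) :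
      LocalStep H (s, m :: l) (.queue P n) (s, l)

/-- The events of every process are produced by the protocol; `after e` is the local configuration
of the process right after its event `e`.  A child starts in the state in which its parent dequeues
the notification of the joining.  The last transaction of a halting process may be incomplete. -/
structure Generates (H : GroupComputation Pid Content Msg)
    (after : Event Pid → State × List (Multicast Pid Content)) : Prop where
  original : ∀ P ∈ H.mem.procs, H.mem.joinView P = 0 →
    A.Handles H (.notify P 0) A.init (after (.notify P 0))
  forked : ∀ d e f, H.Pred d e → H.Fork e f → f ∈ H.events →
    A.Handles H f (after d).1 (after f)
  step : ∀ e f, H.Pred e f → A.LocalStep H (after e) f (after f)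
  complete : ∀ e ∈ H.events, e.proc ∉ H.halting → (∀ f ∈ H.eventsAt e.proc, H.le f e) →
    (after e).2 = []

/-- A computation of the protocol that satisfies all the model axioms, except perhaps the Process
Liveness Axiom. -/
def IsPreHistory (H : GroupComputation Pid Content Msg) : Prop :=
  H.BasicAxioms ∧ ∃ after, A.Generates H after

/-- A history (of the protocol). -/
def IsHistory (H : GroupComputation Pid Content Msg) : Prop :=
  A.IsPreHistory H ∧ H.LivenessAxiom

/-- The protocol never queues packets to processes that do not appear live: the Process Liveness
Axiom, being a statement about the behavior of the protocol, holds in whatever conforming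
computation the protocol generates. -/
def RespectsLiveness : Prop :=
  ∀ H : GroupComputation Pid Content Msg, A.IsPreHistory H → H.Conforming → H.LivenessAxiom

/-! ### The vacuum loop -/

inductive LoopPhase where
  | requests
  | packets
  | self
  | notify
  | done

/-- State of the vacuum loop at a process `P`.  `next` is `v + 1`, where `v` is the highest view
that is processed so far, and `inbox Q` holds the contents of the packets in the receive queue of
the channel from `Q` to `P`. -/
structure LoopState (Pid Content State : Type*) where
  phase : LoopPhase
  next : ℕ
  state : State
  requests : Set ℕ
  inbox : Pid → List Content

open Classical in
/-- The contents of the packets on the self channel of `P` that arise from a list of multicasts. -/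
noncomputable def selfCopies (P : Pid) (l : List (Multicast Pid Content)) : List Content :=
  (l.filter fun m => P ∈ m.targets).map Multicast.content

open Classical in
/-- Completes a transaction at `P` with result `x`: the state is updated and the new packets of the
self channel go to the end of its receive queue. (New packets of `P` on other channels do not enter
any receive queue of `P`.) -/
noncomputable def LoopState.absorb (P : Pid) (s : LoopState Pid Content State)
    (x : State × List (Multicast Pid Content)) : LoopState Pid Content State :=
  { s with
    state := x.1
    inbox := Function.update s.inbox P (s.inbox P ++ selfCopies P x.2) }

open Classical in
/-- Removes the head of the receive queue of the channel from `Q`. -/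
noncomputable def LoopState.pop (Q : Pid) (s : LoopState Pid Content State) :
    LoopState Pid Content State :=
  { s with inbox := Function.update s.inbox Q (s.inbox Q).tail }

/-- One step of the vacuum loop at `P`: processing of one item, or transition to the next phase. -/
inductive VacuumStep (H : GroupComputation Pid Content Msg) (P : Pid) :
    LoopState Pid Content State → LoopState Pid Content State → Prop
  | request (s : LoopState Pid Content State) (r : ℕ) (hp : s.phase = .requests)
      (hv : H.mem.joinView P < s.next) (hr : r ∈ s.requests) :
      VacuumStep H P s
        (({ s with requests := s.requests \ {r} } : LoopState Pid Content State).absorb P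
          (A.broadcast (H.reqContent P r) s.state))
  | requestsDone (s : LoopState Pid Content State) (hp : s.phase = .requests)
      (h : s.next ≤ H.mem.joinView P ∨ s.requests = ∅) :
      VacuumStep H P s { s with phase := .packets }
  | packet (s : LoopState Pid Content State) (Q : Pid) (c : Content) (l : List Content)
      (hp : s.phase = .packets) (hv : H.mem.removalView P = s.next) (hQ : Q ≠ P)
      (hc : s.inbox Q = c :: l) :
      VacuumStep H P s ((s.pop Q).absorb P (A.packet c Q s.state))
  | packetsDone (s : LoopState Pid Content State) (hp : s.phase = .packets)
      (h : H.mem.removalView P ≠ s.next ∨ ∀ Q, Q ≠ P → s.inbox Q = []) :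
      VacuumStep H P s { s with phase := .self }
  | self (s : LoopState Pid Content State) (c : Content) (l : List Content)
      (hp : s.phase = .self) (hc : s.inbox P = c :: l) :
      VacuumStep H P s ((s.pop P).absorb P (A.packet c P s.state))
  | selfDone (s : LoopState Pid Content State) (hp : s.phase = .self) (h : s.inbox P = []) :
      VacuumStep H P s { s with phase := .notify }
  | halt (s : LoopState Pid Content State) (hp : s.phase = .notify)
      (hv : H.mem.removalView P = s.next) :
      VacuumStep H P s { s with phase := .done }
  | notify (s : LoopState Pid Content State) (c : Note Pid) (hp : s.phase = .notify)
      (hv : (s.next : ℕ∞) < H.mem.removalView P) (hc : H.IsNote P s.next c) :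
      VacuumStep H P s
        (({ s with phase := .requests, next := s.next + 1 } :
          LoopState Pid Content State).absorb P (A.onNote H.mem c s.state))

/-- `x` is the local configuration in which `P` halts, with the halting event (if any) taken back.
For an uninitialized process it is the state that it is about to inherit from its parent. -/
def HaltConfig (H : GroupComputation Pid Content Msg)
    (after : Event Pid → State × List (Multicast Pid Content)) (P : Pid)
    (x : State × List (Multicast Pid Content)) : Prop :=
  (∃ e ∈ H.eventsAt P, ¬ H.IsHaltEvent e ∧
    (∀ f ∈ H.eventsAt P, ¬ H.IsHaltEvent f → H.le f e) ∧ x = after e) ∨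
  (H.eventsAt P = ∅ ∧ ∃ d, H.Pred d (.notify (H.mem.parent P) (H.mem.joinView P)) ∧
    x = ((after d).1, []))

/-- `s` is the state of the vacuum loop at `P` after the current item has been finished. -/
structure LoopStart (H : GroupComputation Pid Content Msg)
    (after : Event Pid → State × List (Multicast Pid Content)) (P : Pid)
    (s : LoopState Pid Content State) : Prop where
  phase : s.phase = .requests
  join_le : H.mem.joinView P ≤ s.next
  le_removal : (s.next : ℕ∞) ≤ H.mem.removalView P
  next : ∀ i : ℕ, H.mem.joinView P ≤ i → (i : ℕ∞) < H.mem.removalView P →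
    (Event.notify P i ∈ H.events ↔ i < s.next)
  requests : s.requests = {r | r ∈ H.requests P ∧ Event.request P r ∉ H.events}
  queues : ∃ x queued, HaltConfig H after P x ∧
    s = LoopState.absorb P { s with inbox := queued } x ∧
    ∀ Q, ∃ l : List ℕ, l.Pairwise (fun m n => H.lt (.queue Q m) (.queue Q n)) ∧
      (∀ n, n ∈ l ↔ ⟨Q, n, P⟩ ∈ H.received ∧ Event.dequeue ⟨Q, n, P⟩ ∉ H.events) ∧
      queued Q = l.map (H.content Q)

/-- In every lossless conforming history of the protocol, the vacuum loop terminates at every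
halting process which is original or whose joining has been processed by its parent. -/
def VacuumConvergent : Prop :=
  ∀ (H : GroupComputation Pid Content Msg) (after : Event Pid → State × List (Multicast Pid Content)),
    A.IsHistory H → H.Conforming → H.Lossless → A.Generates H after →
    ∀ P ∈ H.halting,
      (0 < H.mem.joinView P →
        Event.notify (H.mem.parent P) (H.mem.joinView P) ∈ H.events) →
      ∀ s, LoopStart H after P s →
        ¬ ∃ u : ℕ → LoopState Pid Content State, u 0 = s ∧
          ∀ n, A.VacuumStep H P (u n) (u (n + 1))

/-! ### Transactional histories -/

/-- The trigger `e` occurs, and all the side effects of its processing have been queued. -/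
def Completed (H : GroupComputation Pid Content Msg)
    (after : Event Pid → State × List (Multicast Pid Content)) (e : Event Pid) : Prop :=
  e ∈ H.events ∧ ∃ f ∈ H.eventsAt e.proc, H.le e f ∧ (after f).2 = []

/-- A conforming, lossless history in which all notifications, all requests and all received
packets are processed to completion. -/
structure Transactional (H : GroupComputation Pid Content Msg) : Prop where
  history : A.IsHistory H
  conforming : H.Conforming
  lossless : H.Lossless
  completed : ∃ after, A.Generates H after ∧
    (∀ P i, H.HasNote P i → Completed H after (.notify P i)) ∧
    (∀ P ∈ H.mem.procs, ∀ r ∈ H.requests P, Completed H after (.request P r)) ∧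
    (∀ k ∈ H.received, Completed H after (.dequeue k))

end Protocol

/-! The construction starts from `undropped`: all halting events are taken back, dropped
notifications are declared undropped, and a packet counts as sent and received exactly if it is
dequeued or its channel is downstream. A halting event precedes no other event, so the result is
again a conforming history, and it is lossless.

This history is completed by running the vacuum loops of the halting processes, one event at a time
(`append`). New packets on downstream channels (self channels included) are received at once, new
packets on upstream channels are never sent. `CanAppend.good` checks all axioms for the appended
event, except liveness, which then follows from `RespectsLiveness`. The loops are interleaved view
by view. `Sim.advance` follows the loop of one process up to its next notification, by well-founded
induction supplied by vacuum convergence. For each view, `Tidy.exists_notified_succ` serves the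
continuing members, then the joining processes, and only then those that are removed. Thus all
possible senders have stopped queuing packets to a removed process before it halts, and by
`Finished.ext` it remains finished. The limit over all views is a history because each axiom is
either decided at a finite stage or concerns a process that has stopped changing.

For fault equivalence the point is that every new event is a vacuum event
(`Ext.isVacuum_of_notMem`). A new event influences another process only through the dequeuing of a
packet or through a fork. New dequeuings at another process occur on downstream channels, which
lowers the removal view, and only after the target has processed all its notifications but the
halting one, so that it forks no more. A process whose first events are new has no children, by
conformity. Hence forks contribute at most one generation, the removal views of all processes
reached are bounded, and so these are finitely many halting processes with finitely many events
each. Halting events are vacuum events too, since they have no successors; so taking them back and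
putting them at the end does no harm. -/

/-! ### Membership intervals and view changes. -/

namespace GroupViews

variable {Pid : Type*} {M : GroupViews Pid} {P Q : Pid}

theorem joinView_lt_removalView (hP : P ∈ M.procs) : (M.joinView P : ℕ∞) < M.removalView P := by
  obtain ⟨i, hi⟩ := hP
  have h := (M.view_interval P ⟨i, hi⟩ i).1 hi
  exact lt_of_le_of_lt (by exact_mod_cast h.1) h.2

theorem mem_view_joinView (hP : P ∈ M.procs) :
    (M.joinView P : ℕ∞) < M.numViews ∧ P ∈ M.view (M.joinView P) :=
  (M.view_interval P hP _).2 ⟨le_rfl, joinView_lt_removalView hP⟩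

theorem mem_view_of_le_of_lt (hP : P ∈ M.procs) {i : ℕ} (h : M.joinView P ≤ i)
    (h' : (i : ℕ∞) < M.removalView P) : (i : ℕ∞) < M.numViews ∧ P ∈ M.view i :=
  (M.view_interval P hP i).2 ⟨h, h'⟩

theorem le_of_mem_view (hP : P ∈ M.procs) {i : ℕ} (h : (i : ℕ∞) < M.numViews)
    (h' : P ∈ M.view i) : M.joinView P ≤ i ∧ (i : ℕ∞) < M.removalView P :=
  (M.view_interval P hP i).1 ⟨h, h'⟩

/-- Otherwise `numViews` is finite and the interval axiom, applied to the index `numViews` itself,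
would make it the index of a view. -/
theorem removalView_le_numViews (hP : P ∈ M.procs) : M.removalView P ≤ M.numViews := by
  by_contra! h
  obtain ⟨n, hn⟩ := ENat.ne_top_iff_exists.1 h.ne_top
  have hj := (mem_view_joinView hP).1
  rw [← hn] at h hj
  have := (mem_view_of_le_of_lt hP (i := n) (by exact_mod_cast hj.le) h).1
  rw [← hn] at this
  exact lt_irrefl _ this

/-- The parent is in the view before the joining, and it survives the view change because the only
change there is the addition of the child. The strict bound on its removal view makes the
notification of the joining an ordinary one, never the halting event of the parent. -/
theorem parent_spec (hP : P ∈ M.procs) (h0 : 0 < M.joinView P) :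
    M.parent P ∈ M.procs ∧ M.joinView (M.parent P) < M.joinView P ∧
      (M.joinView P : ℕ∞) < M.removalView (M.parent P) := by
  obtain ⟨i, hi⟩ := Nat.exists_eq_succ_of_ne_zero h0.ne'
  have hi' : M.joinView P = i + 1 := hi
  have hmem := M.parent_mem P hP i hi'
  obtain ⟨hjN, hjv⟩ := mem_view_joinView hP
  rw [hi'] at hjN hjv
  have hlt : (i : ℕ∞) < M.numViews := lt_trans (by exact_mod_cast Nat.lt_succ_self i) hjN
  have hpp : M.parent P ∈ M.procs := ⟨i, hlt, hmem⟩
  have hP' : P ∉ M.view i := fun h => by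
    have := (le_of_mem_view hP hlt h).1
    omega
  have hmem' : M.parent P ∈ M.view (i + 1) := by
    rcases M.view_change i hjN with ⟨J, -, hJ⟩ | ⟨R, -, hR⟩
    · have : M.parent P ∈ (M.view (i + 1) : Set Pid) := by
        rw [hJ]; exact Or.inr hmem
      exact this
    · have : P ∈ (M.view (i + 1) : Set Pid) := hjv
      rw [hR] at this
      exact absurd this.1 hP'
  refine ⟨hpp, ?_, ?_⟩
  · have := (le_of_mem_view hpp hlt hmem).1
    omega
  · rw [hi']
    exact (le_of_mem_view hpp hjN hmem').2

theorem finite_joinView_le (M : GroupViews Pid) (v : ℕ) :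
    {P | P ∈ M.procs ∧ M.joinView P ≤ v}.Finite := by
  refine Set.Finite.subset (Set.Finite.biUnion (Set.finite_Iic v)
    fun i _ => (M.view i).finite_toSet) ?_
  rintro P ⟨hP, hv⟩
  simp only [Set.mem_iUnion]
  exact ⟨M.joinView P, hv, (mem_view_joinView hP).2⟩

/-- The process `P` only witnesses that `i` is the index of a view other than the first. The one
process in which views `i - 1` and `i` differ has an interval that begins or ends exactly at `i`. -/
theorem exists_change (hP : P ∈ M.procs) {i : ℕ} (h : M.joinView P < i)
    (h' : (i : ℕ∞) < M.removalView P) :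
    (∃ J ∈ M.procs, M.joinView J = i) ∨ ∃ R ∈ M.procs, M.removalView R = i := by
  obtain ⟨k, rfl⟩ : ∃ k, i = k + 1 := ⟨i - 1, by omega⟩
  have hN := (mem_view_of_le_of_lt hP h.le h').1
  have hk : (k : ℕ∞) < M.numViews := lt_trans (by exact_mod_cast Nat.lt_succ_self k) hN
  rcases M.view_change k hN with ⟨J, hJ, hJ'⟩ | ⟨R, hR, hR'⟩
  · left
    have hm : J ∈ M.view (k + 1) := by
      have : J ∈ (M.view (k + 1) : Set Pid) := by rw [hJ']; exact Or.inl rfl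
      exact this
    have hp : J ∈ M.procs := ⟨k + 1, hN, hm⟩
    refine ⟨J, hp, ?_⟩
    obtain ⟨h1, h2⟩ := le_of_mem_view hp hN hm
    by_contra hne
    exact hJ (mem_view_of_le_of_lt hp (i := k) (by omega)
      (lt_trans (by exact_mod_cast Nat.lt_succ_self k) h2)).2
  · right
    have hp : R ∈ M.procs := ⟨k, hk, hR⟩
    refine ⟨R, hp, ?_⟩
    obtain ⟨h1, h2⟩ := le_of_mem_view hp hk hR
    refine le_antisymm ?_ ?_
    · by_contra! h3
      have := (mem_view_of_le_of_lt hp (i := k + 1) (by omega) h3).2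
      have : R ∈ (M.view (k + 1) : Set Pid) := this
      rw [hR'] at this
      exact this.2 rfl
    · push_cast
      exact Order.add_one_le_of_lt h2

end GroupViews

/-! ### Notifications, forks and the order of events in a computation. -/

namespace GroupComputation

variable {Pid Content Msg : Type*} {H H' : GroupComputation Pid Content Msg}

theorem HasNote.mem_procs {P : Pid} {i : ℕ} (h : H.HasNote P i) : P ∈ H.mem.procs := by
  obtain ⟨c, h⟩ := h
  cases h <;> assumption

theorem HasNote.joinView_le {P : Pid} {i : ℕ} (h : H.HasNote P i) : H.mem.joinView P ≤ i := by
  obtain ⟨c, h⟩ := h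
  cases h with
  | new hP => exact le_rfl
  | joined J hP hJ h₁ h₂ => exact h₁.le
  | removed R _ hP hR hi h₁ h₂ => exact h₁.le
  | dead _ hP hi h =>
    have := GroupViews.joinView_lt_removalView hP
    rw [hi] at this
    exact_mod_cast this.le

theorem HasNote.le_removalView {P : Pid} {i : ℕ} (h : H.HasNote P i) :
    (i : ℕ∞) ≤ H.mem.removalView P := by
  obtain ⟨c, h⟩ := h
  cases h with
  | new hP => exact (GroupViews.joinView_lt_removalView hP).le
  | joined J hP hJ h₁ h₂ => exact h₂.le
  | removed R _ hP hR hi h₁ h₂ => exact h₂.le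
  | dead _ hP hi h => exact hi.ge

/-- Every view change during membership is a joining or a removal, so the notifications of a process
leave no gap between its joining and its removal. -/
theorem hasNote_of_lt {P : Pid} {i : ℕ} (hP : P ∈ H.mem.procs) (h : H.mem.joinView P ≤ i)
    (h' : (i : ℕ∞) < H.mem.removalView P) : H.HasNote P i := by
  rcases h.eq_or_lt with rfl | h
  · exact ⟨_, .new P hP⟩
  · rcases GroupViews.exists_change hP h h' with ⟨J, hJ, rfl⟩ | ⟨R, hR, hi⟩
    · exact ⟨_, .joined P J hP hJ h h'⟩
    · exact ⟨_, .removed P R i hP hR hi h h'⟩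

theorem IsNote.eq_dead {P : Pid} {i : ℕ} {c : Note Pid} (h : H.IsNote P i c)
    (hi : H.mem.removalView P = i) : c = .dead ∧ (H.mem.Removed P ∨ P ∈ H.halting) := by
  cases h with
  | new hP => exact absurd hi (GroupViews.joinView_lt_removalView hP).ne'
  | joined J hP hJ h₁ h₂ => exact absurd hi h₂.ne'
  | removed R _ hP hR hi' h₁ h₂ => exact absurd hi h₂.ne'
  | dead _ hP hi' h => exact ⟨rfl, h⟩

theorem IsNote.congr (hm : H.mem = H'.mem) (hh : H.halting = H'.halting) {P : Pid} {i : ℕ}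
    {c : Note Pid} (h : H.IsNote P i c) : H'.IsNote P i c := by
  cases h with
  | new hP => rw [hm] at *; exact .new P hP
  | joined J hP hJ h₁ h₂ => rw [hm] at *; exact .joined P J hP hJ h₁ h₂
  | removed R _ hP hR hi h₁ h₂ => rw [hm] at *; exact .removed P R i hP hR hi h₁ h₂
  | dead _ hP hi h => rw [hm, hh] at *; exact .dead P i hP hi h

theorem Fork.congr (hm : H.mem = H'.mem) {e f : Event Pid} (h : H.Fork e f) : H'.Fork e f := by
  unfold Fork at *
  rwa [← hm]

theorem Fork.unique {d d' e : Event Pid} (h : H.Fork d e) (h' : H.Fork d' e) : d = d' := by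
  obtain ⟨J, _, _, rfl, rfl⟩ := h
  obtain ⟨J', _, _, rfl, hJ⟩ := h'
  cases hJ
  rfl

theorem Fork.not_isHaltEvent {d e : Event Pid} (h : H.Fork d e) :
    ¬ H.IsHaltEvent d ∧ ¬ H.IsHaltEvent e := by
  obtain ⟨J, hJ, h0, rfl, rfl⟩ := h
  constructor
  · rintro ⟨P, i, hi, he⟩
    cases he
    have := (GroupViews.parent_spec hJ h0).2.2
    exact this.ne' hi
  · rintro ⟨P, i, hi, he⟩
    cases he
    exact (GroupViews.joinView_lt_removalView hJ).ne' hi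

theorem Fork.proc_ne {d e : Event Pid} (h : H.Fork d e) : d.proc ≠ e.proc := by
  obtain ⟨J, hJ, h0, rfl, rfl⟩ := h
  intro h
  have := (GroupViews.parent_spec hJ h0).2.1
  simp only [Event.proc] at h
  rw [h] at this
  exact lt_irrefl _ this

namespace BasicAxioms

variable (B : H.BasicAxioms) {e f g : Event Pid}
include B

theorem mem_left (h : H.le e f) : e ∈ H.events := ((B.minimalOrder e f).1 h).1

theorem mem_right (h : H.le e f) : f ∈ H.events := ((B.minimalOrder e f).1 h).2.1

theorem le_refl (h : e ∈ H.events) : H.le e e := (B.minimalOrder e e).2 ⟨h, h, .refl⟩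

theorem le_trans (h : H.le e f) (h' : H.le f g) : H.le e g := by
  rw [B.minimalOrder] at *
  exact ⟨h.1, h'.2.1, h.2.2.trans h'.2.2⟩

theorem lt_trans (h : H.lt e f) (h' : H.lt f g) : H.lt e g :=
  ⟨B.le_trans h.1 h'.1, fun h'' => h'.2 (B.le_trans h'' h.1)⟩

theorem lt_of_le_of_lt (h : H.le e f) (h' : H.lt f g) : H.lt e g :=
  ⟨B.le_trans h h'.1, fun h'' => h'.2 (B.le_trans h'' h)⟩

theorem lt_of_lt_of_le (h : H.lt e f) (h' : H.le f g) : H.lt e g :=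
  ⟨B.le_trans h.1 h', fun h'' => h.2 (B.le_trans h' h'')⟩

theorem antisymm (hp : e.proc = f.proc) (h : H.le e f) (h' : H.le f e) : e = f :=
  (B.localOrder e (B.mem_left h) f (B.mem_right h) hp).2 h h'

theorem le_or_lt (he : e ∈ H.events) (hf : f ∈ H.events) (hp : e.proc = f.proc) :
    H.le e f ∨ H.lt f e := by
  by_cases h : H.le e f
  · exact .inl h
  · exact .inr ⟨((B.localOrder e he f hf hp).1).resolve_left h, h⟩

theorem lt_of_ne (hp : e.proc = f.proc) (h : H.le e f) (hne : e ≠ f) : H.lt e f :=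
  ⟨h, fun h' => hne (B.antisymm hp h h')⟩

theorem exists_max {S : Set (Event Pid)} (hS : S.Finite) (hne : S.Nonempty) {P : Pid}
    (hP : S ⊆ H.eventsAt P) : ∃ m ∈ S, ∀ f ∈ S, H.le f m := by
  induction S, hS using Set.Finite.induction_on with
  | empty => exact absurd hne Set.not_nonempty_empty
  | @insert a s ha hs ih =>
    have ha' := hP (Set.mem_insert a s)
    rcases s.eq_empty_or_nonempty with rfl | hne'
    · exact ⟨a, by simp, by simpa using B.le_refl ha'.1⟩
    · obtain ⟨m, hm, hm'⟩ := ih hne' fun x hx => hP (Or.inr hx)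
      have hm'' := hP (Or.inr hm)
      rcases B.le_or_lt ha'.1 hm''.1 (ha'.2.trans hm''.2.symm) with h | h
      · refine ⟨m, Or.inr hm, ?_⟩
        rintro f (rfl | hf)
        exacts [h, hm' f hf]
      · refine ⟨a, Or.inl rfl, ?_⟩
        rintro f (rfl | hf)
        exacts [B.le_refl ha'.1, B.le_trans (hm' f hf) h.1]

theorem exists_min {S : Set (Event Pid)} (hS : S.Finite) (hne : S.Nonempty) {P : Pid}
    (hP : S ⊆ H.eventsAt P) : ∃ m ∈ S, ∀ f ∈ S, H.le m f := by
  induction S, hS using Set.Finite.induction_on with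
  | empty => exact absurd hne Set.not_nonempty_empty
  | @insert a s ha hs ih =>
    have ha' := hP (Set.mem_insert a s)
    rcases s.eq_empty_or_nonempty with rfl | hne'
    · exact ⟨a, by simp, by simpa using B.le_refl ha'.1⟩
    · obtain ⟨m, hm, hm'⟩ := ih hne' fun x hx => hP (Or.inr hx)
      have hm'' := hP (Or.inr hm)
      rcases B.le_or_lt ha'.1 hm''.1 (ha'.2.trans hm''.2.symm) with h | h
      · refine ⟨a, Or.inl rfl, ?_⟩
        rintro f (rfl | hf)
        exacts [B.le_refl ha'.1, B.le_trans h (hm' f hf)]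
      · refine ⟨m, Or.inr hm, ?_⟩
        rintro f (rfl | hf)
        exacts [h.1, hm' f hf]

/-- Every event that is not the first one at its process has an immediate predecessor. -/
theorem exists_pred (hp : e.proc = f.proc) (h : H.lt e f) :
    ∃ d, H.Pred d f ∧ H.le e d := by
  have he := B.mem_left h.1
  have hf := B.mem_right h.1
  obtain ⟨d, hd, hmax⟩ := B.exists_max (S := {g | g ∈ H.eventsAt f.proc ∧ H.lt g f})
    (B.orderFoundation.finite f hf) ⟨e, ⟨he, hp⟩, h⟩ (P := f.proc) fun g hg => hg.1
  refine ⟨d, ⟨hd.1.1, hf, hd.1.2, hd.2, ?_⟩, hmax e ⟨⟨he, hp⟩, h⟩⟩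
  rintro g hg ⟨h1, h2⟩
  exact h1.2 (hmax g ⟨⟨hg.1, hg.2.trans hd.1.2⟩, h2⟩)

/-- Every event that is not the last one at its process has an immediate successor. -/
theorem exists_succ (hp : e.proc = f.proc) (h : H.lt e f) :
    ∃ d, H.Pred e d ∧ H.le d f := by
  have he := B.mem_left h.1
  have hf := B.mem_right h.1
  have hS : {g | g ∈ H.eventsAt f.proc ∧ H.lt e g ∧ H.le g f} ⊆
      insert f {g | g ∈ H.eventsAt f.proc ∧ H.lt g f} := by
    rintro g ⟨hg, h1, h2⟩
    by_cases hgf : g = f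
    · exact .inl hgf
    · exact .inr ⟨hg, B.lt_of_ne hg.2 h2 hgf⟩
  obtain ⟨d, hd, hmin⟩ := B.exists_min
    (((B.orderFoundation.finite f hf).insert f).subset hS) ⟨f, ⟨hf, rfl⟩, h, B.le_refl hf⟩
    (P := f.proc) fun g hg => hg.1
  refine ⟨d, ⟨he, hd.1.1, hp.trans hd.1.2.symm, hd.2.1, ?_⟩, hd.2.2⟩
  rintro g hg ⟨h1, h2⟩
  exact h2.2 (hmin g ⟨⟨hg.1, hg.2.trans hp⟩, h1, B.le_trans h2.1 hd.2.2⟩)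

theorem pred_unique {d d' : Event Pid} (h : H.Pred d f) (h' : H.Pred d' f) : d = d' := by
  have hp : d.proc = d'.proc := h.2.2.1.trans h'.2.2.1.symm
  rcases B.le_or_lt h.1 h'.1 hp with h1 | h1
  · by_contra hne
    exact h.2.2.2.2 d' ⟨h'.1, hp.symm⟩ ⟨B.lt_of_ne hp h1 hne, h'.2.2.2.1⟩
  · exact absurd ⟨h1, h.2.2.2.1⟩ (h'.2.2.2.2 d ⟨h.1, hp⟩)

theorem le_of_primitive (h : H.Primitive e f) : H.le e f :=
  (B.minimalOrder e f).2 ⟨h.1, h.2.1, .single (.inl h)⟩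

/-- A halting event is last at its process, it is not a queuing event, and it is neither end of a
fork. Hence no generating step of the order leads from it to another event. This is what permits
halting events to be taken back and appended later. -/
theorem isHaltEvent_maximal (he : H.IsHaltEvent e) (h : H.le e f) : e = f := by
  have := ((B.minimalOrder e f).1 h).2.2
  have heE := B.mem_left h
  clear h
  induction this using Relation.ReflTransGen.head_induction_on with
  | refl => rfl
  | @head a c hac _ ih =>
    have hca : a = c := by
      obtain ⟨P, i, hi, rfl⟩ := he
      rcases hac with ⟨h1, h2, h3⟩ | ⟨h3, h4⟩
      · rcases h3 with ⟨hp, hle⟩ | ⟨k, _, hk, _⟩ | h4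
        · exact B.antisymm hp hle (B.orderFoundation.halt_last P i hi h1 c ⟨h2, hp.symm⟩)
        · cases hk
        · exact absurd ⟨P, i, hi, rfl⟩ h4.not_isHaltEvent.1
      · exact absurd ⟨P, i, hi, rfl⟩ h4.not_isHaltEvent.2
    subst hca
    exact ih he heE

theorem notify_joinView_mem (he : e ∈ H.events) :
    Event.notify e.proc (H.mem.joinView e.proc) ∈ H.events :=
  (B.orderFoundation.join_first e he).1

theorem notify_le {P : Pid} {i i' : ℕ} (hi : H.mem.joinView P ≤ i) (hii : i ≤ i')
    (h : Event.notify P i' ∈ H.events) :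
    Event.notify P i ∈ H.events ∧ H.le (.notify P i) (.notify P i') := by
  rcases hii.eq_or_lt with rfl | hlt
  · exact ⟨h, B.le_refl h⟩
  · have := B.notificationOrder P i i' hi hlt (B.wellFormed.notify_mem P i' h).le_removalView h
    exact ⟨this.1, this.2.1⟩

end BasicAxioms

/-- In a conforming computation a process that does not halt is a member of the last view. -/
theorem Conforming.removalView_eq (C : H.Conforming) {P : Pid} (hP : P ∈ H.mem.procs)
    (hh : P ∉ H.halting) : H.mem.removalView P = H.mem.numViews := by
  refine le_antisymm (GroupViews.removalView_le_numViews hP) ?_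
  by_contra! h
  exact hh (C.halt P hP h)

/-- All processes of a conforming computation halt if one does without being removed. -/
theorem Conforming.halting_of_not_removed (B : H.BasicAxioms) (C : H.Conforming) {P Q : Pid}
    (hP : P ∈ H.halting) (hr : ¬ H.mem.Removed P) (hQ : Q ∈ H.mem.procs) : Q ∈ H.halting := by
  refine (C.channel P (B.wellFormed.halting_sub hP) Q hQ ?_).resolve_left hr
  -- A halting process has queued finitely many packets, so only finitely many can be dequeued at
  -- `Q`, and the channel axiom applies.
  have : {n | Event.queue P n ∈ H.eventsAt P}.Finite := by
    refine Set.Finite.preimage ?_ (B.firstHalting P hP).1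
    intro a _ b _ hab
    cases hab
    rfl
  refine this.subset fun n hn => ?_
  exact ⟨(B.wellFormed.dequeue_mem _ hn).1, rfl⟩

/-- A halting process that is not removed has `numViews` as its removal view. This is finite by
conformity, so there are finitely many processes, and all of them halt by
`Conforming.halting_of_not_removed`. -/
theorem Conforming.stunted_or (B : H.BasicAxioms) (C : H.Conforming) :
    H.Stunted ∨ ∀ P ∈ H.mem.procs, P ∈ H.halting ↔ H.mem.Removed P := by
  by_cases h : ∃ P ∈ H.halting, ¬ H.mem.Removed P
  · obtain ⟨P, hP, hr⟩ := h
    refine .inl ⟨?_, fun Q hQ => C.halting_of_not_removed B hP hr hQ⟩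
    have hPp := B.wellFormed.halting_sub hP
    have hN : H.mem.removalView P = H.mem.numViews :=
      le_antisymm (GroupViews.removalView_le_numViews hPp) (not_lt.1 hr)
    obtain ⟨n, hn⟩ := ENat.ne_top_iff_exists.1 (hN ▸ C.gms P hP)
    refine (H.mem.finite_joinView_le n).subset fun Q hQ => ⟨hQ, ?_⟩
    have := (GroupViews.mem_view_joinView hQ).1
    rw [← hn] at this
    exact_mod_cast this.le
  · push Not at h
    exact .inr fun P hP => ⟨h P, C.halt P hP⟩

/-- The targets of packets are members of a view in which the sender is or will be. -/
theorem LivenessAxiom.removalView_lt (B : H.BasicAxioms) (L : H.LivenessAxiom) {k : Packet Pid}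
    (hk : k ∈ H.packets) : k.tgt ∈ H.mem.procs ∧
      (H.mem.joinView k.src : ℕ∞) < H.mem.removalView k.tgt := by
  obtain ⟨h1, h2, -⟩ := L k.src k.serial k.tgt hk
  have hs : k.src ∈ H.mem.procs := B.wellFormed.proc_mem _ hk.1
  refine ⟨h1, ?_⟩
  rcases h2 with h2 | ⟨h2, -⟩
  · exact (GroupViews.le_of_mem_view h1 (GroupViews.mem_view_joinView hs).1 h2).2
  · have := (B.wellFormed.notify_mem _ _ h2).joinView_le
    exact lt_of_le_of_lt (by exact_mod_cast this) (GroupViews.joinView_lt_removalView h1)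

end GroupComputation

/-! ### Causally closed extensions of a computation. -/

namespace GroupComputation

variable {Pid Content Msg State : Type*}

/-- `H'` extends `H` by events at halting processes that do not causally precede any event of
`H`; no packet of `H` changes its fate. -/
structure Ext (H : GroupComputation Pid Content Msg)
    (after : Event Pid → State × List (Multicast Pid Content))
    (H' : GroupComputation Pid Content Msg)
    (after' : Event Pid → State × List (Multicast Pid Content)) : Prop where
  mem : H'.mem = H.mem
  halting : H'.halting = H.halting
  requests : H'.requests = H.requests
  reqContent : H'.reqContent = H.reqContent
  events : H.events ⊆ H'.events
  targets : ∀ P n, Event.queue P n ∈ H.events → H'.targets P n = H.targets P n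
  content : ∀ P n, Event.queue P n ∈ H.events → H'.content P n = H.content P n
  after : ∀ e ∈ H.events, after' e = after e
  le_iff : ∀ e ∈ H.events, ∀ f ∈ H.events, H'.le e f ↔ H.le e f
  closed : ∀ e f, f ∈ H.events → H'.Primitive e f → e ∈ H.events
  sent : ∀ k ∈ H.packets, k ∈ H'.sent ↔ k ∈ H.sent
  received : ∀ k ∈ H.packets, k ∈ H'.received ↔ k ∈ H.received
  halting_of_new : ∀ e ∈ H'.events, e ∉ H.events → e.proc ∈ H.halting
  dequeue_new : ∀ k, Event.dequeue k ∈ H'.events → Event.dequeue k ∉ H.events →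
    k.src = k.tgt ∨ (H.mem.removalView k.tgt < H.mem.removalView k.src ∧
      ∀ i : ℕ, H.mem.joinView k.tgt ≤ i → (i : ℕ∞) < H.mem.removalView k.tgt →
        Event.notify k.tgt i ∈ H'.events ∧ H'.lt (.notify k.tgt i) (.dequeue k))

namespace Ext

variable {H H' H'' : GroupComputation Pid Content Msg}
  {a a' a'' : Event Pid → State × List (Multicast Pid Content)}

theorem lt_iff (X : Ext H a H' a') {e f : Event Pid} (he : e ∈ H.events) (hf : f ∈ H.events) :
    H'.lt e f ↔ H.lt e f := by
  unfold lt
  rw [X.le_iff e he f hf, X.le_iff f hf e he]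

theorem mem_packets_iff (X : Ext H a H' a') {k : Packet Pid}
    (hk : Event.queue k.src k.serial ∈ H.events) : k ∈ H'.packets ↔ k ∈ H.packets := by
  unfold packets
  simp only [Set.mem_ofPred_eq, X.targets _ _ hk, hk, X.events hk]

theorem packets_subset (X : Ext H a H' a') : H.packets ⊆ H'.packets :=
  fun _ hk => (X.mem_packets_iff hk.1).2 hk

theorem isNote_iff (X : Ext H a H' a') {P : Pid} {i : ℕ} {c : Note Pid} :
    H'.IsNote P i c ↔ H.IsNote P i c :=
  ⟨.congr X.mem X.halting, .congr X.mem.symm X.halting.symm⟩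

theorem hasNote_iff (X : Ext H a H' a') {P : Pid} {i : ℕ} :
    H'.HasNote P i ↔ H.HasNote P i :=
  exists_congr fun _ => X.isNote_iff

theorem fork_iff (X : Ext H a H' a') {e f : Event Pid} : H'.Fork e f ↔ H.Fork e f :=
  ⟨.congr X.mem, .congr X.mem.symm⟩

theorem primitive_iff (X : Ext H a H' a') {e f : Event Pid} (he : e ∈ H.events)
    (hf : f ∈ H.events) : H'.Primitive e f ↔ H.Primitive e f := by
  unfold Primitive
  rw [X.le_iff e he f hf, X.fork_iff]
  simp only [he, hf, X.events he, X.events hf, true_and]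
  refine or_congr_right (or_congr_left (exists_congr fun k => ?_))
  constructor
  · rintro ⟨hk, rfl, rfl⟩
    exact ⟨(X.mem_packets_iff he).1 hk, rfl, rfl⟩
  · rintro ⟨hk, rfl, rfl⟩
    exact ⟨X.packets_subset hk, rfl, rfl⟩

theorem mem_of_le (X : Ext H a H' a') {e f : Event Pid} (he : e ∈ H'.events)
    (hf : f ∈ H.events) (hp : e.proc = f.proc) (h : H'.le e f) : e ∈ H.events :=
  X.closed e f hf ⟨he, X.events hf, .inl ⟨hp, h⟩⟩

theorem mem_of_lt (X : Ext H a H' a') {e f : Event Pid} (he : e ∈ H'.events)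
    (hf : f ∈ H.events) (hp : e.proc = f.proc) (h : H'.lt e f) : e ∈ H.events :=
  X.mem_of_le he hf hp h.1

/-- New events at a process come after all old ones, so immediate predecessors of old events are
unaffected. With this the protocol conditions carry over to extensions. -/
theorem pred_iff (X : Ext H a H' a') {e f : Event Pid} (hf : f ∈ H.events) :
    H'.Pred e f ↔ H.Pred e f := by
  constructor
  · rintro ⟨h1, h2, h3, h4, h5⟩
    have he := X.mem_of_lt h1 hf h3 h4
    refine ⟨he, hf, h3, (X.lt_iff he hf).1 h4, fun g hg h => h5 g ⟨X.events hg.1, hg.2⟩ ?_⟩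
    rwa [X.lt_iff he hg.1, X.lt_iff hg.1 hf]
  · rintro ⟨h1, h2, h3, h4, h5⟩
    refine ⟨X.events h1, X.events hf, h3, (X.lt_iff h1 hf).2 h4, fun g hg h => ?_⟩
    have hgm := X.mem_of_lt hg.1 hf (hg.2.trans h3) h.2
    rw [X.lt_iff h1 hgm, X.lt_iff hgm hf] at h
    exact h5 g ⟨hgm, hg.2⟩ h

theorem mem_of_reaches (X : Ext H a H' a') {e f : Event Pid} (hf : f ∈ H.events)
    (h : H'.Reaches e f) : e ∈ H.events ∧ H.Reaches e f := by
  unfold Reaches at *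
  induction h using Relation.ReflTransGen.head_induction_on with
  | refl => exact ⟨hf, .refl⟩
  | head h _ ih =>
    have he := X.closed _ _ ih.1 h
    exact ⟨he, .head ((X.primitive_iff he ih.1).1 h) ih.2⟩

theorem eventsAt_subset (X : Ext H a H' a') (P : Pid) : H.eventsAt P ⊆ H'.eventsAt P :=
  fun _ h => ⟨X.events h.1, h.2⟩

theorem mem_of_not_halting (X : Ext H a H' a') {e : Event Pid} (hP : e.proc ∉ H.halting)
    (he : e ∈ H'.events) : e ∈ H.events := by
  by_contra h
  exact hP (X.halting_of_new e he h)

theorem refl (H : GroupComputation Pid Content Msg)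
    (a : Event Pid → State × List (Multicast Pid Content)) : Ext H a H a where
  mem := rfl
  halting := rfl
  requests := rfl
  reqContent := rfl
  events := subset_rfl
  targets _ _ _ := rfl
  content _ _ _ := rfl
  after _ _ := rfl
  le_iff _ _ _ _ := Iff.rfl
  closed _ _ _ h := h.1
  sent _ _ := Iff.rfl
  received _ _ := Iff.rfl
  halting_of_new _ h h' := absurd h h'
  dequeue_new _ h h' := absurd h h'

theorem trans (X : Ext H a H' a') (Y : Ext H' a' H'' a'') : Ext H a H'' a'' where
  mem := Y.mem.trans X.mem
  halting := Y.halting.trans X.halting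
  requests := Y.requests.trans X.requests
  reqContent := Y.reqContent.trans X.reqContent
  events := X.events.trans Y.events
  targets P n h := (Y.targets P n (X.events h)).trans (X.targets P n h)
  content P n h := (Y.content P n (X.events h)).trans (X.content P n h)
  after e h := (Y.after e (X.events h)).trans (X.after e h)
  le_iff e he f hf := (Y.le_iff e (X.events he) f (X.events hf)).trans (X.le_iff e he f hf)
  closed e f hf h := by
    have he := Y.closed e f (X.events hf) h
    exact X.closed e f hf ((Y.primitive_iff he (X.events hf)).1 h)
  sent k hk := (Y.sent k (X.packets_subset hk)).trans (X.sent k hk)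
  received k hk := (Y.received k (X.packets_subset hk)).trans (X.received k hk)
  halting_of_new e he he' := by
    by_cases h : e ∈ H'.events
    · exact X.halting_of_new e h he'
    · exact X.halting ▸ Y.halting_of_new e he h
  dequeue_new k hk hk' := by
    by_cases h : Event.dequeue k ∈ H'.events
    · refine (X.dequeue_new k h hk').imp_right fun ⟨h1, h2⟩ => ⟨h1, fun i hi hi' => ?_⟩
      obtain ⟨h3, h4⟩ := h2 i hi hi'
      exact ⟨Y.events h3, (Y.lt_iff h3 h).2 h4⟩
    · have := Y.dequeue_new k hk h
      rwa [X.mem] at this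

end Ext

end GroupComputation

/-! ### Good histories and the transport of callbacks to extensions. -/

namespace Protocol

open GroupComputation

variable {Pid Content Msg State : Type*} (A : Protocol Pid Content Msg State)

/-- A lossless conforming history with its local configurations. -/
structure Good (H : GroupComputation Pid Content Msg)
    (after : Event Pid → State × List (Multicast Pid Content)) : Prop where
  basic : H.BasicAxioms
  generates : A.Generates H after
  live : H.LivenessAxiom
  conforming : H.Conforming
  lossless : H.Lossless

variable {A}

theorem Handles.congr {H H' : GroupComputation Pid Content Msg} (hm : H'.mem = H.mem)
    (hh : H'.halting = H.halting) (hr : H'.reqContent = H.reqContent) {e : Event Pid}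
    (hc : ∀ k, e = .dequeue k → H'.content k.src k.serial = H.content k.src k.serial)
    {s : State} {x : State × List (Multicast Pid Content)} (h : A.Handles H e s x) :
    A.Handles H' e s x := by
  cases h with
  | notify P i c _ h => rw [← hm]; exact .notify P i c s (h.congr hm.symm hh.symm)
  | dequeue k => rw [← hc k rfl]; exact .dequeue k s
  | request P r => rw [← hr]; exact .request P r s

theorem LocalStep.congr {H H' : GroupComputation Pid Content Msg} (hm : H'.mem = H.mem)
    (hh : H'.halting = H.halting) (hr : H'.reqContent = H.reqContent) {e : Event Pid}
    (hc : ∀ k, e = .dequeue k → H'.content k.src k.serial = H.content k.src k.serial)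
    (hq : ∀ P n, e = .queue P n →
      H'.targets P n = H.targets P n ∧ H'.content P n = H.content P n)
    {x y : State × List (Multicast Pid Content)} (h : A.LocalStep H x e y) :
    A.LocalStep H' x e y := by
  cases h with
  | trigger s _ _ h => exact .trigger s e y (h.congr hm hh hr hc)
  | queue s m l P n ht hct =>
    have := hq P n rfl
    exact .queue s m l P n (this.1.trans ht) (this.2.trans hct)

end Protocol

namespace GroupComputation

open Protocol

variable {Pid Content Msg State : Type*} {A : Protocol Pid Content Msg State}
  {H H' : GroupComputation Pid Content Msg}
  {a a' : Event Pid → State × List (Multicast Pid Content)}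

theorem Ext.handles (B : H.BasicAxioms) (X : Ext H a H' a') {e : Event Pid} (he : e ∈ H.events)
    {s : State} {x : State × List (Multicast Pid Content)} (h : A.Handles H e s x) :
    A.Handles H' e s x := by
  refine h.congr X.mem X.halting X.reqContent ?_
  rintro k rfl
  exact X.content _ _ (B.wellFormed.dequeue_mem k he).1

theorem Ext.localStep (B : H.BasicAxioms) (X : Ext H a H' a') {e : Event Pid}
    (he : e ∈ H.events) {x y : State × List (Multicast Pid Content)}
    (h : A.LocalStep H x e y) : A.LocalStep H' x e y := by
  refine h.congr X.mem X.halting X.reqContent ?_ ?_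
  · rintro k rfl
    exact X.content _ _ (B.wellFormed.dequeue_mem k he).1
  · rintro P n rfl
    exact ⟨X.targets _ _ he, X.content _ _ he⟩

/-! ### Limits of increasing sequences -/

/-- The first member of a sequence of computations in which an event occurs. -/
noncomputable def firstIndex (Hs : ℕ → GroupComputation Pid Content Msg) (e : Event Pid) : ℕ :=
  sInf {n | e ∈ (Hs n).events}

theorem mem_firstIndex {Hs : ℕ → GroupComputation Pid Content Msg} {e : Event Pid} {n : ℕ}
    (h : e ∈ (Hs n).events) :
    firstIndex Hs e ≤ n ∧ e ∈ (Hs (firstIndex Hs e)).events :=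
  ⟨Nat.sInf_le h, Nat.sInf_mem (s := {n | e ∈ (Hs n).events}) ⟨n, h⟩⟩

/-- The limit of a sequence of lossless computations, each an extension of the previous one. -/
noncomputable def limit (Hs : ℕ → GroupComputation Pid Content Msg) :
    GroupComputation Pid Content Msg where
  mem := (Hs 0).mem
  halting := (Hs 0).halting
  requests := (Hs 0).requests
  reqContent := (Hs 0).reqContent
  targets P n := (Hs (firstIndex Hs (.queue P n))).targets P n
  content P n := (Hs (firstIndex Hs (.queue P n))).content P n
  sent := {k | ∃ n, k ∈ (Hs n).sent}
  received := {k | ∃ n, k ∈ (Hs n).received}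
  dropped := ∅
  events := {e | ∃ n, e ∈ (Hs n).events}
  le e f := ∃ n, (Hs n).le e f

section limit

variable {Hs : ℕ → GroupComputation Pid Content Msg}
  {as : ℕ → Event Pid → State × List (Multicast Pid Content)}

theorem exists_common (X : ∀ m n, m ≤ n → Ext (Hs m) (as m) (Hs n) (as n)) {e f : Event Pid}
    (he : e ∈ (limit Hs).events) (hf : f ∈ (limit Hs).events) (m : ℕ) :
    ∃ n, m ≤ n ∧ e ∈ (Hs n).events ∧ f ∈ (Hs n).events := by
  obtain ⟨n, hn⟩ := he
  obtain ⟨n', hn'⟩ := hf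
  exact ⟨max m (max n n'), by simp, (X n _ (by simp)).events hn, (X n' _ (by simp)).events hn'⟩

/-- The limit extends each member of the sequence. -/
theorem ext_limit (X : ∀ m n, m ≤ n → Ext (Hs m) (as m) (Hs n) (as n))
    (G : ∀ n, A.Good (Hs n) (as n)) (m : ℕ) :
    Ext (Hs m) (as m) (limit Hs) (fun e => as (firstIndex Hs e) e) := by
  have hle : ∀ m, ∀ e ∈ (Hs m).events, ∀ f ∈ (Hs m).events,
      (limit Hs).le e f ↔ (Hs m).le e f := by
    refine fun m e he f hf => ⟨fun ⟨n, hn⟩ => ?_, fun h => ⟨m, h⟩⟩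
    have h1 := (G n).basic.mem_left hn
    have h2 := (G n).basic.mem_right hn
    rcases le_total m n with h | h
    · exact ((X m n h).le_iff e he f hf).1 hn
    · exact ((X n m h).le_iff e h1 f h2).2 hn
  have htar : ∀ m P n, Event.queue P n ∈ (Hs m).events →
      (limit Hs).targets P n = (Hs m).targets P n := fun m P n h => by
    obtain ⟨h1, h2⟩ := mem_firstIndex h
    exact ((X _ _ h1).targets P n h2).symm
  have hpk : ∀ m k, k ∈ (limit Hs).packets → Event.queue k.src k.serial ∈ (Hs m).events →
      k ∈ (Hs m).packets := fun m k hk h => ⟨h, htar m _ _ h ▸ hk.2⟩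
  refine
    { mem := (X 0 m m.zero_le).mem.symm
      halting := (X 0 m m.zero_le).halting.symm
      requests := (X 0 m m.zero_le).requests.symm
      reqContent := (X 0 m m.zero_le).reqContent.symm
      events := fun e he => ⟨m, he⟩
      targets := htar m
      content := fun P n h => ?_
      after := fun e he => ?_
      le_iff := hle m
      closed := ?_
      sent := fun k hk => ⟨fun ⟨n, hn⟩ => ?_, fun h => ⟨m, h⟩⟩
      received := fun k hk => ⟨fun ⟨n, hn⟩ => ?_, fun h => ⟨m, h⟩⟩
      halting_of_new := ?_
      dequeue_new := ?_ }
  · obtain ⟨h1, h2⟩ := mem_firstIndex h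
    exact ((X _ _ h1).content P n h2).symm
  · obtain ⟨h1, h2⟩ := mem_firstIndex he
    exact ((X _ _ h1).after e h2).symm
  · intro e f hf h
    obtain ⟨n, hmn, hen, hfn⟩ := exists_common X h.1 h.2.1 m
    refine (X m n hmn).closed e f hf ⟨hen, hfn, ?_⟩
    rcases h.2.2 with ⟨hp, hl⟩ | ⟨k, hk, rfl, rfl⟩ | h
    · exact .inl ⟨hp, (hle n e hen f hfn).1 hl⟩
    · exact .inr (.inl ⟨k, hpk n k hk hen, rfl, rfl⟩)
    · exact .inr (.inr (h.congr (X 0 n n.zero_le).mem.symm))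
  · rcases le_total m n with h | h
    · exact ((X m n h).sent k hk).1 hn
    · exact ((X n m h).sent k ((G n).basic.wellFormed.sent_sub hn)).2 hn
  · rcases le_total m n with h | h
    · exact ((X m n h).received k hk).1 hn
    · exact ((X n m h).received k ((G n).basic.wellFormed.sent_sub
        ((G n).basic.wellFormed.received_sub hn))).2 hn
  · intro e he hem
    obtain ⟨n, hmn, hen, -⟩ := exists_common X he he m
    exact (X m n hmn).halting_of_new e hen hem
  · intro k hk hkm
    obtain ⟨n, hmn, hen, -⟩ := exists_common X hk hk m
    refine ((X m n hmn).dequeue_new k hen hkm).imp_right fun ⟨h1, h2⟩ => ⟨h1, fun i hi hi' => ?_⟩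
    obtain ⟨h3, h4⟩ := h2 i hi hi'
    exact ⟨⟨n, h3⟩, (hle n _ h3 _ hen).2 h4.1, fun h => h4.2 ((hle n _ hen _ h3).1 h)⟩

/-- Most axioms concern finitely many events, which occur together at some stage; there the axiom
holds, and `ext_limit` carries it over. Only the finiteness of halting processes can be lost in a
limit, hence the hypothesis `hfin`. -/
theorem limit_basic (X : ∀ m n, m ≤ n → Ext (Hs m) (as m) (Hs n) (as n))
    (G : ∀ n, A.Good (Hs n) (as n))
    (hfin : ∀ P ∈ (Hs 0).halting, ∃ m, ∀ n, ∀ e ∈ (Hs n).eventsAt P, e ∈ (Hs m).events) :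
    (limit Hs).BasicAxioms := by
  have Y := ext_limit X G
  have Z : ∀ n, _ := fun n => (G n).basic
  have lift1 : ∀ {e}, e ∈ (limit Hs).events → ∃ n, e ∈ (Hs n).events := fun h => h
  have lift2 : ∀ {e f}, e ∈ (limit Hs).events → f ∈ (limit Hs).events →
      ∃ n, e ∈ (Hs n).events ∧ f ∈ (Hs n).events := fun he hf => by
    obtain ⟨n, -, h⟩ := exists_common X he hf 0
    exact ⟨n, h⟩
  have hprim : ∀ {e f}, (limit Hs).Primitive e f → ∃ n, (Hs n).Primitive e f := by
    intro e f h
    obtain ⟨n, h1, h2⟩ := lift2 h.1 h.2.1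
    exact ⟨n, ((Y n).primitive_iff h1 h2).1 h⟩
  have pk_iff : ∀ n k, Event.queue k.src k.serial ∈ (Hs n).events →
      (k ∈ (limit Hs).packets ↔ k ∈ (Hs n).packets) := fun n k h => (Y n).mem_packets_iff h
  refine ⟨?_, ?_, ?_, ?_, ?_, ?_, ?_, ?_, ?_, ?_, ?_, ?_, ?_, ?_⟩
  · refine ⟨(Z 0).wellFormed.halting_sub, ?_, ?_, ?_, ?_, ?_, ?_, ?_, ?_⟩
    · intro e he
      obtain ⟨n, hn⟩ := lift1 he
      rw [(Y n).mem]
      exact (Z n).wellFormed.proc_mem e hn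
    · intro k hk
      obtain ⟨n, hn⟩ := lift1 hk
      exact (Y n).packets_subset ((Z n).wellFormed.dequeue_mem k hn)
    · intro P i h
      obtain ⟨n, hn⟩ := lift1 h
      exact (Y n).hasNote_iff.2 ((Z n).wellFormed.notify_mem P i hn)
    · intro P r h
      obtain ⟨n, hn⟩ := lift1 h
      rw [(Y n).requests]
      exact (Z n).wellFormed.request_mem P r hn
    · rintro k ⟨n, hn⟩
      exact (Y n).packets_subset ((Z n).wellFormed.sent_sub hn)
    · rintro k ⟨n, hn⟩
      exact ⟨n, (Z n).wellFormed.received_sub hn⟩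
    · intro P i h
      exact absurd h (Set.notMem_empty _)
    · intro P hP h
      exact ⟨0, (Z 0).wellFormed.original P hP h⟩
  · intro k hk
    obtain ⟨n, hn⟩ := lift1 hk
    exact ((Y n).lt_iff ((Z n).wellFormed.dequeue_mem k hn).1 hn).2 ((Z n).packetEvent k hn)
  · intro P Q m n hm hn hlt hd
    obtain ⟨N, h1, h2⟩ := lift2 hd hm.1
    have hn' : Event.queue P n ∈ (Hs N).events := ((Z N).wellFormed.dequeue_mem _ h1).1
    have := (Z N).packetOrder P Q m n ((pk_iff N ⟨P, m, Q⟩ h2).1 hm)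
      ((pk_iff N ⟨P, n, Q⟩ hn').1 hn) (((Y N).lt_iff h2 hn').1 hlt) h1
    exact ⟨⟨N, this.1⟩, ((Y N).lt_iff this.1 h1).2 this.2⟩
  · intro P i i' hi hii hi' h
    obtain ⟨n, hn⟩ := lift1 h
    rw [(Y n).mem] at hi hi'
    have := (Z n).notificationOrder P i i' hi hii hi' hn
    exact ⟨⟨n, this.1⟩, ((Y n).lt_iff this.1 hn).2 this.2⟩
  · intro e f hef hf
    obtain ⟨n, hn⟩ := lift1 hf
    have := (Z n).parent e f ((Y n).fork_iff.1 hef) hn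
    exact ⟨⟨n, this.1⟩, ((Y n).le_iff _ this.1 _ hn).2 this.2.1,
      ((Y n).le_iff _ hn _ this.1).2 this.2.2⟩
  · intro e he f hf hp
    obtain ⟨n, h1, h2⟩ := lift2 he hf
    rw [(Y n).le_iff e h1 f h2, (Y n).le_iff f h2 e h1]
    exact (Z n).localOrder e h1 f h2 hp
  · intro P n Q hd i hi
    have hq : Event.queue P n ∈ (limit Hs).events := by
      obtain ⟨N, hN⟩ := lift1 hd
      exact ⟨N, ((Z N).wellFormed.dequeue_mem _ hN).1⟩
    obtain ⟨N, h1, h2⟩ := lift2 hd hq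
    rw [(Y N).mem] at *
    have := (Z N).piggyback P n Q h1 i (hi.imp_right fun ⟨h3, h4⟩ => by
      have h3' := (Y N).mem_of_lt h3 h2 rfl h4
      exact ⟨h3', ((Y N).lt_iff h3' h2).1 h4⟩)
    exact this.imp_right fun ⟨h3, h4⟩ => ⟨⟨N, h3⟩, ((Y N).lt_iff h3 h1).2 h4⟩
  · intro P n i hk hi hlt
    obtain ⟨N, h1, h2⟩ := lift2 hi hk.1
    have := (Z N).selfChannel P n i ((pk_iff N _ h2).1 hk) h1 (((Y N).lt_iff h2 h1).1 hlt)
    exact ⟨⟨N, this.1⟩, ((Y N).lt_iff this.1 h1).2 this.2⟩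
  · refine ⟨?_, ?_, ?_⟩
    · intro e he
      obtain ⟨n, hn⟩ := lift1 he
      refine ((Z n).orderFoundation.finite e hn).subset ?_
      rintro f ⟨hf, hlt⟩
      have := (Y n).mem_of_lt hf.1 hn hf.2 hlt
      exact ⟨⟨this, hf.2⟩, ((Y n).lt_iff this hn).1 hlt⟩
    · intro e he
      obtain ⟨n, hn⟩ := lift1 he
      have := (Z n).orderFoundation.join_first e hn
      rw [(Y n).mem]
      exact ⟨⟨n, this.1⟩, ((Y n).le_iff _ this.1 _ hn).2 this.2⟩
    · intro P i hi h e he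
      obtain ⟨n, h1, h2⟩ := lift2 h he.1
      rw [(Y n).mem] at hi
      exact ((Y n).le_iff _ h2 _ h1).2
        ((Z n).orderFoundation.halt_last P i hi h1 e ⟨h2, he.2⟩)
  · intro e f
    constructor
    · rintro ⟨n, hn⟩
      obtain ⟨h1, h2, h3⟩ := ((Z n).minimalOrder e f).1 hn
      refine ⟨⟨n, h1⟩, ⟨n, h2⟩, Relation.ReflTransGen.mono ?_ _ _ h3⟩
      rintro b c (h | ⟨h, h'⟩)
      · exact .inl (((Y n).primitive_iff h.1 h.2.1).2 h)
      · exact .inr ⟨((Y n).primitive_iff h.1 h.2.1).2 h, (Y n).fork_iff.2 h'⟩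
    · rintro ⟨h1, h2, h3⟩
      obtain ⟨n, hn, -⟩ := lift2 h1 h1
      clear h2
      induction h3 with
      | refl => exact ⟨n, (Z n).le_refl hn⟩
      | @tail b c _ hbc ih =>
        obtain ⟨m, hm⟩ := ih
        have : ∃ m', (Hs m').le b c := by
          rcases hbc with h | ⟨h, h'⟩
          · obtain ⟨m', hm'⟩ := hprim h
            exact ⟨m', (Z m').le_of_primitive hm'⟩
          · obtain ⟨m', hm'⟩ := hprim h
            exact ⟨m', ((Z m').parent _ _ ((Y m').fork_iff.1 h') hm'.2.1).2.2⟩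
        obtain ⟨m', hm'⟩ := this
        refine ⟨max m m', (Z _).le_trans (f := b) ?_ ?_⟩
        · exact ((X m _ (le_max_left ..)).le_iff _ ((Z m).mem_left hm) _ ((Z m).mem_right hm)).2 hm
        · exact ((X m' _ (le_max_right ..)).le_iff _ ((Z m').mem_left hm') _
            ((Z m').mem_right hm')).2 hm'
  -- The events at a halting process are all present at one stage `m`, where they are finite in
  -- number.
  · intro P hP
    refine ⟨?_, ((Z 0).firstHalting P hP).2⟩
    obtain ⟨m, hm⟩ := hfin P hP
    have hP : P ∈ (Hs m).halting := (X 0 m m.zero_le).halting ▸ hP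
    refine ((Z m).firstHalting P hP).1.subset ?_
    rintro e ⟨⟨n, hn⟩, rfl⟩
    exact ⟨hm n e ⟨hn, rfl⟩, rfl⟩
  -- The progress conditions concern processes that do not halt. These receive no new events, so
  -- stage 0 already satisfies them.
  · refine ⟨fun P i h => absurd h (Set.notMem_empty _), fun P hP hh i hi _ => ⟨0, ?_⟩⟩
    refine (Z 0).secondHalting.2 P hP hh i ((Y 0).hasNote_iff.1 hi) fun j _ => ?_
    rw [(G 0).lossless.no_dropped_notifications]
    exact Set.notMem_empty _
  · refine ⟨?_, ?_, ?_⟩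
    · intro k hk hh
      have h0 := (Y 0).mem_of_not_halting (e := .queue k.src k.serial) hh hk.1
      exact ⟨0, (Z 0).thirdHalting.sent k ((pk_iff 0 k h0).1 hk) hh⟩
    · intro k hk
      obtain ⟨n, hn⟩ := lift1 hk
      exact ⟨n, (Z n).thirdHalting.dequeue k hn⟩
    · intro P n Q hQ hk hP hQh hr
      have hq := (Y 0).mem_of_not_halting (e := .queue P n) hP hk.1
      refine ⟨0, (Z 0).thirdHalting.progress P n Q hQ ((pk_iff 0 _ hq).1 hk) hP hQh ?_⟩
      intro m hm hle
      exact ((Y 0).received _ hm).1 (hr m ((Y 0).packets_subset hm) ⟨0, hle⟩)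
  · intro P hP hh r hr
    exact ⟨0, (Z 0).fourthHalting P hP hh r hr⟩

/-- The immediate predecessor of an event and its local configuration are settled at the first stage
in which the event occurs. -/
theorem limit_generates (X : ∀ m n, m ≤ n → Ext (Hs m) (as m) (Hs n) (as n))
    (G : ∀ n, A.Good (Hs n) (as n)) :
    A.Generates (limit Hs) (fun e => as (firstIndex Hs e) e) := by
  have Y := ext_limit X G
  refine ⟨?_, ?_, ?_, ?_⟩
  · intro P hP h0
    have hm := (G 0).basic.wellFormed.original P hP h0
    have := (Y 0).handles (G 0).basic hm ((G 0).generates.original P hP h0)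
    rwa [← (Y 0).after _ hm] at this
  · rintro d e f hde hef ⟨n, hn⟩
    have hef' := (Y n).fork_iff.1 hef
    have he := ((G n).basic.parent e f hef' hn).1
    have hde' := ((Y n).pred_iff he).1 hde
    have := (Y n).handles (G n).basic hn ((G n).generates.forked d e f hde' hef' hn)
    rwa [← (Y n).after _ hn, ← (Y n).after _ hde'.1] at this
  · intro e f hef
    obtain ⟨n, hn⟩ := hef.2.1
    have h := ((Y n).pred_iff hn).1 hef
    have := (Y n).localStep (G n).basic hn ((G n).generates.step e f h)
    rwa [← (Y n).after _ hn, ← (Y n).after _ h.1] at this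
  · rintro e ⟨n, hn⟩ hh hlast
    have := (G n).generates.complete e hn ((X 0 n n.zero_le).halting ▸ hh) fun f hf =>
      ((Y n).le_iff f hf.1 e hn).1 (hlast f ⟨⟨n, hf.1⟩, hf.2⟩)
    rwa [← (Y n).after _ hn] at this

theorem limit_conforming (X : ∀ m n, m ≤ n → Ext (Hs m) (as m) (Hs n) (as n))
    (G : ∀ n, A.Good (Hs n) (as n)) : (limit Hs).Conforming := by
  have Y := ext_limit X G
  have C := (G 0).conforming
  refine ⟨?_, ?_, ?_, C.gms, ?_, C.halt⟩
  · intro P hP Q hQ h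
    exact C.channel P hP Q hQ (h.subset fun n hn => ⟨0, hn⟩)
  · intro P n Q i hi h1 h2 h3
    obtain ⟨N, -, hN1, hN2⟩ := exists_common X h1 h2 0
    exact (G N).conforming.packet P n Q i ((Y N).isNote_iff.1 hi) hN1 hN2
      (((Y N).lt_iff hN1 hN2).1 h3)
  · intro P i h
    exact absurd h (Set.notMem_empty _)
  · intro P hP h
    refine C.parent P hP (Set.eq_empty_of_subset_empty ?_)
    exact h ▸ (Y 0).eventsAt_subset P

theorem limit_lossless (X : ∀ m n, m ≤ n → Ext (Hs m) (as m) (Hs n) (as n))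
    (G : ∀ n, A.Good (Hs n) (as n)) : (limit Hs).Lossless := by
  have Y := ext_limit X G
  refine ⟨?_, rfl, ?_, ?_⟩
  · rintro k ⟨n, hn⟩
    exact ⟨n, (G n).lossless.no_dropped_packets hn⟩
  · rintro k ⟨n, hn⟩ h
    refine ⟨n, (G n).lossless.upstream k hn ?_⟩
    unfold Upstream at *
    rwa [(Y n).mem] at h
  · rintro k hk h
    obtain ⟨n, hn⟩ := hk.1
    refine ⟨n, (G n).lossless.downstream k (((Y n).mem_packets_iff hn).1 hk) ?_⟩
    unfold Downstream at *
    rwa [(Y n).mem] at h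

end limit

end GroupComputation

/-! ### Appending a single event at a halting process. -/

namespace GroupComputation

open Protocol

variable {Pid Content Msg State : Type*}

/-- The events of `H` by which an event `e` that is appended to `H` is directly preceded. -/
def Before (H : GroupComputation Pid Content Msg) (d e : Event Pid) : Prop :=
  d ∈ H.events ∧ (d.proc = e.proc ∨
    (∃ k ∈ H.packets, e = .dequeue k ∧ d = .queue k.src k.serial) ∨ H.Fork d e)

open Classical in
/-- Appends an event at the end of a process.  If it is the queuing of a multicast then the targets
and the content are `tg` and `ct`, and the packets on downstream channels are sent and received. -/
noncomputable def append (H : GroupComputation Pid Content Msg) (e : Event Pid) (tg : Finset Pid)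
    (ct : Content) : GroupComputation Pid Content Msg :=
  { H with
    targets := fun P n => if .queue P n = e then tg else H.targets P n
    content := fun P n => if .queue P n = e then ct else H.content P n
    sent := H.sent ∪ {k | .queue k.src k.serial = e ∧ k.tgt ∈ tg ∧ H.Downstream k.src k.tgt}
    received :=
      H.received ∪ {k | .queue k.src k.serial = e ∧ k.tgt ∈ tg ∧ H.Downstream k.src k.tgt}
    events := insert e H.events
    le := fun f g => H.le f g ∨ (g = e ∧ (f = e ∨ ∃ d, H.Before d e ∧ H.le f d)) ∨
      (f = e ∧ ∃ d ∈ H.events, H.Fork d e ∧ H.le d g) }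

/-- `e` is the last event at `P`. -/
def IsLast (H : GroupComputation Pid Content Msg) (P : Pid) (e : Event Pid) : Prop :=
  e ∈ H.eventsAt P ∧ ∀ f ∈ H.eventsAt P, H.le f e

/-- The event `e` can be appended to `H`, resulting in the local configuration `x`. -/
structure CanAppend (A : Protocol Pid Content Msg State) (H : GroupComputation Pid Content Msg)
    (after : Event Pid → State × List (Multicast Pid Content)) (e : Event Pid) (tg : Finset Pid)
    (ct : Content) (x : State × List (Multicast Pid Content)) : Prop where
  halting : e.proc ∈ H.halting
  fresh : e ∉ H.events
  not_halted : ∀ i : ℕ, H.mem.removalView e.proc = i → Event.notify e.proc i ∉ H.events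
  dequeue : ∀ k, e = .dequeue k → k ∈ H.received ∧
    (∀ m, ⟨k.src, m, k.tgt⟩ ∈ H.packets → H.lt (.queue k.src m) (.queue k.src k.serial) →
      Event.dequeue ⟨k.src, m, k.tgt⟩ ∈ H.events) ∧
    (k.src = k.tgt ∨ (H.mem.removalView k.tgt < H.mem.removalView k.src ∧
      ∀ i : ℕ, H.mem.joinView k.tgt ≤ i → (i : ℕ∞) < H.mem.removalView k.tgt →
        Event.notify k.tgt i ∈ H.events))
  notify : ∀ P i, e = .notify P i → H.HasNote P i ∧
    (∀ i', H.mem.joinView P ≤ i' → i' < i → Event.notify P i' ∈ H.events) ∧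
    ∀ n, ⟨P, n, P⟩ ∈ H.packets → Event.dequeue ⟨P, n, P⟩ ∈ H.events
  request : ∀ P r, e = .request P r → r ∈ H.requests P
  step : (∃ d, H.IsLast e.proc d ∧ A.LocalStep (H.append e tg ct) (after d) e x) ∨
    (H.eventsAt e.proc = ∅ ∧ ∃ d p, H.Fork d e ∧ d ∈ H.events ∧ H.Pred p d ∧
      A.Handles (H.append e tg ct) e (after p).1 x)

section append

variable {A : Protocol Pid Content Msg State} {H : GroupComputation Pid Content Msg}
  {after : Event Pid → State × List (Multicast Pid Content)} {e : Event Pid} {tg : Finset Pid}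
  {ct : Content} {x : State × List (Multicast Pid Content)}

/-- A join event is the first event of its process, so as long as it is missing there are no others.
-/
theorem eventsAt_eq_empty_of_fork (B : H.BasicAxioms) (hfr : e ∉ H.events) {d : Event Pid}
    (h : H.Fork d e) : H.eventsAt e.proc = ∅ := by
  obtain ⟨J, hJ, h0, rfl, rfl⟩ := h
  refine Set.eq_empty_of_forall_notMem fun f hf => hfr ?_
  have := B.notify_joinView_mem hf.1
  rwa [hf.2] at this

theorem append_le_old (hfr : e ∉ H.events) {f g : Event Pid} (hf : f ∈ H.events)
    (hg : g ∈ H.events) : (H.append e tg ct).le f g ↔ H.le f g := by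
  have h1 : f ≠ e := fun h => hfr (h ▸ hf)
  have h2 : g ≠ e := fun h => hfr (h ▸ hg)
  simp [append, h1, h2]

theorem append_le_new (B : H.BasicAxioms) {f : Event Pid} (h : H.Before f e) :
    (H.append e tg ct).le f e :=
  .inr (.inl ⟨rfl, .inr ⟨f, h, B.le_refl h.1⟩⟩)

/-- The order, unlike causality, can place a new event below an old one, but only when the new event
is a join event: it is contemporaneous with the notification event of the parent. -/
theorem append_new_le (B : H.BasicAxioms) (hfr : e ∉ H.events) {f : Event Pid}
    (hf : f ∈ H.events) (h : (H.append e tg ct).le e f) : ∃ d ∈ H.events, H.Fork d e := by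
  rcases h with h | ⟨h, -⟩ | ⟨-, d, hd, h, -⟩
  · exact absurd (B.mem_left h) hfr
  · exact absurd (h ▸ hf) hfr
  · exact ⟨d, hd, h⟩

theorem append_le_trans (B : H.BasicAxioms) (hfr : e ∉ H.events) {b c d : Event Pid}
    (h : (H.append e tg ct).le b c) (h' : (H.append e tg ct).le c d) :
    (H.append e tg ct).le b d := by
  -- If `e` is a join event then the parent's notification is the only event directly before it. A
  -- chain of old events that passes through `e` therefore enters and leaves at the same old event
  -- and creates no new relation.
  have key : ∀ {d d'}, H.Fork d e → H.Before d' e → d' = d := by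
    rintro d d' hf ⟨hd, h | ⟨k, -, rfl, -⟩ | h⟩
    · exact absurd ⟨hd, h⟩
        (Set.eq_empty_iff_forall_notMem.1 (eventsAt_eq_empty_of_fork B hfr hf) d')
    · obtain ⟨J, _, _, _, h⟩ := hf
      cases h
    · exact h.unique hf
  rcases h with h | ⟨rfl, rfl | ⟨p, hp, hbp⟩⟩ | ⟨rfl, p, hp, hf, hpc⟩
  · rcases h' with h' | ⟨rfl, rfl | ⟨q, hq, hcq⟩⟩ | ⟨rfl, -⟩
    · exact .inl (B.le_trans h h')
    · exact absurd (B.mem_right h) hfr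
    · exact .inr (.inl ⟨rfl, .inr ⟨q, hq, B.le_trans h hcq⟩⟩)
    · exact absurd (B.mem_right h) hfr
  · exact h'
  · rcases h' with h' | ⟨rfl, -⟩ | ⟨-, q, hq, hf, hqd⟩
    · exact absurd (B.mem_left h') hfr
    · exact .inr (.inl ⟨rfl, .inr ⟨p, hp, hbp⟩⟩)
    · rw [key hf hp] at hbp
      exact .inl (B.le_trans hbp hqd)
  · rcases h' with h' | ⟨rfl, -⟩ | ⟨rfl, -⟩
    · exact .inr (.inr ⟨rfl, p, hp, hf, B.le_trans hpc h'⟩)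
    · exact .inr (.inl ⟨rfl, .inl rfl⟩)
    · exact absurd (B.mem_right hpc) hfr

theorem append_mem_packets_iff (hfr : e ∉ H.events) {k : Packet Pid} :
    k ∈ (H.append e tg ct).packets ↔
      k ∈ H.packets ∨ (.queue k.src k.serial = e ∧ k.tgt ∈ tg) := by
  by_cases h : Event.queue k.src k.serial = e
  · have : k ∉ H.packets := fun h' => hfr (h ▸ h'.1)
    simp [packets, append, h] at this ⊢
    exact fun h => absurd h hfr
  · simp [packets, append, h]

theorem append_primitive_of_before (B : H.BasicAxioms) (hfr : e ∉ H.events) {d : Event Pid}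
    (h : H.Before d e) : (H.append e tg ct).Primitive d e := by
  refine ⟨.inr h.1, .inl rfl, ?_⟩
  rcases h.2 with hp | ⟨k, hk, rfl, rfl⟩ | hf
  · exact .inl ⟨hp, append_le_new B h⟩
  · exact .inr (.inl ⟨k, (append_mem_packets_iff hfr).2 (.inl hk), rfl, rfl⟩)
  · exact .inr (.inr hf)

theorem append_primitive_old (B : H.BasicAxioms) (hfr : e ∉ H.events) {f g : Event Pid}
    (hg : g ∈ H.events) (h : (H.append e tg ct).Primitive f g) :
    f ∈ H.events ∧ H.Primitive f g := by
  obtain ⟨h1, h2, h3⟩ := h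
  have hf : f ∈ H.events := by
    rcases h1 with rfl | h1
    · exfalso
      rcases h3 with ⟨hp, hle⟩ | ⟨k, hk, rfl, rfl⟩ | h3
      · obtain ⟨d, hd, hfk⟩ := append_new_le B hfr hg hle
        exact (eventsAt_eq_empty_of_fork B hfr hfk ▸ Set.notMem_empty g) ⟨hg, hp.symm⟩
      · exact hfr (B.wellFormed.dequeue_mem k hg).1
      · exact hfr (B.parent _ _ h3 hg).1
    · exact h1
  refine ⟨hf, hf, hg, ?_⟩
  rcases h3 with ⟨hp, hle⟩ | ⟨k, hk, rfl, rfl⟩ | h3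
  · exact .inl ⟨hp, (append_le_old hfr hf hg).1 hle⟩
  · refine .inr (.inl ⟨k, ?_, rfl, rfl⟩)
    exact ((append_mem_packets_iff hfr).1 hk).resolve_right fun h => hfr (h.1 ▸ hf)
  · exact .inr (.inr h3)

/-- The clauses in the order of `append` are the old chains, the old chains prolonged by one step to
`e`, and the reversed fork step from `e` prolonged by an old chain. By `append_le_trans` these are
closed under composition, so nothing else is generated. -/
theorem append_minimalOrder (B : H.BasicAxioms) (hfr : e ∉ H.events) :
    (H.append e tg ct).MinimalOrderAxiom := by
  have hprim : ∀ {f g}, H.Primitive f g → (H.append e tg ct).Primitive f g := by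
    rintro f g ⟨hf, hg, h⟩
    refine ⟨.inr hf, .inr hg, ?_⟩
    rcases h with ⟨hp, hle⟩ | ⟨k, hk, rfl, rfl⟩ | h3
    · exact .inl ⟨hp, (append_le_old hfr hf hg).2 hle⟩
    · exact .inr (.inl ⟨k, (append_mem_packets_iff hfr).2 (.inl hk), rfl, rfl⟩)
    · exact .inr (.inr h3)
  have hold : ∀ {f g}, H.le f g → Relation.ReflTransGen (fun a b =>
      (H.append e tg ct).Primitive a b ∨
        ((H.append e tg ct).Primitive b a ∧ (H.append e tg ct).Fork b a)) f g := by
    intro f g h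
    refine Relation.ReflTransGen.mono ?_ _ _ ((B.minimalOrder f g).1 h).2.2
    rintro b c (h | ⟨h, h'⟩)
    exacts [.inl (hprim h), .inr ⟨hprim h, h'⟩]
  have hee : (H.append e tg ct).le e e := .inr (.inl ⟨rfl, .inl rfl⟩)
  intro f g
  constructor
  · rintro (h | ⟨rfl, rfl | ⟨d, hd, hfd⟩⟩ | ⟨rfl, d, hd, hf, hdg⟩)
    · exact ⟨.inr (B.mem_left h), .inr (B.mem_right h), hold h⟩
    · exact ⟨.inl rfl, .inl rfl, .refl⟩
    · exact ⟨.inr (B.mem_left hfd), .inl rfl,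
        (hold hfd).tail (.inl (append_primitive_of_before B hfr hd))⟩
    · exact ⟨.inl rfl, .inr (B.mem_right hdg), .head (.inr
        ⟨append_primitive_of_before B hfr ⟨hd, .inr (.inr hf)⟩, hf⟩) (hold hdg)⟩
  · rintro ⟨h1, h2, h3⟩
    have hrefl : ∀ f ∈ (H.append e tg ct).events, (H.append e tg ct).le f f := by
      rintro f (rfl | hf)
      exacts [hee, .inl (B.le_refl hf)]
    have hbef : ∀ {b}, b ∈ (H.append e tg ct).events → H.Fork b e → H.Before b e := by
      rintro b (rfl | hb) h
      · exact absurd rfl h.proc_ne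
      · exact ⟨hb, .inr (.inr h)⟩
    have hgen : ∀ {b c}, (H.append e tg ct).Primitive b c → (H.append e tg ct).le b c := by
      rintro b c h
      rcases h.2.1 with rfl | hc
      · rcases h.2.2 with ⟨_, hle⟩ | ⟨k, hk, rfl, rfl⟩ | h3
        · exact hle
        · have hk' : k ∈ H.packets :=
            ((append_mem_packets_iff hfr).1 hk).resolve_right fun h => by cases h.1
          exact append_le_new B ⟨hk'.1, .inr (.inl ⟨k, hk', rfl, rfl⟩)⟩
        · exact append_le_new B (hbef h.1 h3)
      · exact .inl (B.le_of_primitive (append_primitive_old B hfr hc h).2)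
    induction h3 with
    | refl => exact hrefl f h1
    | @tail b c hb hbc ih =>
      have hbm : b ∈ (H.append e tg ct).events := by
        rcases hbc with h | ⟨h, -⟩
        exacts [h.1, h.2.1]
      refine append_le_trans B hfr (ih hbm) ?_
      rcases hbc with h | ⟨h, h'⟩
      · exact hgen h
      · rcases h.2.1 with rfl | hb'
        · exact .inr (.inr ⟨rfl, c, (hbef h.1 h').1, h', B.le_refl (hbef h.1 h').1⟩)
        · exact .inl (B.parent _ _ h' hb').2.2

namespace CanAppend

variable (C : CanAppend A H after e tg ct x)
include C

open Classical in
theorem ext (B : H.BasicAxioms) :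
    Ext H after (H.append e tg ct) (Function.update after e x) := by
  have hne : ∀ f ∈ H.events, f ≠ e := fun f hf h => C.fresh (h ▸ hf)
  have hpk : ∀ k ∈ H.packets, ¬ .queue k.src k.serial = e := fun k hk => hne _ hk.1
  refine
    { mem := rfl
      halting := rfl
      requests := rfl
      reqContent := rfl
      events := fun f hf => .inr hf
      targets := fun P n h => if_neg (hne _ h)
      content := fun P n h => if_neg (hne _ h)
      after := fun f hf => Function.update_of_ne (hne f hf) _ _
      le_iff := fun f hf g hg => append_le_old C.fresh hf hg
      closed := fun f g hg h => (append_primitive_old B C.fresh hg h).1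
      sent := fun k hk => by simp [append, hpk k hk]
      received := fun k hk => by simp [append, hpk k hk]
      halting_of_new := ?_
      dequeue_new := ?_ }
  · rintro f (rfl | hf) h
    exacts [C.halting, absurd hf h]
  · rintro k (hk | hk) h
    · subst hk
      refine (C.dequeue k rfl).2.2.imp_right fun ⟨h1, h2⟩ => ⟨h1, fun i hi hi' => ?_⟩
      have hn := h2 i hi hi'
      refine ⟨.inr hn, append_le_new B ⟨hn, .inl rfl⟩, fun hle => ?_⟩
      -- A dequeuing is not a join event, so it precedes no old event.
      obtain ⟨d, _, J, _, _, _, hd⟩ := append_new_le B C.fresh hn hle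
      cases hd
    · exact absurd hk h

theorem lt_new (B : H.BasicAxioms) {f : Event Pid} (hf : f ∈ H.eventsAt e.proc) :
    (H.append e tg ct).lt f e := by
  refine ⟨append_le_new B ⟨hf.1, .inl hf.2⟩, fun h => ?_⟩
  obtain ⟨d, hd, h⟩ := append_new_le B C.fresh hf.1 h
  exact (eventsAt_eq_empty_of_fork B C.fresh h ▸ Set.notMem_empty f) hf

theorem wellFormed (B : H.BasicAxioms) : (H.append e tg ct).WellFormed := by
  have W := B.wellFormed
  have X := C.ext B
  refine ⟨W.halting_sub, ?_, ?_, ?_, ?_, ?_, ?_, ?_, ?_⟩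
  · rintro f (rfl | hf)
    exacts [W.halting_sub C.halting, W.proc_mem f hf]
  · rintro k (hk | hk)
    · exact X.packets_subset (W.sent_sub (W.received_sub (C.dequeue k hk.symm).1))
    · exact X.packets_subset (W.dequeue_mem k hk)
  · rintro P i (h | h)
    · exact X.hasNote_iff.2 (C.notify P i h.symm).1
    · exact X.hasNote_iff.2 (W.notify_mem P i h)
  · rintro P r (h | h)
    exacts [C.request P r h.symm, W.request_mem P r h]
  · rintro k (h | h)
    · exact X.packets_subset (W.sent_sub h)
    · exact (append_mem_packets_iff C.fresh).2 (.inr ⟨h.1, h.2.1⟩)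
  · rintro k (h | h)
    exacts [.inl (W.received_sub h), .inr h]
  · exact fun P i h => X.hasNote_iff.2 (W.dropped_sub P i h)
  · exact fun P hP h => .inr (W.original P hP h)

theorem packetEvent (B : H.BasicAxioms) : (H.append e tg ct).PacketEventAxiom := by
  have X := C.ext B
  rintro k (hk | hk)
  · subst hk
    have hk := B.wellFormed.sent_sub (B.wellFormed.received_sub (C.dequeue k rfl).1)
    refine ⟨append_le_new B ⟨hk.1, .inr (.inl ⟨k, hk, rfl, rfl⟩)⟩, fun h => ?_⟩
    obtain ⟨d, _, J, _, _, _, hd⟩ := append_new_le B C.fresh hk.1 h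
    cases hd
  · exact (X.lt_iff (B.wellFormed.dequeue_mem k hk).1 hk).2 (B.packetEvent k hk)

theorem packetOrder (B : H.BasicAxioms) : (H.append e tg ct).PacketOrderAxiom := by
  have X := C.ext B
  rintro P Q m n hm hn hlt (hd | hd)
  · have hk := B.wellFormed.sent_sub (B.wellFormed.received_sub (C.dequeue _ hd.symm).1)
    have hqm := X.mem_of_lt hm.1 hk.1 rfl hlt
    have := (C.dequeue _ hd.symm).2.1 m ((X.mem_packets_iff hqm).1 hm)
      ((X.lt_iff hqm hk.1).1 hlt)
    refine ⟨.inr this, ?_⟩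
    rw [hd]
    exact C.lt_new B ⟨this, hd ▸ rfl⟩
  · have hk := B.wellFormed.dequeue_mem _ hd
    have hqm := X.mem_of_lt hm.1 hk.1 rfl hlt
    have := B.packetOrder P Q m n ((X.mem_packets_iff hqm).1 hm) hk
      ((X.lt_iff hqm hk.1).1 hlt) hd
    exact ⟨.inr this.1, (X.lt_iff this.1 hd).2 this.2⟩

theorem notificationOrder (B : H.BasicAxioms) :
    (H.append e tg ct).NotificationOrderAxiom := by
  have X := C.ext B
  rintro P i i' hi hii hi' (h | h)
  · have := (C.notify P i' h.symm).2.1 i hi hii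
    refine ⟨.inr this, ?_⟩
    rw [h]
    exact C.lt_new B ⟨this, h ▸ rfl⟩
  · have := B.notificationOrder P i i' hi hii hi' h
    exact ⟨.inr this.1, (X.lt_iff this.1 h).2 this.2⟩

theorem parent (B : H.BasicAxioms) : (H.append e tg ct).ParentAxiom := by
  have X := C.ext B
  rintro d f hdf (rfl | hf)
  · have hdf' : H.Fork d f := hdf
    have hd : d ∈ H.events := by
      rcases C.step with ⟨p, hp, -⟩ | ⟨-, d', p, hd', hd, -⟩
      · exact absurd hp.1 (eventsAt_eq_empty_of_fork B C.fresh hdf' ▸ Set.notMem_empty _)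
      · rwa [hdf'.unique hd']
    exact ⟨.inr hd, append_le_new B ⟨hd, .inr (.inr hdf')⟩,
      .inr (.inr ⟨rfl, d, hd, hdf', B.le_refl hd⟩)⟩
  · obtain ⟨h1, h2, h3⟩ := B.parent d f hdf hf
    exact ⟨.inr h1, .inl h2, .inl h3⟩

theorem localOrder (B : H.BasicAxioms) : (H.append e tg ct).LocalOrderAxiom := by
  have X := C.ext B
  rintro f (rfl | hf) g (rfl | hg) hp
  · exact ⟨.inl (.inr (.inl ⟨rfl, .inl rfl⟩)), fun _ _ => rfl⟩
  · have := C.lt_new B ⟨hg, hp.symm⟩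
    exact ⟨.inr this.1, fun h => absurd h this.2⟩
  · have := C.lt_new B ⟨hf, hp⟩
    exact ⟨.inl this.1, fun _ h => absurd h this.2⟩
  · rw [X.le_iff f hf g hg, X.le_iff g hg f hf]
    exact B.localOrder f hf g hg hp

/-- On the self channel the axiom is clear. On another channel the target has already processed all
notifications before its removal view, and by liveness the sender can have processed only such
notifications before it queued the packet. -/
theorem piggyback (B : H.BasicAxioms) (L : H.LivenessAxiom) :
    (H.append e tg ct).PiggybackAxiom := by
  have X := C.ext B
  rintro P n Q (hd | hd) i hi
  · have hk := B.wellFormed.sent_sub (B.wellFormed.received_sub (C.dequeue _ hd.symm).1)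
    have hi : i ≤ H.mem.joinView P ∨ (Event.notify P i ∈ H.events ∧
        H.lt (.notify P i) (.queue P n)) := by
      refine hi.imp_right fun ⟨h3, h4⟩ => ?_
      have h3' := X.mem_of_lt h3 hk.1 rfl h4
      exact ⟨h3', (X.lt_iff h3' hk.1).1 h4⟩
    suffices h : i ≤ H.mem.joinView Q ∨ Event.notify Q i ∈ H.events by
      refine h.imp_right fun h => ⟨.inr h, ?_⟩
      rw [hd]
      exact C.lt_new B ⟨h, hd ▸ rfl⟩
    rcases (C.dequeue _ hd.symm).2.2 with hPQ | ⟨hr, hn⟩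
    · obtain rfl : P = Q := hPQ
      exact hi.imp_right And.left
    · dsimp only at hr hn
      obtain ⟨hQ, hjr⟩ := L.removalView_lt B hk
      dsimp only at hQ hjr
      obtain ⟨r, hr'⟩ := ENat.ne_top_iff_exists.1 hr.ne_top
      rw [← hr'] at hr hn hjr
      -- If `i` were at least the removal view `r` of the target, then the sender would have
      -- processed the removal before queuing the packet, against liveness.
      have hir : i < r := by
        have hjr' : H.mem.joinView P < r := by exact_mod_cast hjr
        rcases hi with hi | ⟨h1, h2⟩
        · omega
        · by_contra! hri
          obtain ⟨h3, h4⟩ := B.notify_le hjr'.le hri h1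
          have h5 := (L P n Q hk).2.2 r hr'.symm h3
          exact (B.lt_trans h5 (B.lt_of_le_of_lt h4 h2)).2 (B.le_refl hk.1)
      rcases le_total i (H.mem.joinView Q) with h | h
      · exact .inl h
      · exact .inr (hn i h (by exact_mod_cast hir))
  · have hk := B.wellFormed.dequeue_mem _ hd
    refine (B.piggyback P n Q hd i (hi.imp_right fun ⟨h3, h4⟩ => ?_)).imp_right
      fun ⟨h3, h4⟩ => ⟨.inr h3, (X.lt_iff h3 hd).2 h4⟩
    have h3' := X.mem_of_lt h3 hk.1 rfl h4
    exact ⟨h3', (X.lt_iff h3' hk.1).1 h4⟩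

theorem selfChannel (B : H.BasicAxioms) : (H.append e tg ct).SelfChannelAxiom := by
  have X := C.ext B
  rintro P n i hk (hi | hi) hlt
  · have hq : Event.queue P n ∈ H.events := by
      rcases hk.1 with h | h
      · rw [← hi] at h
        cases h
      · exact h
    have := (C.notify P i hi.symm).2.2 n ((X.mem_packets_iff hq).1 hk)
    refine ⟨.inr this, ?_⟩
    rw [hi]
    exact C.lt_new B ⟨this, hi ▸ rfl⟩
  · have hq := X.mem_of_lt hk.1 hi rfl hlt
    have := B.selfChannel P n i ((X.mem_packets_iff hq).1 hk) hi ((X.lt_iff hq hi).1 hlt)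
    exact ⟨.inr this.1, (X.lt_iff this.1 hi).2 this.2⟩

theorem orderFoundation (B : H.BasicAxioms) : (H.append e tg ct).OrderFoundationAxiom := by
  have X := C.ext B
  refine ⟨?_, ?_, ?_⟩
  · rintro f (rfl | hf)
    · refine (B.firstHalting _ C.halting).1.subset ?_
      rintro g ⟨⟨rfl | hg, hp⟩, hlt⟩
      · exact absurd hlt.1 hlt.2
      · exact ⟨hg, hp⟩
    · refine (B.orderFoundation.finite f hf).subset ?_
      rintro g ⟨hg, hlt⟩
      have := X.mem_of_lt hg.1 hf hg.2 hlt
      exact ⟨⟨this, hg.2⟩, (X.lt_iff this hf).1 hlt⟩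
  · rintro f (rfl | hf)
    · rcases C.step with ⟨d, hd, -⟩ | ⟨-, d, p, hd, -⟩
      · have := B.notify_joinView_mem hd.1.1
        rw [hd.1.2] at this
        exact ⟨.inr this, append_le_new B ⟨this, .inl rfl⟩⟩
      · obtain ⟨J, hJ, h0, rfl, rfl⟩ := hd
        exact ⟨.inl rfl, .inr (.inl ⟨rfl, .inl rfl⟩)⟩
    · have := B.orderFoundation.join_first f hf
      exact ⟨.inr this.1, .inl this.2⟩
  · rintro P i hi hm f ⟨hf, hp⟩
    rcases hm with hm | hm
    · rcases hf with rfl | hf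
      · rw [hm]
        exact .inr (.inl ⟨rfl, .inl rfl⟩)
      · rw [hm]
        exact append_le_new B ⟨hf, .inl (by rw [← hm, hp]; rfl)⟩
    · rcases hf with rfl | hf
      · subst hp
        exact absurd hm (C.not_halted i hi)
      · exact .inl (B.orderFoundation.halt_last P i hi hm f ⟨hf, hp⟩)

theorem basic (B : H.BasicAxioms) (L : H.LivenessAxiom) (hd : H.dropped = ∅) :
    (H.append e tg ct).BasicAxioms := by
  have X := C.ext B
  refine ⟨C.wellFormed B, C.packetEvent B, C.packetOrder B, C.notificationOrder B, C.parent B,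
    C.localOrder B, C.piggyback B L, C.selfChannel B, C.orderFoundation B,
    append_minimalOrder B C.fresh, ?_, ?_, ?_, ?_⟩
  · refine fun P hP => ⟨((B.firstHalting P hP).1.insert e).subset ?_, (B.firstHalting P hP).2⟩
    rintro f ⟨rfl | hf, hp⟩
    exacts [.inl rfl, .inr ⟨hf, hp⟩]
  · refine ⟨fun P i h => ?_, fun P hP hh i hi h => .inr ?_⟩
    · change (P, i) ∈ H.dropped at h
      rw [hd] at h
      exact absurd h (Set.notMem_empty _)
    · exact B.secondHalting.2 P hP hh i (X.hasNote_iff.1 hi) h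
  · refine ⟨?_, ?_, ?_⟩
    · intro k hk hh
      have hq := X.mem_of_not_halting (e := .queue k.src k.serial) hh hk.1
      exact .inl (B.thirdHalting.sent k ((X.mem_packets_iff hq).1 hk) hh)
    · rintro k (hk | hk)
      exacts [.inl (C.dequeue k hk.symm).1, .inl (B.thirdHalting.dequeue k hk)]
    · intro P n Q hQ hk hP hQh hr
      have hq := X.mem_of_not_halting (e := .queue P n) hP hk.1
      refine .inr (B.thirdHalting.progress P n Q hQ ((X.mem_packets_iff hq).1 hk) hP hQh ?_)
      intro m hm hle
      exact (X.received _ hm).1 (hr m (X.packets_subset hm) (.inl hle))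
  · exact fun P hP hh r hr => .inr (B.fourthHalting P hP hh r hr)

open Classical in
theorem generates (B : H.BasicAxioms) (Ge : A.Generates H after) :
    A.Generates (H.append e tg ct) (Function.update after e x) := by
  have X := C.ext B
  refine ⟨?_, ?_, ?_, ?_⟩
  · intro P hP h0
    have hm := B.wellFormed.original P hP h0
    have := X.handles B hm (Ge.original P hP h0)
    rwa [← X.after _ hm] at this
  · rintro d f g hdf hfg (rfl | hg)
    · rcases C.step with ⟨p, hp, -⟩ | ⟨-, d', p, hd', hd, hp, hh⟩
      · exact absurd hp.1 (eventsAt_eq_empty_of_fork B C.fresh hfg ▸ Set.notMem_empty _)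
      · obtain rfl := Fork.unique (H := H) hfg hd'
        have hdf' := (X.pred_iff hd).1 hdf
        obtain rfl := B.pred_unique hp hdf'
        rw [X.after _ hp.1, Function.update_self]
        exact hh
    · have hf := (B.parent f g hfg hg).1
      have hdf' := (X.pred_iff hf).1 hdf
      have := X.handles B hg (Ge.forked d f g hdf' hfg hg)
      rwa [← X.after _ hg, ← X.after _ hdf'.1] at this
  · intro f g hfg
    rcases hfg.2.1 with rfl | hg
    · have hf : f ∈ H.eventsAt g.proc := by
        refine ⟨?_, hfg.2.2.1⟩
        rcases hfg.1 with rfl | h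
        · exact absurd hfg.2.2.2.1.1 hfg.2.2.2.1.2
        · exact h
      rcases C.step with ⟨p, hp, hs⟩ | ⟨h0, -⟩
      · have hpf : p = f := by
          by_contra hne
          refine hfg.2.2.2.2 p ⟨.inr hp.1.1, hp.1.2.trans hf.2.symm⟩ ⟨?_, C.lt_new B hp.1⟩
          rw [X.lt_iff hf.1 hp.1.1]
          exact B.lt_of_ne (hf.2.trans hp.1.2.symm) (hp.2 f hf) (Ne.symm hne)
        subst hpf
        rw [X.after _ hf.1, Function.update_self]
        exact hs
      · exact absurd hf (h0 ▸ Set.notMem_empty f)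
    · have h := (X.pred_iff hg).1 hfg
      have := X.localStep B hg (Ge.step f g h)
      rwa [← X.after _ hg, ← X.after _ h.1] at this
  · rintro f (rfl | hf) hh hlast
    · exact absurd C.halting hh
    · rw [X.after _ hf]
      exact Ge.complete f hf hh fun g hg =>
        (X.le_iff g hg.1 f hf).1 (hlast g ⟨.inr hg.1, hg.2⟩)

/-- A new packet dequeued at `P` comes from `P` itself or from a process with a larger removal view.
At `P` there is no notification of the removal of either. -/
theorem conforming (B : H.BasicAxioms) (Co : H.Conforming) :
    (H.append e tg ct).Conforming := by
  have X := C.ext B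
  refine ⟨?_, ?_, Co.notification, Co.gms, ?_, Co.halt⟩
  · exact fun P hP Q hQ h => Co.channel P hP Q hQ (h.subset fun n hn => .inr hn)
  · rintro P n Q i hi h1 (h2 | h2) h3
    · have hi := X.isNote_iff.1 hi
      cases hi with
      | removed _ _ hP hR hi hj hlt =>
        rcases (C.dequeue _ h2.symm).2.2 with h | ⟨h, -⟩
        · dsimp only at h
          rw [← h, hi] at hlt
          exact lt_irrefl _ hlt
        · dsimp only at h
          rw [hi] at h
          exact lt_asymm h hlt
    · have hp : (Event.notify P i).proc = (Event.dequeue ⟨Q, n, P⟩ : Event Pid).proc := rfl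
      have h1' := X.mem_of_lt h1 h2 hp h3
      exact Co.packet P n Q i (X.isNote_iff.1 hi) h1' h2 ((X.lt_iff h1' h2).1 h3)
  · intro P hP h
    refine Co.parent P hP (Set.eq_empty_of_subset_empty ?_)
    exact h ▸ X.eventsAt_subset P

/-- Since `append` sends new packets on downstream channels only, the condition on received upstream
packets concerns old packets alone. -/
theorem lossless (Lo : H.Lossless) : (H.append e tg ct).Lossless := by
  refine ⟨?_, Lo.no_dropped_notifications, ?_, ?_⟩
  · rintro k (hk | hk)
    exacts [.inl (Lo.no_dropped_packets hk), .inr hk]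
  · rintro k (hk | hk) h
    · exact .inr (Lo.upstream k hk h)
    · rcases hk.2.2 with h' | h'
      · exact absurd h.1 (not_le.2 h')
      · exact absurd h' h.2
  · intro k hk h
    rcases (append_mem_packets_iff C.fresh).1 hk with hk | hk
    · exact .inl (Lo.downstream k hk h)
    · exact .inr ⟨hk.1, hk.2, h⟩

-- Checking the other axioms for the appended event uses liveness of the old history only. Liveness
-- of the new one can therefore be obtained at the end from `RespectsLiveness`.
open Classical in
theorem good (hlive : A.RespectsLiveness) (G : A.Good H after) :
    A.Good (H.append e tg ct) (Function.update after e x) := by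
  have B' := C.basic G.basic G.live G.lossless.no_dropped_notifications
  have G' := C.generates G.basic G.generates
  have C' := C.conforming G.basic G.conforming
  exact ⟨B', G', hlive _ ⟨B', _, G'⟩ C', C', C.lossless G.lossless⟩

end CanAppend

end append

end GroupComputation

/-! ### Taking back halting events and dropped items. -/

namespace GroupComputation

open Protocol

variable {Pid Content Msg State : Type*}

/-- The computation without halting events and without dropped packets and notifications: a packet
is sent and received if and only if it is dequeued or its channel is downstream. -/
def undropped (H : GroupComputation Pid Content Msg) : GroupComputation Pid Content Msg :=
  { H with
    sent := {k | k ∈ H.packets ∧ (.dequeue k ∈ H.events ∨ H.Downstream k.src k.tgt)}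
    received := {k | k ∈ H.packets ∧ (.dequeue k ∈ H.events ∨ H.Downstream k.src k.tgt)}
    dropped := ∅
    events := {e | e ∈ H.events ∧ ¬ H.IsHaltEvent e}
    le := fun e f => H.le e f ∧ ¬ H.IsHaltEvent e ∧ ¬ H.IsHaltEvent f }

variable {A : Protocol Pid Content Msg State} {H : GroupComputation Pid Content Msg}
  {after : Event Pid → State × List (Multicast Pid Content)} {e f : Event Pid}

theorem not_isHaltEvent_queue {P : Pid} {n : ℕ} : ¬ H.IsHaltEvent (.queue P n) := by
  rintro ⟨P, i, -, h⟩
  cases h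

theorem not_isHaltEvent_dequeue {k : Packet Pid} : ¬ H.IsHaltEvent (.dequeue k) := by
  rintro ⟨P, i, -, h⟩
  cases h

theorem not_isHaltEvent_request {P : Pid} {r : ℕ} : ¬ H.IsHaltEvent (.request P r) := by
  rintro ⟨P, i, -, h⟩
  cases h

theorem isHaltEvent_notify_iff {P : Pid} {i : ℕ} :
    H.IsHaltEvent (.notify P i) ↔ H.mem.removalView P = i := by
  constructor
  · rintro ⟨P, i, h, h'⟩
    cases h'
    exact h
  · exact fun h => ⟨P, i, h, rfl⟩

theorem not_isHaltEvent_notify_of_lt {P : Pid} {i : ℕ} (h : (i : ℕ∞) < H.mem.removalView P) :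
    ¬ H.IsHaltEvent (.notify P i) := fun h' => h.ne' (isHaltEvent_notify_iff.1 h')

theorem proc_mem_halting_of_isHaltEvent (B : H.BasicAxioms) (C : H.Conforming)
    (he : e ∈ H.events) (h : H.IsHaltEvent e) : e.proc ∈ H.halting := by
  obtain ⟨P, i, hi, rfl⟩ := h
  obtain ⟨c, hc⟩ := B.wellFormed.notify_mem P i he
  exact (hc.eq_dead hi).2.elim (C.halt P (B.wellFormed.proc_mem _ he)) id

/-- Between two processes that do not halt, all packets are dequeued. -/
theorem dequeue_mem_of_not_halting (B : H.BasicAxioms) (C : H.Conforming) {P Q : Pid} {n : ℕ}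
    (hk : ⟨P, n, Q⟩ ∈ H.packets) (hQp : Q ∈ H.mem.procs) (hP : P ∉ H.halting)
    (hQ : Q ∉ H.halting) : Event.dequeue ⟨P, n, Q⟩ ∈ H.events := by
  have hPp : P ∈ H.mem.procs := B.wellFormed.proc_mem _ hk.1
  -- The channel carries infinitely many dequeued packets, but only finitely many are queued before
  -- the given one. So the given packet or a later one is dequeued, and FIFO gives the claim.
  have hinf : ¬ {m | Event.dequeue ⟨P, m, Q⟩ ∈ H.events}.Finite := fun h =>
    (C.channel P hPp Q hQp h).elim (fun h => hP (C.halt P hPp h)) hQ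
  have hfin : {m | Event.queue P m ∈ {f | f ∈ H.eventsAt P ∧ H.lt f (.queue P n)}}.Finite := by
    refine Set.Finite.preimage ?_ (B.orderFoundation.finite _ hk.1)
    intro a _ b _ hab
    cases hab
    rfl
  obtain ⟨m, hm, hm'⟩ : ∃ m, Event.dequeue ⟨P, m, Q⟩ ∈ H.events ∧
      ¬ H.lt (.queue P m) (.queue P n) := by
    by_contra! h
    exact hinf (hfin.subset fun m hm =>
      ⟨⟨(B.wellFormed.dequeue_mem _ hm).1, rfl⟩, h m hm⟩)
  have hmk := B.wellFormed.dequeue_mem _ hm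
  have hle := (B.le_or_lt hk.1 hmk.1 rfl).resolve_right hm'
  by_cases hne : n = m
  · exact hne ▸ hm
  · refine (B.packetOrder P Q n m hk hmk (B.lt_of_ne rfl hle ?_) hm).1
    intro h
    cases h
    exact hne rfl

section undropped

theorem undropped_lt_iff (he : ¬ H.IsHaltEvent e) (hf : ¬ H.IsHaltEvent f) :
    H.undropped.lt e f ↔ H.lt e f := by
  simp [lt, undropped, he, hf]

theorem undropped_le_iff (he : ¬ H.IsHaltEvent e) (hf : ¬ H.IsHaltEvent f) :
    H.undropped.le e f ↔ H.le e f := by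
  simp [undropped, he, hf]

theorem undropped_packets : H.undropped.packets = H.packets := by
  ext k
  simp [packets, undropped, not_isHaltEvent_queue]

theorem undropped_isNote_iff {P : Pid} {i : ℕ} {c : Note Pid} :
    H.undropped.IsNote P i c ↔ H.IsNote P i c := ⟨.congr (H := H.undropped) (H' := H) rfl rfl,
    .congr (H := H) (H' := H.undropped) rfl rfl⟩

theorem not_isHaltEvent_of_le (B : H.BasicAxioms) (h : H.le e f) (hf : ¬ H.IsHaltEvent f) :
    ¬ H.IsHaltEvent e := fun he => hf (B.isHaltEvent_maximal he h ▸ he)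

theorem undropped_pred_iff (B : H.BasicAxioms) (hf : ¬ H.IsHaltEvent f) :
    H.undropped.Pred e f ↔ H.Pred e f := by
  constructor
  · rintro ⟨h1, h2, h3, h4, h5⟩
    refine ⟨h1.1, h2.1, h3, (undropped_lt_iff h1.2 hf).1 h4, fun g hg h => ?_⟩
    have := not_isHaltEvent_of_le B h.2.1 hf
    exact h5 g ⟨⟨hg.1, this⟩, hg.2⟩ ⟨(undropped_lt_iff h1.2 this).2 h.1,
      (undropped_lt_iff this hf).2 h.2⟩
  · rintro ⟨h1, h2, h3, h4, h5⟩
    have he := not_isHaltEvent_of_le B h4.1 hf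
    refine ⟨⟨h1, he⟩, ⟨h2, hf⟩, h3, (undropped_lt_iff he hf).2 h4, fun g hg h => ?_⟩
    exact h5 g ⟨hg.1.1, hg.2⟩
      ⟨(undropped_lt_iff he hg.1.2).1 h.1, (undropped_lt_iff hg.1.2 hf).1 h.2⟩

theorem undropped_primitive_iff (he : ¬ H.IsHaltEvent e) (hf : ¬ H.IsHaltEvent f) :
    H.undropped.Primitive e f ↔ H.Primitive e f := by
  unfold Primitive
  rw [undropped_le_iff he hf, undropped_packets]
  have h1 : e ∈ H.undropped.events ↔ e ∈ H.events := and_iff_left he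
  have h2 : f ∈ H.undropped.events ↔ f ∈ H.events := and_iff_left hf
  rw [h1, h2]
  rfl

/-- All members of a generating chain that ends in an event other than a halting event precede that
event, so by maximality none of them is a halting event, and the chain survives. -/
theorem undropped_minimalOrder (B : H.BasicAxioms) : H.undropped.MinimalOrderAxiom := by
  intro e f
  constructor
  · rintro ⟨h, he, hf⟩
    obtain ⟨h1, h2, h3⟩ := (B.minimalOrder e f).1 h
    refine ⟨⟨h1, he⟩, ⟨h2, hf⟩, ?_⟩
    clear h h2 he
    induction h3 using Relation.ReflTransGen.head_induction_on with
    | refl => exact .refl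
    | @head a b hab hbf ih =>
      have hb : b ∈ H.events := by
        rcases hab with h | ⟨h, -⟩
        exacts [h.2.1, h.1]
      have hf' : f ∈ H.events := by
        rcases Relation.ReflTransGen.cases_tail hbf with h | ⟨c, -, h | ⟨h, -⟩⟩
        exacts [h ▸ hb, h.2.1, h.1]
      have hbf' := (B.minimalOrder b f).2 ⟨hb, hf', hbf⟩
      have hbh := not_isHaltEvent_of_le B hbf' hf
      have hab' : H.le a b := by
        rcases hab with h | ⟨h, h'⟩
        exacts [B.le_of_primitive h, (B.parent _ _ h' h.2.1).2.2]
      have hah := not_isHaltEvent_of_le B hab' hbh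
      refine .head ?_ (ih hb)
      rcases hab with h | ⟨h, h'⟩
      · exact .inl ((undropped_primitive_iff hah hbh).2 h)
      · exact .inr ⟨(undropped_primitive_iff hbh hah).2 h, h'⟩
  · rintro ⟨h1, h2, h3⟩
    refine ⟨(B.minimalOrder e f).2 ⟨h1.1, h2.1, ?_⟩, h1.2, h2.2⟩
    refine Relation.ReflTransGen.mono ?_ _ _ h3
    rintro a b (h | ⟨h, h'⟩)
    · exact .inl ((undropped_primitive_iff h.1.2 h.2.1.2).1 h)
    · exact .inr ⟨(undropped_primitive_iff h.1.2 h.2.1.2).1 h, h'⟩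

/-- If the target halts then it is removed, since otherwise all processes would halt. The source
remains until the end, so the channel is downstream. If the target does not halt then the packet is
dequeued. -/
theorem sent_mem_undropped (B : H.BasicAxioms) (L : H.LivenessAxiom) (C : H.Conforming)
    {k : Packet Pid} (hk : k ∈ H.packets) (hh : k.src ∉ H.halting) : k ∈ H.undropped.sent := by
  refine ⟨hk, ?_⟩
  obtain ⟨hQ, -⟩ := L.removalView_lt B hk
  by_cases hQh : k.tgt ∈ H.halting
  · right
    left
    rw [C.removalView_eq (P := k.src) (B.wellFormed.proc_mem _ hk.1) hh]
    by_contra h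
    exact hh (C.halting_of_not_removed B hQh h (B.wellFormed.proc_mem _ hk.1))
  · exact .inl (dequeue_mem_of_not_halting B C hk hQ hh hQh)

theorem undropped_wellFormed (B : H.BasicAxioms) : H.undropped.WellFormed := by
  have W := B.wellFormed
  refine ⟨W.halting_sub, fun e he => W.proc_mem e he.1, ?_, ?_, fun P r h => W.request_mem P r h.1,
    ?_, fun _ h => h, fun P i h => absurd h (Set.notMem_empty _), ?_⟩
  · intro k hk
    rw [undropped_packets]
    exact W.dequeue_mem k hk.1
  · rintro P i ⟨h, -⟩
    obtain ⟨c, hc⟩ := W.notify_mem P i h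
    exact ⟨c, undropped_isNote_iff.2 hc⟩
  · intro k hk
    rw [undropped_packets]
    exact hk.1
  · intro P hP h0
    refine ⟨W.original P hP h0, not_isHaltEvent_notify_of_lt ?_⟩
    have := GroupViews.joinView_lt_removalView hP
    rwa [h0] at this

theorem undropped_basic (B : H.BasicAxioms) (L : H.LivenessAxiom) (C : H.Conforming) :
    H.undropped.BasicAxioms := by
  refine ⟨undropped_wellFormed B, ?_, ?_, ?_, ?_, ?_, ?_, ?_, ?_, undropped_minimalOrder B,
    ?_, ?_, ?_, ?_⟩
  · intro k hk
    exact (undropped_lt_iff not_isHaltEvent_queue not_isHaltEvent_dequeue).2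
      (B.packetEvent k hk.1)
  · intro P Q m n hm hn hlt hd
    rw [undropped_packets] at hm hn
    rw [undropped_lt_iff not_isHaltEvent_queue not_isHaltEvent_queue] at hlt
    have := B.packetOrder P Q m n hm hn hlt hd.1
    exact ⟨⟨this.1, not_isHaltEvent_dequeue⟩,
      (undropped_lt_iff not_isHaltEvent_dequeue not_isHaltEvent_dequeue).2 this.2⟩
  · rintro P i i' hi hii hi' h
    have := B.notificationOrder P i i' hi hii hi' h.1
    have hn : ¬ H.IsHaltEvent (.notify P i) :=
      not_isHaltEvent_notify_of_lt (lt_of_lt_of_le (by exact_mod_cast hii) hi')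
    exact ⟨⟨this.1, hn⟩, (undropped_lt_iff hn h.2).2 this.2⟩
  · rintro e f hef hf
    have hef' : H.Fork e f := hef
    obtain ⟨h1, h2, h3⟩ := B.parent e f hef hf.1
    obtain ⟨h4, h5⟩ := hef'.not_isHaltEvent
    exact ⟨⟨h1, h4⟩, ⟨h2, h4, h5⟩, ⟨h3, h5, h4⟩⟩
  · intro e he f hf hp
    rw [undropped_le_iff he.2 hf.2, undropped_le_iff hf.2 he.2]
    exact B.localOrder e he.1 f hf.1 hp
  · intro P n Q hd i hi
    have hk := B.wellFormed.dequeue_mem _ hd.1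
    refine (B.piggyback P n Q hd.1 i (hi.imp_right fun ⟨h3, h4⟩ =>
      ⟨h3.1, (undropped_lt_iff h3.2 not_isHaltEvent_queue).1 h4⟩)).imp_right fun ⟨h3, h4⟩ => ?_
    have := not_isHaltEvent_of_le B h4.1 not_isHaltEvent_dequeue
    exact ⟨⟨h3, this⟩, (undropped_lt_iff this not_isHaltEvent_dequeue).2 h4⟩
  · intro P n i hk hi hlt
    rw [undropped_packets] at hk
    have := B.selfChannel P n i hk hi.1 ((undropped_lt_iff not_isHaltEvent_queue hi.2).1 hlt)
    exact ⟨⟨this.1, not_isHaltEvent_dequeue⟩,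
      (undropped_lt_iff not_isHaltEvent_dequeue hi.2).2 this.2⟩
  · refine ⟨?_, ?_, ?_⟩
    · intro e he
      refine (B.orderFoundation.finite e he.1).subset ?_
      rintro f ⟨hf, hlt⟩
      exact ⟨⟨hf.1.1, hf.2⟩, (undropped_lt_iff hf.1.2 he.2).1 hlt⟩
    · intro e he
      have := B.orderFoundation.join_first e he.1
      have hn := not_isHaltEvent_of_le B this.2 he.2
      exact ⟨⟨this.1, hn⟩, this.2, hn, he.2⟩
    · intro P i hi h
      exact absurd (isHaltEvent_notify_iff.2 hi) h.2
  · intro P hP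
    exact ⟨(B.firstHalting P hP).1.subset fun e he => ⟨he.1.1, he.2⟩, (B.firstHalting P hP).2⟩
  · refine ⟨fun P i h => absurd h (Set.notMem_empty _), fun P hP hh i hi _ => ?_⟩
    have hn : Event.notify P i ∈ H.events := by
      refine B.secondHalting.2 P hP hh i ?_ fun j _ h => hh (C.notification P j h)
      obtain ⟨c, hc⟩ := hi
      exact ⟨c, undropped_isNote_iff.1 hc⟩
    exact ⟨hn, fun h => hh (proc_mem_halting_of_isHaltEvent B C hn h)⟩
  · refine ⟨?_, ?_, ?_⟩
    · intro k hk hh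
      rw [undropped_packets] at hk
      exact sent_mem_undropped B L C hk hh
    · intro k hk
      exact ⟨B.wellFormed.dequeue_mem k hk.1, .inl hk.1⟩
    · intro P n Q hQ hk hP hQh _
      rw [undropped_packets] at hk
      exact ⟨dequeue_mem_of_not_halting B C hk hQ hP hQh, not_isHaltEvent_dequeue⟩
  · intro P hP hh r hr
    exact ⟨B.fourthHalting P hP hh r hr, not_isHaltEvent_request⟩

theorem undropped_handles {s : State} {x : State × List (Multicast Pid Content)}
    (h : A.Handles H e s x) : A.Handles H.undropped e s x :=
  h.congr (H := H) (H' := H.undropped) rfl rfl rfl fun _ _ => rfl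

theorem undropped_generates (B : H.BasicAxioms) (C : H.Conforming) (Ge : A.Generates H after) :
    A.Generates H.undropped after := by
  refine ⟨?_, ?_, ?_, ?_⟩
  · exact fun P hP h0 => undropped_handles (Ge.original P hP h0)
  · intro d e f hde hef hf
    have he : H.Fork e f := hef
    exact undropped_handles (Ge.forked d e f
      ((undropped_pred_iff B he.not_isHaltEvent.1).1 hde) hef hf.1)
  · intro e f hef
    exact (Ge.step e f ((undropped_pred_iff B hef.2.1.2).1 hef)).congr (H := H) (H' := H.undropped) rfl rfl rfl
      (fun _ _ => rfl) fun _ _ _ => ⟨rfl, rfl⟩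
  · intro e he hh hlast
    refine Ge.complete e he.1 hh fun f hf => ?_
    have : ¬ H.IsHaltEvent f := fun h => by
      have := proc_mem_halting_of_isHaltEvent B C hf.1 h
      rw [hf.2] at this
      exact hh this
    exact (hlast f ⟨⟨hf.1, this⟩, hf.2⟩).1

theorem undropped_conforming (B : H.BasicAxioms) (C : H.Conforming) :
    H.undropped.Conforming := by
  refine ⟨?_, ?_, fun P i h => absurd h (Set.notMem_empty _), C.gms, ?_, C.halt⟩
  · exact fun P hP Q hQ h =>
      C.channel P hP Q hQ (h.subset fun n hn => ⟨hn, not_isHaltEvent_dequeue⟩)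
  · intro P n Q i hi h1 h2 h3
    exact C.packet P n Q i (undropped_isNote_iff.1 hi) h1.1 h2.1
      ((undropped_lt_iff h1.2 h2.2).1 h3)
  · intro P hP h
    refine C.parent P hP (Set.eq_empty_of_forall_notMem fun e he => ?_)
    refine Set.eq_empty_iff_forall_notMem.1 h (.notify P (H.mem.joinView P)) ⟨⟨?_, ?_⟩, rfl⟩
    · exact he.2 ▸ B.notify_joinView_mem he.1
    · exact not_isHaltEvent_notify_of_lt (GroupViews.joinView_lt_removalView hP)

theorem undropped_lossless : H.undropped.Lossless := by
  refine ⟨fun _ h => h, rfl, ?_, ?_⟩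
  · rintro k ⟨_, hk⟩ h
    refine ⟨hk.resolve_right ?_, not_isHaltEvent_dequeue⟩
    rintro (h' | h')
    · exact absurd h.1 (not_le.2 h')
    · exact h.2 h'
  · intro k hk h
    rw [undropped_packets] at hk
    exact ⟨hk, .inr h⟩

theorem undropped_good (hlive : A.RespectsLiveness) (B : H.BasicAxioms) (L : H.LivenessAxiom)
    (C : H.Conforming) (Ge : A.Generates H after) : A.Good H.undropped after := by
  have B' := undropped_basic B L C
  have G' := undropped_generates B C Ge
  have C' := undropped_conforming B C
  exact ⟨B', G', hlive _ ⟨B', _, G'⟩ C', C', undropped_lossless⟩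

end undropped

end GroupComputation

/-! ### States of the vacuum loop as descriptions of histories. -/

namespace GroupComputation

open Protocol

variable {Pid Content Msg State : Type*}

/-- The list of the packets in the receive queue of the channel from `Q` to `P`. -/
def Pending (H : GroupComputation Pid Content Msg) (P Q : Pid) (l : List ℕ) : Prop :=
  l.Pairwise (fun m n => H.lt (.queue Q m) (.queue Q n)) ∧
    ∀ n, n ∈ l ↔ ⟨Q, n, P⟩ ∈ H.received ∧ Event.dequeue ⟨Q, n, P⟩ ∉ H.events

/-- All items at `P` are processed, and no process can queue further packets to `P`. -/
structure Finished (H : GroupComputation Pid Content Msg) (P : Pid) (i : ℕ) : Prop where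
  removalView : H.mem.removalView P = i
  mem : Event.notify P i ∈ H.events
  requests : ∀ r ∈ H.requests P, Event.request P r ∈ H.events
  received : ∀ k ∈ H.received, k.tgt = P → Event.dequeue k ∈ H.events
  notified : ∀ Q ∈ H.mem.procs, H.mem.joinView Q < i → (i : ℕ∞) < H.mem.removalView Q →
    Event.notify Q i ∈ H.events

/-- The state `s` of the vacuum loop at `P` describes the history `H`, in which the multicasts in
`rest` are still to be queued. -/
structure Sim (H : GroupComputation Pid Content Msg)
    (after : Event Pid → State × List (Multicast Pid Content)) (P : Pid)
    (s : LoopState Pid Content State) (rest : List (Multicast Pid Content)) : Prop where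
  halting : P ∈ H.halting
  last : ∃ d, H.IsLast P d ∧ after d = (s.state, rest)
  not_halted : ∀ i : ℕ, H.mem.removalView P = i → Event.notify P i ∉ H.events
  join_lt : H.mem.joinView P < s.next
  le_removal : (s.next : ℕ∞) ≤ H.mem.removalView P
  next : ∀ i : ℕ, H.mem.joinView P ≤ i → (i : ℕ∞) < H.mem.removalView P →
    (Event.notify P i ∈ H.events ↔ i < s.next)
  requests : s.requests = {r | r ∈ H.requests P ∧ Event.request P r ∉ H.events}
  inbox : ∀ Q, Q ≠ P → ∃ l, H.Pending P Q l ∧ s.inbox Q = l.map (H.content Q)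
  self : ∃ l, H.Pending P P l ∧ s.inbox P = l.map (H.content P) ++ selfCopies P rest

variable {A : Protocol Pid Content Msg State} {H H' : GroupComputation Pid Content Msg}
  {after after' : Event Pid → State × List (Multicast Pid Content)} {e : Event Pid} {P Q : Pid}

/-- A received packet to `P` whose queuing is new cannot be on a downstream channel. On the self
channel the queuing would precede the old halting event. On another channel the sender has already
processed the removal of `P`, and by liveness the queuing precedes that old event. Received upstream
packets are dequeued by losslessness. -/
theorem Finished.ext {i : ℕ} (F : H.Finished P i) (G : A.Good H' after')
    (X : Ext H after H' after') : H'.Finished P i := by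
  refine ⟨X.mem ▸ F.removalView, X.events F.mem, fun r hr => X.events (F.requests r (X.requests ▸ hr)),
    ?_, ?_⟩
  · rintro k hk rfl
    have B' := G.basic
    have hkp := B'.wellFormed.sent_sub (B'.wellFormed.received_sub hk)
    by_cases hq : Event.queue k.src k.serial ∈ H.events
    · exact X.events (F.received k ((X.received k ((X.mem_packets_iff hq).1 hkp)).1 hk) rfl)
    · by_cases hu : H'.Upstream k.src k.tgt
      · exact G.lossless.upstream k hk hu
      · exfalso
        apply hq
        by_cases hs : k.src = k.tgt
        · refine X.mem_of_le (f := .notify k.tgt i) hkp.1 F.mem hs ?_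
          exact B'.orderFoundation.halt_last k.tgt i (X.mem ▸ F.removalView) (X.events F.mem) _
            ⟨hkp.1, hs⟩
        · have hlt : (i : ℕ∞) < H'.mem.removalView k.src := by
            by_contra! h
            refine hu ⟨?_, hs⟩
            rwa [X.mem, F.removalView, ← X.mem]
          obtain ⟨-, hj⟩ := G.live.removalView_lt B' hkp
          rw [X.mem] at hlt hj
          rw [F.removalView] at hj
          have hs' : k.src ∈ H.mem.procs := X.mem ▸ B'.wellFormed.proc_mem _ hkp.1
          have hn := F.notified k.src hs' (by exact_mod_cast hj) hlt
          exact X.mem_of_lt (f := .notify k.src i) hkp.1 hn rfl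
            ((G.live k.src k.serial k.tgt hkp).2.2 i (X.mem ▸ F.removalView) (X.events hn))
  · intro Q hQ hj hr
    rw [X.mem] at hQ hj hr
    exact X.events (F.notified Q hQ hj hr)

theorem finite_setOf_queue {S : Set (Event Pid)} (hS : S.Finite) (P : Pid) :
    {n | Event.queue P n ∈ S}.Finite := by
  refine Set.Finite.preimage ?_ hS
  intro a _ b _ hab
  cases hab
  rfl

theorem exists_sorted_list (B : H.BasicAxioms) {S : Set ℕ} (hS : S.Finite)
    (hq : ∀ n ∈ S, Event.queue P n ∈ H.events) :
    ∃ l : List ℕ, l.Pairwise (fun m n => H.lt (.queue P m) (.queue P n)) ∧ ∀ n, n ∈ l ↔ n ∈ S := by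
  induction h : S.ncard generalizing S with
  | zero =>
    rw [Set.ncard_eq_zero hS] at h
    exact ⟨[], .nil, by simp [h]⟩
  | succ N ih =>
    have hne : S.Nonempty := by
      rw [← Set.ncard_pos hS]
      omega
    obtain ⟨f, ⟨m, hm, rfl⟩, hmax⟩ := B.exists_max (S := Event.queue P '' S) (P := P)
      (hS.image _) (hne.image _) (by rintro _ ⟨n, hn, rfl⟩; exact ⟨hq n hn, rfl⟩)
    obtain ⟨l, hl, hlm⟩ := ih (S := S \ {m}) hS.sdiff (fun n hn => hq n hn.1) (by
      rw [Set.ncard_sdiff_singleton_of_mem hm, h]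
      rfl)
    refine ⟨l ++ [m], List.pairwise_append.2 ⟨hl, List.pairwise_singleton _ _, ?_⟩, fun n => ?_⟩
    · intro n hn m' hm'
      obtain rfl := List.mem_singleton.1 hm'
      have hn' := (hlm n).1 hn
      refine B.lt_of_ne rfl (hmax _ ⟨n, hn'.1, rfl⟩) fun h => hn'.2 ?_
      cases h
      rfl
    · rw [List.mem_append, hlm, List.mem_singleton]
      by_cases h : n = m
      · simp [h, hm]
      · simp [h]

theorem Pending.queue_mem {l : List ℕ} (B : H.BasicAxioms) (hl : H.Pending P Q l) {n : ℕ}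
    (hn : n ∈ l) : ⟨Q, n, P⟩ ∈ H.packets :=
  B.wellFormed.sent_sub (B.wellFormed.received_sub ((hl.2 n).1 hn).1)

/-- The pending packets of a lossless history are on downstream channels. -/
theorem Pending.downstream {l : List ℕ} (Lo : H.Lossless) (hl : H.Pending P Q l) {n : ℕ}
    (hn : n ∈ l) : H.Downstream Q P := by
  by_contra h
  unfold Downstream at h
  push Not at h
  exact ((hl.2 n).1 hn).2 (Lo.upstream _ ((hl.2 n).1 hn).1 h)

/-- The receive queue is finite: this is clear if `Q` halts. Otherwise a pending packet shows that
the channel is downstream; then `Q` processes the removal of `P`, and by liveness all its packets to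
`P` are queued before that event. -/
theorem exists_pending (G : A.Good H after) (hP : P ∈ H.halting) (Q : Pid) :
    ∃ l, H.Pending P Q l := by
  have B := G.basic
  have hpk : ∀ n ∈ {n | ⟨Q, n, P⟩ ∈ H.received ∧ Event.dequeue ⟨Q, n, P⟩ ∉ H.events},
      ⟨Q, n, P⟩ ∈ H.packets := fun n hn => B.wellFormed.sent_sub (B.wellFormed.received_sub hn.1)
  refine exists_sorted_list B
    (S := {n | ⟨Q, n, P⟩ ∈ H.received ∧ Event.dequeue ⟨Q, n, P⟩ ∉ H.events}) ?_
    fun n hn => (hpk n hn).1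
  by_cases hQ : Q ∈ H.halting
  · exact (finite_setOf_queue (B.firstHalting Q hQ).1 Q).subset fun n hn => ⟨(hpk n hn).1, rfl⟩
  · rcases Set.eq_empty_or_nonempty
      {n | ⟨Q, n, P⟩ ∈ H.received ∧ Event.dequeue ⟨Q, n, P⟩ ∉ H.events} with h | ⟨n₀, hn₀⟩
    · rw [h]
      exact Set.finite_empty
    have hQp : Q ∈ H.mem.procs := B.wellFormed.proc_mem _ (hpk n₀ hn₀).1
    have hr : H.mem.removalView P < H.mem.removalView Q := by
      by_contra! h
      exact hn₀.2 (G.lossless.upstream _ hn₀.1 ⟨h, fun h : Q = P => hQ (h ▸ hP)⟩)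
    obtain ⟨-, hj⟩ := G.live.removalView_lt B (hpk n₀ hn₀)
    dsimp only at hj
    obtain ⟨r, hr'⟩ := ENat.ne_top_iff_exists.1 hr.ne_top
    rw [← hr'] at hr hj
    have hn : Event.notify Q r ∈ H.events := by
      refine B.secondHalting.2 Q hQp hQ r (hasNote_of_lt hQp (by exact_mod_cast hj.le) hr) ?_
      intro i _ hi
      rw [G.lossless.no_dropped_notifications] at hi
      exact hi
    refine (finite_setOf_queue (B.orderFoundation.finite _ hn) Q).subset fun n hn' => ?_
    exact ⟨⟨(hpk n hn').1, rfl⟩, (G.live Q n P (hpk n hn')).2.2 r hr'.symm hn⟩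

/-- This makes the convergence hypothesis applicable. The loop state already contains the self
copies of the multicasts in `rest`, exactly as if the current transaction had been absorbed. -/
theorem Sim.loopStart {s : LoopState Pid Content State} {rest : List (Multicast Pid Content)}
    (S : Sim H after P s rest) (hs : s.phase = .requests) : LoopStart H after P s := by
  classical
  refine ⟨hs, S.join_lt.le, S.le_removal, S.next, S.requests, ?_⟩
  obtain ⟨d, hd, hd'⟩ := S.last
  have hl : ∀ Q, ∃ l, H.Pending P Q l ∧
      s.inbox Q = if Q = P then l.map (H.content Q) ++ selfCopies P rest
        else l.map (H.content Q) := fun Q => by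
    by_cases h : Q = P
    · subst h
      simpa using S.self
    · simpa [h] using S.inbox Q h
  choose l hl hin using hl
  refine ⟨(s.state, rest), fun Q => (l Q).map (H.content Q), .inl ⟨d, hd.1, ?_, ?_, hd'.symm⟩,
    ?_, fun Q => ⟨l Q, (hl Q).1, (hl Q).2, rfl⟩⟩
  · rintro ⟨P', i, hi, rfl⟩
    obtain rfl : P' = P := hd.1.2
    exact S.not_halted i hi hd.1.1
  · exact fun f hf _ => hd.2 f hf
  · have : s.inbox = Function.update (fun Q => (l Q).map (H.content Q)) P
        ((l P).map (H.content P) ++ selfCopies P rest) := by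
      funext Q
      rw [hin Q]
      by_cases h : Q = P
      · subst h
        simp
      · simp [h]
    cases s
    dsimp only at this
    subst this
    simp only [LoopState.absorb]

theorem Sim.with_phase {s : LoopState Pid Content State} {rest : List (Multicast Pid Content)}
    (S : Sim H after P s rest) (p : LoopPhase) : Sim H after P { s with phase := p } rest :=
  ⟨S.halting, S.last, S.not_halted, S.join_lt, S.le_removal, S.next, S.requests, S.inbox, S.self⟩

section append

variable {tg : Finset Pid} {ct : Content} {x : State × List (Multicast Pid Content)}

open Classical in
theorem CanAppend.sim (C : CanAppend A H after e tg ct x) (B : H.BasicAxioms)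
    (hP : e.proc = P) (he : ¬ H.IsHaltEvent e) {s : LoopState Pid Content State}
    {rest : List (Multicast Pid Content)} (hx : x = (s.state, rest))
    (join_lt : H.mem.joinView P < s.next) (le_removal : (s.next : ℕ∞) ≤ H.mem.removalView P)
    (next : ∀ i : ℕ, H.mem.joinView P ≤ i → (i : ℕ∞) < H.mem.removalView P →
      (Event.notify P i ∈ (H.append e tg ct).events ↔ i < s.next))
    (requests : s.requests =
      {r | r ∈ H.requests P ∧ Event.request P r ∉ (H.append e tg ct).events})
    (inbox : ∀ Q, Q ≠ P → ∃ l, (H.append e tg ct).Pending P Q l ∧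
      s.inbox Q = l.map ((H.append e tg ct).content Q))
    (self : ∃ l, (H.append e tg ct).Pending P P l ∧
      s.inbox P = l.map ((H.append e tg ct).content P) ++ selfCopies P rest) :
    Sim (H.append e tg ct) (Function.update after e x) P s rest := by
  refine ⟨hP ▸ C.halting, ⟨e, ⟨⟨.inl rfl, hP⟩, ?_⟩, ?_⟩, ?_, join_lt, le_removal, next, requests,
    inbox, self⟩
  · rintro f ⟨rfl | hf, hfp⟩
    · exact .inr (.inl ⟨rfl, .inl rfl⟩)
    · exact (C.lt_new B ⟨hf, hfp.trans hP.symm⟩).1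
  · rw [Function.update_self, hx]
  · rintro i hi (h | h)
    · exact he ⟨P, i, hi, h.symm⟩
    · subst hP
      exact C.not_halted i hi h

theorem map_append_content (hfr : e ∉ H.events) {l : List ℕ}
    (hl : ∀ n ∈ l, Event.queue Q n ∈ H.events) :
    l.map ((H.append e tg ct).content Q) = l.map (H.content Q) :=
  List.map_congr_left fun n hn => if_neg fun h => hfr (h.subst (hl n hn))

/-- Covers both an event that does not touch the queue, with `l' = l`, and the dequeuing of a
packet, which is then deleted from `l`. -/
theorem Pending.append_of_sublist {l l' : List ℕ} (C : CanAppend A H after e tg ct x)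
    (B : H.BasicAxioms) (hl : H.Pending P Q l) (hsub : l'.Sublist l)
    (hmem : ∀ n, n ∈ l' ↔ n ∈ l ∧ e ≠ .dequeue ⟨Q, n, P⟩)
    (hrec : ∀ n, ⟨Q, n, P⟩ ∈ (H.append e tg ct).received → ⟨Q, n, P⟩ ∈ H.received) :
    (H.append e tg ct).Pending P Q l' := by
  refine ⟨(hl.1.sublist hsub).imp_of_mem fun hm hn h => ?_, fun n => ?_⟩
  · exact ((C.ext B).lt_iff (hl.queue_mem B (hsub.subset hm)).1
      (hl.queue_mem B (hsub.subset hn)).1).2 h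
  · rw [hmem, hl.2]
    constructor
    · rintro ⟨⟨h1, h2⟩, h3⟩
      refine ⟨.inl h1, ?_⟩
      rintro (h | h)
      exacts [h3 h.symm, h2 h]
    · rintro ⟨h1, h2⟩
      exact ⟨⟨hrec n h1, fun h => h2 (.inr h)⟩, fun h => h2 (.inl h.symm)⟩

end append

open Classical in
theorem selfCopies_cons (m : Multicast Pid Content) (l : List (Multicast Pid Content)) :
    selfCopies P (m :: l) = (if P ∈ m.targets then [m.content] else []) ++ selfCopies P l := by
  unfold selfCopies
  by_cases h : P ∈ m.targets <;> simp [h]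

/-- The next multicast of an unfinished transaction can be queued. -/
theorem Sim.queue (hlive : A.RespectsLiveness) (G : A.Good H after)
    {s : LoopState Pid Content State} {m : Multicast Pid Content}
    {rest : List (Multicast Pid Content)} (S : Sim H after P s (m :: rest)) :
    ∃ H' after', A.Good H' after' ∧ Ext H after H' after' ∧ Sim H' after' P s rest ∧
      ∀ f ∈ H'.events, f ∉ H.events → f.proc = P := by
  classical
  have B := G.basic
  -- A halting process has finitely many events, so an unused serial number remains.
  obtain ⟨n, hn⟩ : ∃ n, Event.queue P n ∉ H.events := by
    obtain ⟨n, hn⟩ := (finite_setOf_queue (B.firstHalting P S.halting).1 P).exists_notMem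
    exact ⟨n, fun h => hn ⟨h, rfl⟩⟩
  obtain ⟨d, hd, hd'⟩ := S.last
  have C : CanAppend A H after (.queue P n) m.targets m.content (s.state, rest) := by
    refine ⟨S.halting, hn, S.not_halted, ?_, ?_, ?_, .inl ⟨d, hd, ?_⟩⟩
    · rintro k h
      cases h
    · rintro P i h
      cases h
    · rintro P r h
      cases h
    · rw [hd']
      exact .queue _ _ _ _ _ (if_pos rfl) (if_pos rfl)
  refine ⟨_, _, C.good hlive G, C.ext B, ?_, ?_⟩
  · have hsame : ∀ {f : Event Pid}, f ≠ .queue P n →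
        (f ∈ (H.append (.queue P n) m.targets m.content).events ↔ f ∈ H.events) :=
      fun hf => or_iff_right hf
    refine C.sim (P := P) B rfl not_isHaltEvent_queue rfl S.join_lt S.le_removal ?_ ?_ ?_ ?_
    · intro i h1 h2
      rw [hsame (by simp)]
      exact S.next i h1 h2
    · rw [S.requests]
      ext r
      exact and_congr_right fun _ => not_congr (hsame (by simp)).symm
    · intro Q hQ
      obtain ⟨l, hl, hin⟩ := S.inbox Q hQ
      refine ⟨l, hl.append_of_sublist C B (List.Sublist.refl _) (by simp) ?_, ?_⟩
      · rintro k (h | ⟨h, -⟩)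
        · exact h
        · exact absurd (Event.queue.inj h).1 hQ
      · rw [map_append_content hn fun k hk => (hl.queue_mem B hk).1, hin]
    · obtain ⟨l, hl, hin⟩ := S.self
      have hmem : ∀ k, ⟨P, k, P⟩ ∈ (H.append (.queue P n) m.targets m.content).received ↔
          ⟨P, k, P⟩ ∈ H.received ∨ (k = n ∧ P ∈ m.targets) := by
        intro k
        refine or_congr_right ⟨fun h => ?_, ?_⟩
        · cases h.1
          exact ⟨rfl, h.2.1⟩
        · rintro ⟨rfl, h⟩
          exact ⟨rfl, h, .inr rfl⟩
      -- If `P` is a target, the content moves from the front of the self copies of the remaining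
      -- multicasts to the end of the pending packets. The inbox, being the concatenation of the
      -- two, does not change.
      by_cases hPm : P ∈ m.targets
      · refine ⟨l ++ [n], ⟨List.pairwise_append.2 ⟨?_, List.pairwise_singleton _ _, ?_⟩,
          fun k => ?_⟩, ?_⟩
        · exact hl.1.imp_of_mem fun h1 h2 h =>
            ((C.ext B).lt_iff (hl.queue_mem B h1).1 (hl.queue_mem B h2).1).2 h
        · intro k hk n' hn'
          obtain rfl := List.mem_singleton.1 hn'
          exact C.lt_new B ⟨(hl.queue_mem B hk).1, rfl⟩
        · rw [hmem, hsame (by simp), List.mem_append, hl.2, List.mem_singleton]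
          constructor
          · rintro (h | rfl)
            · exact ⟨.inl h.1, h.2⟩
            · exact ⟨.inr ⟨rfl, hPm⟩, fun h => hn (B.wellFormed.dequeue_mem _ h).1⟩
          · rintro ⟨h | h, h'⟩
            exacts [.inl ⟨h, h'⟩, .inr h.1]
        · rw [List.map_append, map_append_content hn fun k hk => (hl.queue_mem B hk).1, hin,
            selfCopies_cons, if_pos hPm, List.append_assoc]
          congr 2
          exact congrArg (fun c => [c]) (if_pos rfl).symm
      · refine ⟨l, hl.append_of_sublist C B (List.Sublist.refl _) (by simp) ?_, ?_⟩
        · intro k hk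
          exact ((hmem k).1 hk).resolve_right fun h => hPm h.2
        · rw [map_append_content hn fun k hk => (hl.queue_mem B hk).1, hin,
            selfCopies_cons, if_neg hPm, List.nil_append]
  · rintro f (rfl | hf) h
    exacts [rfl, absurd hf h]

/-- An unfinished transaction can be completed. -/
theorem Sim.flush (hlive : A.RespectsLiveness) {s : LoopState Pid Content State}
    {rest : List (Multicast Pid Content)} : ∀ {H : GroupComputation Pid Content Msg} {after},
    A.Good H after → Sim H after P s rest →
    ∃ H' after', A.Good H' after' ∧ Ext H after H' after' ∧ Sim H' after' P s [] ∧
      ∀ f ∈ H'.events, f ∉ H.events → f.proc = P := by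
  induction rest with
  | nil => exact fun G S => ⟨_, _, G, .refl _ _, S, fun f h h' => absurd h h'⟩
  | cons m rest ih =>
    intro H after G S
    obtain ⟨H₁, a₁, G₁, X₁, S₁, h₁⟩ := S.queue hlive G
    obtain ⟨H₂, a₂, G₂, X₂, S₂, h₂⟩ := ih G₁ S₁
    refine ⟨H₂, a₂, G₂, X₁.trans X₂, S₂, fun f hf hf' => ?_⟩
    by_cases h : f ∈ H₁.events
    exacts [h₁ f h hf', h₂ f hf h]

end GroupComputation

/-! ### Simulation of the vacuum loop by appended events. -/

namespace GroupComputation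

open Protocol

variable {Pid Content Msg State : Type*}
variable {A : Protocol Pid Content Msg State} {H H' : GroupComputation Pid Content Msg}
  {after after' : Event Pid → State × List (Multicast Pid Content)} {e : Event Pid} {P Q : Pid}
  {s : LoopState Pid Content State}

theorem absorb_inbox_self (s : LoopState Pid Content State)
    (x : State × List (Multicast Pid Content)) :
    (s.absorb P x).inbox P = s.inbox P ++ selfCopies P x.2 := by
  classical
  simp [LoopState.absorb]

theorem absorb_inbox_of_ne (h : Q ≠ P) (s : LoopState Pid Content State)
    (x : State × List (Multicast Pid Content)) : (s.absorb P x).inbox Q = s.inbox Q := by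
  classical
  simp [LoopState.absorb, h]

theorem pop_inbox_self (s : LoopState Pid Content State) :
    (s.pop Q).inbox Q = (s.inbox Q).tail := by
  classical
  simp [LoopState.pop]

theorem pop_inbox_of_ne (h : P ≠ Q) (s : LoopState Pid Content State) :
    (s.pop Q).inbox P = s.inbox P := by
  classical
  simp [LoopState.pop, h]

theorem Sim.inbox_eq (S : Sim H after P s []) (Q : Pid) :
    ∃ l, H.Pending P Q l ∧ s.inbox Q = l.map (H.content Q) := by
  by_cases h : Q = P
  · subst h
    simpa [selfCopies] using S.self
  · exact S.inbox Q h

theorem append_empty_received {ct : Content} {k : Packet Pid} :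
    k ∈ (H.append e ∅ ct).received → k ∈ H.received := by
  rintro (h | ⟨-, h, -⟩)
  · exact h
  · exact absurd h (Finset.notMem_empty _)

/-- A pending request can be processed. -/
theorem Sim.request (hlive : A.RespectsLiveness) (G : A.Good H after) (S : Sim H after P s [])
    {r : ℕ} (hr : r ∈ s.requests) :
    ∃ H' after', A.Good H' after' ∧ Ext H after H' after' ∧
      Sim H' after' P
        (({ s with requests := s.requests \ {r} } : LoopState Pid Content State).absorb P
          (A.broadcast (H.reqContent P r) s.state)) (A.broadcast (H.reqContent P r) s.state).2 ∧
      ∀ f ∈ H'.events, f ∉ H.events → f.proc = P := by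
  classical
  have B := G.basic
  have hr' := hr
  rw [S.requests] at hr'
  obtain ⟨d, hd, hd'⟩ := S.last
  -- The target set `∅` and the content `H.content P 0` are dummies, as the event queues nothing.
  have C : CanAppend A H after (.request P r) ∅ (H.content P 0)
      (A.broadcast (H.reqContent P r) s.state) := by
    refine ⟨S.halting, hr'.2, S.not_halted, ?_, ?_, ?_, .inl ⟨d, hd, ?_⟩⟩
    · rintro k h
      cases h
    · rintro P i h
      cases h
    · rintro P r h
      cases h
      exact hr'.1
    · rw [hd']
      exact .trigger _ _ _ (.request P r s.state)
  refine ⟨_, _, C.good hlive G, C.ext B, ?_, ?_⟩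
  · refine C.sim (P := P) B rfl not_isHaltEvent_request rfl S.join_lt S.le_removal ?_ ?_ ?_ ?_
    · intro i h1 h2
      exact (or_iff_right (by simp)).trans (S.next i h1 h2)
    · simp only [LoopState.absorb]
      rw [S.requests]
      ext r'
      simp only [append, Set.mem_sdiff, Set.mem_ofPred_eq, Set.mem_singleton_iff,
        Set.mem_insert_iff, Event.request.injEq, true_and]
      tauto
    · intro Q hQ
      obtain ⟨l, hl, hin⟩ := S.inbox_eq Q
      refine ⟨l, hl.append_of_sublist C B (List.Sublist.refl _) (by simp)
        fun k hk => append_empty_received hk, ?_⟩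
      rw [map_append_content C.fresh fun k hk => (hl.queue_mem B hk).1, ← hin]
      exact absorb_inbox_of_ne hQ _ _
    · obtain ⟨l, hl, hin⟩ := S.inbox_eq P
      refine ⟨l, hl.append_of_sublist C B (List.Sublist.refl _) (by simp)
        fun k hk => append_empty_received hk, ?_⟩
      rw [map_append_content C.fresh fun k hk => (hl.queue_mem B hk).1, ← hin]
      exact absorb_inbox_self _ _
  · rintro f (rfl | hf) h
    exacts [rfl, absurd hf h]

/-- The first packet of a receive queue can be dequeued and processed. -/
theorem Sim.dequeue (hlive : A.RespectsLiveness) (G : A.Good H after) (S : Sim H after P s [])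
    {c : Content} {cs : List Content} (hc : s.inbox Q = c :: cs)
    (hQ : Q = P ∨ H.mem.removalView P = s.next) :
    ∃ H' after', A.Good H' after' ∧ Ext H after H' after' ∧
      Sim H' after' P ((s.pop Q).absorb P (A.packet c Q s.state))
        (A.packet c Q s.state).2 ∧
      ∀ f ∈ H'.events, f ∉ H.events → f.proc = P := by
  classical
  have B := G.basic
  obtain ⟨d, hd, hd'⟩ := S.last
  obtain ⟨l, hl, hin⟩ := S.inbox_eq Q
  rw [hc] at hin
  obtain ⟨n, l, rfl, rfl, rfl⟩ := List.map_eq_cons_iff.1 hin.symm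
  have hn := (hl.2 n).1 (by simp)
  have hnl : n ∉ l := fun h => by
    have := List.rel_of_pairwise_cons hl.1 h
    exact this.2 this.1
  have C : CanAppend A H after (.dequeue ⟨Q, n, P⟩) ∅ (H.content P 0)
      (A.packet (H.content Q n) Q s.state) := by
    refine ⟨S.halting, hn.2, S.not_halted, ?_, ?_, ?_, .inl ⟨d, hd, ?_⟩⟩
    · rintro k h
      cases h
      refine ⟨hn.1, fun m hm hlt => ?_, ?_⟩
      -- Earlier packets of this downstream channel are sent and received. One that is not dequeued
      -- would be a member of the sorted queue, whose first member is `n`.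
      · by_contra hd
        have hmr := G.lossless.no_dropped_packets
          (G.lossless.downstream _ hm (hl.downstream G.lossless (n := n) (by simp)))
        have := (hl.2 m).2 ⟨hmr, hd⟩
        rcases List.mem_cons.1 this with rfl | h
        · exact hlt.2 hlt.1
        · exact hlt.2 (List.rel_of_pairwise_cons hl.1 h).1
      -- Packets from other processes are processed only when the next view is the removal view,
      -- hence after all earlier notifications of `P`.
      · rcases hQ with h | h
        · exact .inl h
        · rcases hl.downstream G.lossless (n := n) (by simp) with h' | h'
          · refine .inr ⟨h', fun i hi hi' => (S.next i hi hi').2 ?_⟩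
            rw [h] at hi'
            exact_mod_cast hi'
          · exact .inl h'
    · rintro P i h
      cases h
    · rintro P r h
      cases h
    · rw [hd']
      refine .trigger _ _ _ ?_
      have h := Handles.dequeue (A := A) (H := H.append (.dequeue ⟨Q, n, P⟩) ∅ (H.content P 0))
        ⟨Q, n, P⟩ s.state
      have hcn : (H.append (.dequeue ⟨Q, n, P⟩) ∅ (H.content P 0)).content Q n =
        H.content Q n := if_neg (by simp)
      rwa [hcn] at h
  refine ⟨_, _, C.good hlive G, C.ext B, ?_, ?_⟩
  · have hpop : ∀ R, ∃ l', (H.append (.dequeue ⟨Q, n, P⟩) ∅ (H.content P 0)).Pending P R l' ∧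
        (s.pop Q).inbox R =
          l'.map ((H.append (.dequeue ⟨Q, n, P⟩) ∅ (H.content P 0)).content R) := by
      intro R
      by_cases hR : R = Q
      · subst hR
        refine ⟨l, hl.append_of_sublist C B (List.sublist_cons_self n l) (fun k => ?_)
          fun k hk => append_empty_received hk, ?_⟩
        · simp only [List.mem_cons, ne_eq, Event.dequeue.injEq, Packet.mk.injEq, true_and,
            and_true]
          constructor
          · exact fun hk => ⟨.inr hk, fun h => hnl (h ▸ hk)⟩
          · rintro ⟨rfl | hk, h⟩
            exacts [absurd rfl h, hk]
        · rw [map_append_content C.fresh fun k hk => (hl.queue_mem B (by simp [hk])).1]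
          refine (pop_inbox_self _).trans ?_
          rw [hc]
          rfl
      · obtain ⟨l', hl', hin'⟩ := S.inbox_eq R
        refine ⟨l', hl'.append_of_sublist C B (List.Sublist.refl _)
          (fun k => by simp [Ne.symm hR]) fun k hk => append_empty_received hk, ?_⟩
        rw [map_append_content C.fresh fun k hk => (hl'.queue_mem B hk).1, ← hin']
        exact pop_inbox_of_ne hR _
    refine C.sim (P := P) B rfl not_isHaltEvent_dequeue rfl S.join_lt S.le_removal ?_ ?_ ?_ ?_
    · intro i h1 h2
      exact (or_iff_right (by simp)).trans (S.next i h1 h2)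
    · refine S.requests.trans ?_
      ext r
      exact and_congr_right fun _ => not_congr (or_iff_right (by simp)).symm
    · intro R hR
      obtain ⟨l', hl', hin'⟩ := hpop R
      exact ⟨l', hl', (absorb_inbox_of_ne hR _ _).trans hin'⟩
    · obtain ⟨l', hl', hin'⟩ := hpop P
      refine ⟨l', hl', ?_⟩
      rw [← hin']
      exact absorb_inbox_self _ _
  · rintro f (rfl | hf) h
    exacts [rfl, absurd hf h]

/-- What has been achieved when the vacuum loop has reached a given phase. -/
def PhaseInv (H : GroupComputation Pid Content Msg) (P : Pid)
    (s : LoopState Pid Content State) : Prop :=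
  (s.phase ≠ .requests → s.requests = ∅) ∧
  (s.phase = .self ∨ s.phase = .notify →
    H.mem.removalView P = s.next → ∀ Q, Q ≠ P → s.inbox Q = []) ∧
  (s.phase = .notify → s.inbox P = []) ∧ s.phase ≠ .done

/-- The next notification can be processed when all packets of the self channel are dequeued. -/
theorem Sim.notify (hlive : A.RespectsLiveness) (G : A.Good H after) (S : Sim H after P s [])
    (hin : s.inbox P = []) :
    ∃ H' after', A.Good H' after' ∧ Ext H after H' after' ∧ H'.received = H.received ∧
      ∀ f, f ∈ H'.events ↔ f = .notify P s.next ∨ f ∈ H.events := by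
  classical
  have B := G.basic
  have hP := B.wellFormed.halting_sub S.halting
  obtain ⟨d, hd, hd'⟩ := S.last
  have hnote : H.HasNote P s.next := by
    rcases S.le_removal.lt_or_eq with h | h
    · exact hasNote_of_lt hP S.join_lt.le h
    -- The final notification exists even if `P` is never removed, because `P` halts.
    · exact ⟨_, .dead P _ hP h.symm (.inr S.halting)⟩
  obtain ⟨c, hcn⟩ := hnote
  have C : CanAppend A H after (.notify P s.next) ∅ (H.content P 0)
      (A.onNote H.mem c s.state) := by
    refine ⟨S.halting, ?_, S.not_halted, ?_, ?_, ?_, .inl ⟨d, hd, ?_⟩⟩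
    · rcases S.le_removal.lt_or_eq with h | h
      · exact fun hm => lt_irrefl _ ((S.next _ S.join_lt.le h).1 hm)
      · exact S.not_halted _ h.symm
    · rintro k h
      cases h
    · rintro P i h
      cases h
      refine ⟨⟨c, hcn⟩, fun i hi hi' => (S.next i hi ?_).2 hi', fun n hn => ?_⟩
      · exact lt_of_lt_of_le (by exact_mod_cast hi') S.le_removal
      · obtain ⟨l, hl, hl'⟩ := S.inbox_eq P
        rw [hin, eq_comm, List.map_eq_nil_iff] at hl'
        subst hl'
        by_contra hdq
        refine List.not_mem_nil ((hl.2 n).2 ⟨?_, hdq⟩)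
        exact G.lossless.no_dropped_packets (G.lossless.downstream _ hn (.inr rfl))
    · rintro P r h
      cases h
    · rw [hd']
      refine .trigger _ _ _ ?_
      exact Handles.notify (A := A) (H := H.append (.notify P s.next) ∅ (H.content P 0)) P s.next
        c s.state (hcn.congr (H := H) (H' := H.append (.notify P s.next) ∅ (H.content P 0)) rfl rfl)
  refine ⟨_, _, C.good hlive G, C.ext B, ?_, fun f => Iff.rfl⟩
  exact Set.Subset.antisymm (fun k hk => append_empty_received hk) Set.subset_union_left

/-- The vacuum loop at `P` can be simulated until the next notification is processed. -/
theorem Sim.advance (hlive : A.RespectsLiveness) {K : GroupComputation Pid Content Msg}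
    {b : Event Pid → State × List (Multicast Pid Content)}
    (hacc : Acc (fun t t' => A.VacuumStep K P t' t) s) :
    ∀ {H : GroupComputation Pid Content Msg}
      {after : Event Pid → State × List (Multicast Pid Content)}
      {rest : List (Multicast Pid Content)},
      A.Good H after → Ext K b H after → Sim H after P s rest → PhaseInv H P s →
      ∃ H' after', A.Good H' after' ∧ Ext H after H' after' ∧
        (∀ f ∈ H'.events, f ∉ H.events → f.proc = P) ∧ Event.notify P s.next ∈ H'.events ∧
        (∀ i : ℕ, H.mem.removalView P = i → i ≠ s.next → Event.notify P i ∉ H'.events) ∧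
        (H.mem.removalView P = s.next → (∀ r ∈ H'.requests P, Event.request P r ∈ H'.events) ∧
          ∀ k ∈ H'.received, k.tgt = P → Event.dequeue k ∈ H'.events) := by
  -- The loop steps refer to the fixed history `K`. They depend only on views, halting processes and
  -- requests, which `K` shares with the growing history `H`.
  induction hacc with
  | intro s _ ih =>
  intro H after rest G X S I
  have step : ∀ (t : LoopState Pid Content State) {H₁ : GroupComputation Pid Content Msg} {a₁}
      {rest₁ : List (Multicast Pid Content)}, A.Good H₁ a₁ → Ext H after H₁ a₁ →
      (∀ f ∈ H₁.events, f ∉ H.events → f.proc = P) →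
      Sim H₁ a₁ P t rest₁ → t.next = s.next → PhaseInv H P t → A.VacuumStep K P s t →
      ∃ H' after', A.Good H' after' ∧ Ext H after H' after' ∧
        (∀ f ∈ H'.events, f ∉ H.events → f.proc = P) ∧ Event.notify P s.next ∈ H'.events ∧
        (∀ i : ℕ, H.mem.removalView P = i → i ≠ s.next → Event.notify P i ∉ H'.events) ∧
        (H.mem.removalView P = s.next → (∀ r ∈ H'.requests P, Event.request P r ∈ H'.events) ∧
          ∀ k ∈ H'.received, k.tgt = P → Event.dequeue k ∈ H'.events) := by
    intro t H₁ a₁ rest₁ G₁ X₁ hnew S₁ hnext I₁ hst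
    obtain ⟨H', a', G', X', h1, h2, h3, h4⟩ := ih t hst G₁ (X.trans X₁) S₁ (by
      unfold PhaseInv at I₁ ⊢
      rwa [X₁.mem])
    rw [hnext] at h2 h3 h4
    rw [X₁.mem] at h3 h4
    refine ⟨H', a', G', X₁.trans X', fun f hf hf' => ?_, h2, h3, h4⟩
    by_cases h : f ∈ H₁.events
    exacts [hnew f h hf', h1 f hf h]
  -- The loop treats a transaction as one step, so the history first has to queue the remaining
  -- multicasts.
  obtain ⟨H₁, a₁, G₁, X₁, S₁, hnew₁⟩ := S.flush hlive G
  have hmem : K.mem = H₁.mem := (X.trans X₁).mem.symm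
  have hmem' : K.mem = H.mem := X.mem.symm
  have hrc : K.reqContent = H₁.reqContent := (X.trans X₁).reqContent.symm
  have hnew₂ : ∀ {H₂ : GroupComputation Pid Content Msg},
      (∀ f ∈ H₂.events, f ∉ H₁.events → f.proc = P) →
      ∀ f ∈ H₂.events, f ∉ H.events → f.proc = P := fun h f hf hf' => by
    by_cases h1 : f ∈ H₁.events
    exacts [hnew₁ f h1 hf', h f hf h1]
  obtain ⟨I1, I2, I3, I4⟩ := I
  rcases hs : s.phase
  · by_cases hr : s.requests = ∅
    · refine step _ G₁ X₁ hnew₁ (S₁.with_phase .packets) rfl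
        ⟨fun _ => hr, by simp, by simp, by simp⟩ (.requestsDone s hs (.inr hr))
    · obtain ⟨r, hr⟩ := Set.nonempty_iff_ne_empty.2 hr
      obtain ⟨H₂, a₂, G₂, X₂, S₂, hnew⟩ := S₁.request hlive G₁ hr
      refine step _ G₂ (X₁.trans X₂) (hnew₂ hnew) S₂ rfl ?_ ?_
      · exact ⟨fun h => absurd hs h, by simp [LoopState.absorb, hs],
          by simp [LoopState.absorb, hs], by simp [LoopState.absorb, hs]⟩
      · rw [← hrc]
        exact .request s r hs (hmem' ▸ S.join_lt) hr
  · have hreq := I1 (by simp [hs])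
    by_cases h : H.mem.removalView P ≠ s.next ∨ ∀ Q, Q ≠ P → s.inbox Q = []
    · refine step _ G₁ X₁ hnew₁ (S₁.with_phase .self) rfl
        ⟨fun _ => hreq, fun _ hn => h.resolve_left fun h => h hn, by simp, by simp⟩
        (.packetsDone s hs (hmem'.symm ▸ h))
    · push Not at h
      obtain ⟨hn, Q, hQ, hne⟩ := h
      obtain ⟨c, cs, hc⟩ := List.exists_cons_of_ne_nil hne
      obtain ⟨H₂, a₂, G₂, X₂, S₂, hnew⟩ := S₁.dequeue hlive G₁ hc (.inr (X₁.mem.symm ▸ hn))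
      refine step _ G₂ (X₁.trans X₂) (hnew₂ hnew) S₂ rfl ?_
        (.packet s Q c cs hs (hmem'.symm ▸ hn) hQ hc)
      exact ⟨fun _ => hreq, by simp [LoopState.absorb, LoopState.pop, hs],
        by simp [LoopState.absorb, LoopState.pop, hs],
        by simp [LoopState.absorb, LoopState.pop, hs]⟩
  · have hreq := I1 (by simp [hs])
    by_cases h : s.inbox P = []
    · refine step _ G₁ X₁ hnew₁ (S₁.with_phase .notify) rfl
        ⟨fun _ => hreq, fun _ => I2 (.inl hs), fun _ => h, by simp⟩ (.selfDone s hs h)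
    · obtain ⟨c, cs, hc⟩ := List.exists_cons_of_ne_nil h
      obtain ⟨H₂, a₂, G₂, X₂, S₂, hnew⟩ := S₁.dequeue hlive G₁ hc (.inl rfl)
      refine step _ G₂ (X₁.trans X₂) (hnew₂ hnew) S₂ rfl ?_ (.self s c cs hs hc)
      refine ⟨fun _ => hreq, fun _ hn Q hQ => ?_,
        by simp [LoopState.absorb, LoopState.pop, hs],
        by simp [LoopState.absorb, LoopState.pop, hs]⟩
      rw [absorb_inbox_of_ne hQ, pop_inbox_of_ne hQ]
      exact I2 (.inl hs) hn Q hQ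
  · have hreq := I1 (by simp [hs])
    have hself := I3 hs
    obtain ⟨H₂, a₂, G₂, X₂, hrec, hev⟩ := S₁.notify hlive G₁ hself
    refine ⟨H₂, a₂, G₂, X₁.trans X₂, hnew₂ fun f hf hf' => ?_, (hev _).2 (.inl rfl), ?_, ?_⟩
    · rw [((hev f).1 hf).resolve_right hf']
      rfl
    · intro i hi hne h
      rcases (hev _).1 h with h | h
      · cases h
        exact hne rfl
      · exact S₁.not_halted i (X₁.mem.symm ▸ hi) h
    -- Before the halting event, the loop has emptied the requests and all inboxes, so nothing is
    -- pending. The notification event itself adds no received packet.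
    · refine fun hn => ⟨fun r hr => (hev _).2 (.inr ?_), fun k hk hkP => (hev _).2 (.inr ?_)⟩
      · by_contra h
        rw [X₂.requests] at hr
        have : r ∈ s.requests := by
          rw [S₁.requests]
          exact ⟨hr, h⟩
        rw [hreq] at this
        exact this
      · rw [hrec] at hk
        by_contra h
        obtain ⟨l, hl, hin⟩ := S₁.inbox_eq k.src
        have h0 : s.inbox k.src = [] := by
          by_cases hks : k.src = P
          · rw [hks, hself]
          · exact I2 (.inr hs) hn _ hks
        rw [h0, eq_comm, List.map_eq_nil_iff] at hin
        subst hin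
        subst hkP
        exact List.not_mem_nil ((hl.2 k.serial).2 ⟨hk, h⟩)
  · exact absurd hs I4

end GroupComputation

/-! ### Completion of the halting processes, view by view. -/

namespace GroupComputation

open Protocol

variable {Pid Content Msg State : Type*}
variable {A : Protocol Pid Content Msg State} {H H' : GroupComputation Pid Content Msg}
  {after after' : Event Pid → State × List (Multicast Pid Content)} {e : Event Pid} {P Q : Pid}

/-- A lossless conforming history in which processes halt only when they are finished. -/
structure Tidy (A : Protocol Pid Content Msg State) (H : GroupComputation Pid Content Msg)
    (after : Event Pid → State × List (Multicast Pid Content)) : Prop where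
  good : A.Good H after
  finished : ∀ P (i : ℕ), H.mem.removalView P = i → Event.notify P i ∈ H.events → H.Finished P i

theorem notify_mem_of_not_halting (G : A.Good H after) (hQ : Q ∈ H.mem.procs)
    (hh : Q ∉ H.halting) {i : ℕ} (hj : H.mem.joinView Q ≤ i)
    (hr : (i : ℕ∞) < H.mem.removalView Q) : Event.notify Q i ∈ H.events := by
  refine G.basic.secondHalting.2 Q hQ hh i (hasNote_of_lt hQ hj hr) fun j _ h => ?_
  rw [G.lossless.no_dropped_notifications] at h
  exact h

/-- The vacuum loop of a process can be run until the next notification is processed. -/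
theorem Tidy.exists_notify_succ (hlive : A.RespectsLiveness) (hconv : A.VacuumConvergent)
    (T : Tidy A H after) {v : ℕ} (hP : P ∈ H.halting) (hj : H.mem.joinView P ≤ v)
    (hr : ((v + 1 : ℕ) : ℕ∞) ≤ H.mem.removalView P)
    (hn : ∀ i ≤ v, H.mem.joinView P ≤ i → Event.notify P i ∈ H.events)
    (hfin : H.mem.removalView P = (v + 1 : ℕ) → ∀ Q ∈ H.mem.procs, H.mem.joinView Q < v + 1 →
      ((v + 1 : ℕ) : ℕ∞) < H.mem.removalView Q → Event.notify Q (v + 1) ∈ H.events) :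
    ∃ H' after', Tidy A H' after' ∧ Ext H after H' after' ∧
      Event.notify P (v + 1) ∈ H'.events := by
  classical
  have G := T.good
  have B := G.basic
  by_cases hv : Event.notify P (v + 1) ∈ H.events
  · exact ⟨H, after, T, .refl _ _, hv⟩
  have hlate : ∀ i, v + 1 ≤ i → Event.notify P i ∉ H.events := fun i hi h =>
    hv (B.notify_le (by omega) hi h).1
  obtain ⟨d, hd, hmax⟩ := B.exists_max (B.firstHalting P hP).1
    ⟨_, hn v le_rfl hj, rfl⟩ subset_rfl
  choose l hl using exists_pending G hP
  -- The loop is restarted for each view, at the last event of `P`, with the self copies of its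
  -- unfinished transaction already in the inbox.
  let s : LoopState Pid Content State :=
    { phase := .requests
      next := v + 1
      state := (after d).1
      requests := {r | r ∈ H.requests P ∧ Event.request P r ∉ H.events}
      inbox := fun Q => (l Q).map (H.content Q) ++
        if Q = P then selfCopies P (after d).2 else [] }
  have S : Sim H after P s (after d).2 := by
    refine ⟨hP, ⟨d, ⟨hd, hmax⟩, rfl⟩, fun i hi => hlate i ?_, Nat.lt_succ_of_le hj, hr,
      fun i hi hi' => ⟨fun h => ?_, fun h => hn i (Nat.le_of_lt_succ h) hi⟩, rfl,
      fun Q hQ => ⟨l Q, hl Q, by simp [s, hQ]⟩, ⟨l P, hl P, by simp [s]⟩⟩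
    · rw [hi] at hr
      exact_mod_cast hr
    · by_contra h'
      exact hlate i (not_lt.1 h') h
  -- A failure of accessibility yields an infinite run of the loop from `s`, which convergence
  -- excludes. That the parent has processed the joining follows from the presence of the join
  -- event.
  have hacc : Acc (fun t t' => A.VacuumStep H P t' t) s := by
    by_contra h
    obtain ⟨u, hu⟩ := not_acc_iff_exists_descending_chain.1 h
    refine hconv H after ⟨⟨B, after, G.generates⟩, G.live⟩ G.conforming G.lossless G.generates P hP
      (fun h0 => ?_) s (S.loopStart rfl) ⟨u, hu⟩
    exact (B.parent _ (.notify P (H.mem.joinView P)) ⟨P, B.wellFormed.halting_sub hP, h0, rfl, rfl⟩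
      (hn _ hj le_rfl)).1
  obtain ⟨H', a', G', X, hnew, hnot, hnh, hdone⟩ := Sim.advance hlive hacc G (.refl _ _) S
    ⟨fun h => absurd rfl h, by simp [s], by simp [s], by simp [s]⟩
  refine ⟨H', a', ⟨G', fun Q i hi hm => ?_⟩, X, hnot⟩
  have hi' : H.mem.removalView Q = i := X.mem ▸ hi
  by_cases hm' : Event.notify Q i ∈ H.events
  · exact (T.finished Q i hi' hm').ext G' X
  · obtain rfl : Q = P := hnew _ hm hm'
    obtain rfl : i = v + 1 := by
      by_contra hne
      exact hnh i hi' hne hm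
    obtain ⟨h1, h2⟩ := hdone hi'
    refine ⟨hi, hm, h1, h2, fun R hR hjR hrR => ?_⟩
    rw [X.mem] at hR hjR hrR
    exact X.events (hfin hi' R hR hjR hrR)

/-- A process joins after its parent has processed the notification of the joining. -/
theorem Tidy.exists_join (hlive : A.RespectsLiveness) (T : Tidy A H after) (hP : P ∈ H.halting)
    (h0 : 0 < H.mem.joinView P)
    (hpar : Event.notify (H.mem.parent P) (H.mem.joinView P) ∈ H.events) :
    ∃ H' after', Tidy A H' after' ∧ Ext H after H' after' ∧
      Event.notify P (H.mem.joinView P) ∈ H'.events := by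
  classical
  have G := T.good
  have B := G.basic
  by_cases hv : Event.notify P (H.mem.joinView P) ∈ H.events
  · exact ⟨H, after, T, .refl _ _, hv⟩
  have hPp := B.wellFormed.halting_sub hP
  have hempty : ∀ f ∈ H.events, f.proc ≠ P := by
    rintro f hf rfl
    exact hv (B.notify_joinView_mem hf)
  have hfork : H.Fork (.notify (H.mem.parent P) (H.mem.joinView P))
      (.notify P (H.mem.joinView P)) := ⟨P, hPp, h0, rfl, rfl⟩
  obtain ⟨hpp, hpj, hpr⟩ := GroupViews.parent_spec hPp h0
  -- The child inherits the state in which its parent dequeues the notification, which is that after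
  -- the preceding event. A preceding event exists because the join event of the parent comes
  -- earlier.
  obtain ⟨h1, h2⟩ := B.notificationOrder _ _ _ le_rfl hpj hpr.le hpar
  obtain ⟨p, hp, -⟩ := B.exists_pred (by rfl) h2
  have C : CanAppend A H after (.notify P (H.mem.joinView P)) ∅ (H.content P 0)
      (A.onNote H.mem (.new P) (after p).1) := by
    refine ⟨hP, hv, fun i _ h => hempty _ h rfl, ?_, ?_, ?_,
      .inr ⟨Set.eq_empty_of_forall_notMem fun f hf => hempty f hf.1 hf.2, _, p, hfork, hpar, hp,
        ?_⟩⟩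
    · rintro k h
      cases h
    · rintro P i h
      cases h
      exact ⟨⟨_, .new P hPp⟩, fun i hi hi' => absurd hi (not_le.2 hi'),
        fun n hn => absurd rfl (hempty _ hn.1)⟩
    · rintro P r h
      cases h
    · exact Handles.notify (A := A)
        (H := H.append (.notify P (H.mem.joinView P)) ∅ (H.content P 0)) _ _ _ _ (.new P hPp)
  have G' := C.good hlive G
  refine ⟨_, _, ⟨G', fun Q i hi hm => ?_⟩, C.ext B, .inl rfl⟩
  rcases hm with hm | hm
  · cases hm
    exact absurd hi (GroupViews.joinView_lt_removalView hPp).ne'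
  · exact (T.finished Q i hi hm).ext G' (C.ext B)

/-- Extensions for each of finitely many processes can be combined. -/
theorem Tidy.exists_forall_mem {S : Set Pid} (hS : S.Finite) (g : Pid → Event Pid)
    (T : Tidy A H after) (h : ∀ P ∈ S, ∀ H' after', Tidy A H' after' → Ext H after H' after' →
      ∃ H'' after'', Tidy A H'' after'' ∧ Ext H' after' H'' after'' ∧ g P ∈ H''.events) :
    ∃ H' after', Tidy A H' after' ∧ Ext H after H' after' ∧ ∀ P ∈ S, g P ∈ H'.events := by
  induction S, hS using Set.Finite.induction_on with
  | empty => exact ⟨H, after, T, .refl _ _, fun P hP => absurd hP (Set.notMem_empty _)⟩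
  | @insert P S _ _ ih =>
    obtain ⟨H₁, a₁, T₁, X₁, h₁⟩ := ih fun Q hQ => h Q (.inr hQ)
    obtain ⟨H₂, a₂, T₂, X₂, h₂⟩ := h P (.inl rfl) H₁ a₁ T₁ X₁
    refine ⟨H₂, a₂, T₂, X₁.trans X₂, ?_⟩
    rintro Q (rfl | hQ)
    exacts [h₂, X₂.events (h₁ Q hQ)]

/-- The halting processes have processed the notifications of the views up to `v`. -/
def Notified (H : GroupComputation Pid Content Msg) (v : ℕ) : Prop :=
  ∀ P ∈ H.halting, ∀ i ≤ v, H.mem.joinView P ≤ i → (i : ℕ∞) ≤ H.mem.removalView P →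
    Event.notify P i ∈ H.events

theorem Tidy.exists_notified_succ (hlive : A.RespectsLiveness) (hconv : A.VacuumConvergent)
    (T : Tidy A H after) {v : ℕ} (hv : H.Notified v) :
    ∃ H' after', Tidy A H' after' ∧ Ext H after H' after' ∧ H'.Notified (v + 1) := by
  have hsub : ∀ p : Pid → Prop,
      {P | P ∈ H.halting ∧ H.mem.joinView P ≤ v + 1 ∧ p P}.Finite := fun p =>
    (H.mem.finite_joinView_le (v + 1)).subset fun P hP =>
      ⟨T.good.basic.wellFormed.halting_sub hP.1, hP.2.1⟩
  -- Continuing members come first: they include the parents of the joining processes and all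
  -- senders that could still write to a process removed at this view.
  obtain ⟨H₁, a₁, T₁, X₁, h₁⟩ := T.exists_forall_mem
    (hsub fun P => H.mem.joinView P ≤ v ∧ ((v + 1 : ℕ) : ℕ∞) < H.mem.removalView P)
    (fun P => .notify P (v + 1)) <| by
      rintro P ⟨hP, -, hj, hr⟩ H' a' T' X'
      refine T'.exists_notify_succ hlive hconv (X'.halting ▸ hP) (X'.mem ▸ hj)
        (X'.mem ▸ hr.le) (fun i hi hji => ?_) fun h => ?_
      · rw [X'.mem] at hji
        exact X'.events (hv P hP i hi hji (le_trans (by exact_mod_cast (by omega)) hr.le))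
      · rw [X'.mem] at h
        exact absurd h hr.ne'
  have hn₁ : ∀ Q ∈ H.mem.procs, H.mem.joinView Q ≤ v →
      ((v + 1 : ℕ) : ℕ∞) < H.mem.removalView Q → Event.notify Q (v + 1) ∈ H₁.events := by
    intro Q hQ hj hr
    by_cases hh : Q ∈ H.halting
    · exact h₁ Q ⟨hh, by omega, hj, hr⟩
    · exact X₁.events (notify_mem_of_not_halting T.good hQ hh (by omega) hr)
  obtain ⟨H₂, a₂, T₂, X₂, h₂⟩ := T₁.exists_forall_mem
    (hsub fun P => H.mem.joinView P = v + 1) (fun P => .notify P (v + 1)) <| by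
      rintro P ⟨hP, -, hj⟩ H' a' T' X'
      have hPp := T.good.basic.wellFormed.halting_sub hP
      obtain ⟨h1, h2, h3⟩ := GroupViews.parent_spec hPp (by omega)
      have hX := X₁.trans X'
      rw [← hj] at hn₁ ⊢
      have := T'.exists_join hlive (P := P) (hX.halting ▸ hP) (by rw [hX.mem]; omega)
        (by rw [hX.mem]; exact X'.events (hn₁ _ h1 (by omega) h3))
      rwa [hX.mem] at this
  have hX₂ := X₁.trans X₂
  -- Processes removed at this view come last, so that the condition `notified` of `Finished` holds
  -- when they halt.
  obtain ⟨H₃, a₃, T₃, X₃, h₃⟩ := T₂.exists_forall_mem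
    (hsub fun P => H.mem.joinView P ≤ v ∧ H.mem.removalView P = (v + 1 : ℕ))
    (fun P => .notify P (v + 1)) <| by
      rintro P ⟨hP, -, hj, hr⟩ H' a' T' X'
      have hX := hX₂.trans X'
      refine T'.exists_notify_succ hlive hconv (hX.halting ▸ hP) (hX.mem ▸ hj)
        (by rw [hX.mem, hr]) (fun i hi hji => ?_) fun _ Q hQ hjQ hrQ => ?_
      · rw [hX.mem] at hji
        refine hX.events (hv P hP i hi hji ?_)
        rw [hr]
        exact_mod_cast (by omega)
      · rw [hX.mem] at hQ hjQ hrQ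
        exact (X₂.trans X').events (hn₁ Q hQ (by omega) hrQ)
  have hX₃ := hX₂.trans X₃
  refine ⟨H₃, a₃, T₃, hX₃, ?_⟩
  unfold Notified
  rw [hX₃.halting, hX₃.mem]
  intro P hP i hi hj hr
  rcases Nat.le_or_eq_of_le_succ hi with hi | rfl
  · exact hX₃.events (hv P hP i hi hj hr)
  · by_cases hj' : H.mem.joinView P = v + 1
    · exact X₃.events (h₂ P ⟨hP, by omega, hj'⟩)
    · have hj'' : H.mem.joinView P ≤ v := by omega
      rcases hr.lt_or_eq with hr | hr
      · exact X₃.events (X₂.events (h₁ P ⟨hP, by omega, hj'', hr⟩))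
      · exact h₃ P ⟨hP, by omega, hj'', hr.symm⟩

/-- A tidy history extends to one in which all processes that halt are finished. -/
theorem Tidy.exists_finished (hlive : A.RespectsLiveness) (hconv : A.VacuumConvergent)
    (T : Tidy A H after) (h0 : H.Notified 0) :
    ∃ H' after', A.Good H' after' ∧ Ext H after H' after' ∧ (∀ v, H'.Notified v) ∧
      ∀ P ∈ H.halting, ∀ i : ℕ, H.mem.removalView P = i → H'.Finished P i := by
  let V (n : ℕ) := {p : GroupComputation Pid Content Msg ×
    (Event Pid → State × List (Multicast Pid Content)) // Tidy A p.1 p.2 ∧ p.1.Notified n}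
  have hstep : ∀ n (p : V n), ∃ q : V (n + 1), Ext p.1.1 p.1.2 q.1.1 q.1.2 := by
    rintro n ⟨p, hp, hn⟩
    obtain ⟨H', a', T', X', h'⟩ := hp.exists_notified_succ hlive hconv hn
    exact ⟨⟨(H', a'), T', h'⟩, X'⟩
  choose F hF using hstep
  let u : ∀ n, V n := fun n => Nat.rec ⟨(H, after), T, h0⟩ (fun n p => F n p) n
  have X : ∀ m n, m ≤ n → Ext (u m).1.1 (u m).1.2 (u n).1.1 (u n).1.2 := by
    intro m n hmn
    induction n, hmn using Nat.le_induction with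
    | base => exact .refl _ _
    | succ n _ ih => exact ih.trans (hF n (u n))
  let Hs : ℕ → GroupComputation Pid Content Msg := fun n => (u n).1.1
  have G : ∀ n, A.Good (Hs n) (u n).1.2 := fun n => (u n).2.1.good
  have hnot : ∀ P ∈ H.halting, ∀ i : ℕ, H.mem.joinView P ≤ i → (i : ℕ∞) ≤ H.mem.removalView P →
      Event.notify P i ∈ (Hs i).events := by
    intro P hP i hj hr
    have hX := X 0 i i.zero_le
    exact (u i).2.2 P (hX.halting ▸ hP) i le_rfl (hX.mem ▸ hj) (hX.mem ▸ hr)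
  have hjoin : ∀ P ∈ H.halting, ∀ i : ℕ, H.mem.removalView P = i → H.mem.joinView P ≤ i := by
    intro P hP i hi
    have := GroupViews.joinView_lt_removalView (T.good.basic.wellFormed.halting_sub hP)
    rw [hi] at this
    exact_mod_cast this.le
  -- The stage whose index is the removal view of `P` contains the halting event. Every later event
  -- at `P` would have to precede it, and extensions insert nothing before old events.
  have hfin : ∀ P ∈ (Hs 0).halting, ∃ m, ∀ n, ∀ e ∈ (Hs n).eventsAt P, e ∈ (Hs m).events := by
    intro P hP
    obtain ⟨i, hi⟩ := ENat.ne_top_iff_exists.1 (T.good.conforming.gms P hP)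
    have hm := hnot P hP i (hjoin P hP i hi.symm) hi.le
    refine ⟨i, fun n e he => ?_⟩
    have he' := (X n (max n i) (le_max_left _ _)).events he.1
    have hX := X i (max n i) (le_max_right _ _)
    refine hX.mem_of_le he' hm he.2 ?_
    refine (G (max n i)).basic.orderFoundation.halt_last P i ?_ (hX.events hm) e ⟨he', he.2⟩
    rw [hi]
    exact congrArg (fun M => GroupViews.removalView M P) (X 0 _ (Nat.zero_le _)).mem
  have Y := ext_limit (Hs := Hs) X G
  have B' := limit_basic (Hs := Hs) X G hfin
  have G' := limit_generates (Hs := Hs) X G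
  have C' := limit_conforming (Hs := Hs) X G
  have GT : A.Good (limit Hs) _ := ⟨B', G', hlive _ ⟨B', _, G'⟩ C', C',
    limit_lossless (Hs := Hs) X G⟩
  refine ⟨_, _, GT, Y 0, fun v => ?_, fun P hP i hi => ?_⟩
  · exact fun P hP i _ hj hr => (Y i).events (hnot P hP i hj hr)
  · have hm := hnot P hP i (hjoin P hP i hi) hi.ge
    exact ((u i).2.1.finished P i ((X 0 i i.zero_le).mem ▸ hi) hm).ext GT (Y i)

theorem undropped_tidy (hlive : A.RespectsLiveness) (B : H.BasicAxioms) (L : H.LivenessAxiom)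
    (C : H.Conforming) (Ge : A.Generates H after) :
    Tidy A H.undropped after ∧ H.undropped.Notified 0 := by
  have G := undropped_good hlive B L C Ge
  refine ⟨⟨G, fun P i hi h => absurd (isHaltEvent_notify_iff.2 hi) h.2⟩, fun P hP i hi hj _ => ?_⟩
  obtain rfl : i = 0 := by omega
  exact G.basic.wellFormed.original P (G.basic.wellFormed.halting_sub hP) (by omega)

end GroupComputation

namespace GroupComputation

open Protocol

variable {Pid Content Msg State : Type*}
variable {A : Protocol Pid Content Msg State} {H T : GroupComputation Pid Content Msg}
  {after after' : Event Pid → State × List (Multicast Pid Content)} {e f : Event Pid} {P Q : Pid}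

/-! ### Transactional histories -/

/-- While multicasts are outstanding the event cannot be the last one of its process, and the next
event must be the queuing of one of them; so induction on their number applies. -/
theorem completed_of_not_halting (G : A.Good H after) :
    ∀ e ∈ H.events, e.proc ∉ H.halting → Completed H after e := by
  have B := G.basic
  suffices h : ∀ (n : ℕ) (e : Event Pid), (after e).2.length = n → e ∈ H.events →
      e.proc ∉ H.halting → Completed H after e from fun e => h _ e rfl
  intro n
  induction n with
  | zero =>
    intro e h he hh
    exact ⟨he, e, ⟨he, rfl⟩, B.le_refl he, List.length_eq_zero_iff.1 h⟩
  | succ n ih =>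
    intro e h he hh
    have hne : (after e).2 ≠ [] := by
      intro h'
      simp [h'] at h
    obtain ⟨g, hg, hlt⟩ : ∃ g ∈ H.eventsAt e.proc, ¬ H.le g e := by
      by_contra! hlast
      exact hne (G.generates.complete e he hh hlast)
    obtain ⟨d, hd, -⟩ := B.exists_succ (f := g) hg.2.symm
      ((B.le_or_lt hg.1 he hg.2).resolve_left hlt)
    have hs := G.generates.step e d hd
    have hlen : (after d).2.length = n := by
      generalize after e = x at hs hne h
      generalize after d = y at hs
      cases hs with
      | trigger => exact absurd rfl hne
      | queue => simpa using h
    obtain ⟨-, q, hq, hdq, hq'⟩ := ih d hlen hd.2.1 (hd.2.2.1 ▸ hh)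
    exact ⟨he, q, ⟨hq.1, hq.2.trans hd.2.2.1.symm⟩, B.le_trans hd.2.2.2.1.1 hdq, hq'⟩

/-- The halting event is a trigger without side effects and comes last. Being a trigger it requires
completion of the earlier transactions, and it leaves nothing to be queued. -/
theorem completed_of_finished (G : A.Good H after) {i : ℕ} (F : H.Finished P i)
    (he : e ∈ H.eventsAt P) : Completed H after e := by
  have B := G.basic
  refine ⟨he.1, .notify P i, ⟨F.mem, he.2.symm⟩,
    B.orderFoundation.halt_last P i F.removalView F.mem e he, ?_⟩
  have hP : P ∈ H.mem.procs := B.wellFormed.proc_mem _ F.mem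
  have hj := GroupViews.joinView_lt_removalView hP
  rw [F.removalView] at hj
  obtain ⟨-, hlt⟩ := B.notificationOrder P _ i le_rfl (by exact_mod_cast hj) F.removalView.ge F.mem
  obtain ⟨d, hd, -⟩ := B.exists_pred (by rfl) hlt
  have hs := G.generates.step _ _ hd
  generalize after d = x at hs
  generalize after (Event.notify P i) = y at hs
  cases hs with
  | trigger s _ _ h =>
    cases h with
    | notify _ _ c _ hc =>
      obtain ⟨rfl, -⟩ := hc.eq_dead F.removalView
      rfl

/-- Received packets to a halting process are dequeued because it is finished. From a halting
process to one that does not halt the channel is upstream, where losslessness helps; between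
processes that do not halt all packets are dequeued anyway. -/
theorem transactional_of_finished (G : A.Good H after) (hn : ∀ v, H.Notified v)
    (hF : ∀ P ∈ H.halting, ∀ i : ℕ, H.mem.removalView P = i → H.Finished P i) :
    A.Transactional H := by
  have B := G.basic
  have hF' : ∀ P ∈ H.halting, ∃ i, H.Finished P i := fun P hP => by
    obtain ⟨i, hi⟩ := ENat.ne_top_iff_exists.1 (G.conforming.gms P hP)
    exact ⟨i, hF P hP i hi.symm⟩
  have hC : ∀ e ∈ H.events, Completed H after e := by
    intro e he
    by_cases hh : e.proc ∈ H.halting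
    · obtain ⟨i, F⟩ := hF' _ hh
      exact completed_of_finished G F ⟨he, rfl⟩
    · exact completed_of_not_halting G e he hh
  refine ⟨⟨⟨B, after, G.generates⟩, G.live⟩, G.conforming, G.lossless, after, G.generates, ?_, ?_,
    ?_⟩
  · intro P i hi
    apply hC
    by_cases hh : P ∈ H.halting
    · exact hn i P hh i le_rfl hi.joinView_le hi.le_removalView
    · refine B.secondHalting.2 P hi.mem_procs hh i hi fun j _ h => ?_
      rw [G.lossless.no_dropped_notifications] at h
      exact h
  · intro P hP r hr
    apply hC
    by_cases hh : P ∈ H.halting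
    · obtain ⟨i, F⟩ := hF' _ hh
      exact F.requests r hr
    · exact B.fourthHalting P hP hh r hr
  · intro k hk
    apply hC
    have hkp := B.wellFormed.sent_sub (B.wellFormed.received_sub hk)
    obtain ⟨ht, -⟩ := G.live.removalView_lt B hkp
    by_cases hh : k.tgt ∈ H.halting
    · obtain ⟨i, F⟩ := hF' _ hh
      exact F.received k hk rfl
    · by_cases hs : k.src ∈ H.halting
      · refine G.lossless.upstream k hk ⟨?_, fun h => hh (h ▸ hs)⟩
        rw [G.conforming.removalView_eq ht hh]
        exact GroupViews.removalView_le_numViews (B.wellFormed.halting_sub hs)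
      · exact dequeue_mem_of_not_halting B G.conforming hkp ht hs hh

/-! ### Vacuum events -/

theorem BasicAxioms.le_of_reaches (B : H.BasicAxioms) (he : e ∈ H.events) (h : H.Reaches e f) :
    H.le e f := by
  unfold Reaches at h
  induction h with
  | refl => exact B.le_refl he
  | tail _ h ih => exact B.le_trans ih (B.le_of_primitive h)

theorem isVacuum_of_isHaltEvent (B : H.BasicAxioms) (C : H.Conforming) (he : e ∈ H.events)
    (h : H.IsHaltEvent e) : H.IsVacuum e := by
  have key : ∀ f, H.Reaches e f → e = f := fun f hf =>
    B.isHaltEvent_maximal h (B.le_of_reaches he hf)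
  have hh := proc_mem_halting_of_isHaltEvent B C he h
  refine ⟨hh, (Set.finite_singleton e).subset fun f hf => (key f hf).symm, fun f hf => ?_⟩
  rw [← key f hf]
  exact hh

/-- The events by which a lossless history is extended are vacuum events. -/
theorem Ext.isVacuum_of_notMem (B : H.BasicAxioms) (C : H.Conforming) (BT : T.BasicAxioms)
    (X : Ext H after T after') (he : e ∈ T.events) (he' : e ∉ H.events) : T.IsVacuum e := by
  have hP := X.halting_of_new e he he'
  obtain ⟨p, hp⟩ := ENat.ne_top_iff_exists.1 (C.gms _ hP)
  have hPp := B.wellFormed.halting_sub hP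
  -- With `p` the removal view of the process of `e`, this bound covers that process and all of its
  -- children, which join before `p`.
  obtain ⟨R, hR⟩ : ∃ R : ℕ, ∀ Q ∈ H.halting, H.mem.joinView Q ≤ p → H.mem.removalView Q ≤ R := by
    have hfin : {Q | Q ∈ H.halting ∧ H.mem.joinView Q ≤ p}.Finite :=
      (H.mem.finite_joinView_le p).subset fun Q hQ => ⟨B.wellFormed.halting_sub hQ.1, hQ.2⟩
    obtain ⟨R, hR⟩ := (hfin.image fun Q => (H.mem.removalView Q).toNat).bddAbove
    refine ⟨R, fun Q hQ hj => ?_⟩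
    rw [← ENat.natCast_toNat (C.gms Q hQ)]
    exact_mod_cast hR ⟨Q, ⟨hQ, hj⟩, rfl⟩
  -- This set is finite and closed under causal steps. Its events are at the process of `e`, at a
  -- process without events in `H`, or after all notifications of their process that precede its
  -- removal.
  let S : Set (Event Pid) := {f | f ∈ T.events ∧ f ∉ H.events ∧
    H.mem.removalView f.proc ≤ R ∧ (f.proc = e.proc ∨ H.eventsAt f.proc = ∅ ∨
      ∀ i : ℕ, H.mem.joinView f.proc ≤ i → (i : ℕ∞) < H.mem.removalView f.proc →
        Event.notify f.proc i ∈ T.events ∧ T.lt (.notify f.proc i) f)}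
  have hSh : ∀ f ∈ S, f.proc ∈ H.halting := fun f hf => X.halting_of_new f hf.1 hf.2.1
  have hSfin : S.Finite := by
    have hfin : {Q | Q ∈ H.halting ∧ H.mem.removalView Q ≤ R}.Finite := by
      refine (H.mem.finite_joinView_le R).subset fun Q hQ => ?_
      have hQp := B.wellFormed.halting_sub hQ.1
      exact ⟨hQp, by exact_mod_cast ((GroupViews.joinView_lt_removalView hQp).trans_le hQ.2).le⟩
    refine (hfin.biUnion fun Q hQ => (BT.firstHalting Q (X.halting ▸ hQ.1)).1).subset ?_
    intro f hf
    exact Set.mem_biUnion (show f.proc ∈ {Q | Q ∈ H.halting ∧ H.mem.removalView Q ≤ R} from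
      ⟨hSh f hf, hf.2.2.1⟩) ⟨hf.1, rfl⟩
  have heS : e ∈ S := by
    refine ⟨he, he', hR _ hP ?_, .inl rfl⟩
    have := GroupViews.joinView_lt_removalView hPp
    rw [← hp] at this
    exact_mod_cast this.le
  have hclosed : ∀ f g, f ∈ S → T.Primitive f g → g ∈ S := by
    rintro f g ⟨hf, hf', hfR, hcase⟩ hfg
    have hg' : g ∉ H.events := fun h => hf' (X.closed f g h hfg)
    have hlocal : f.proc = g.proc → T.le f g → g ∈ S := by
      intro hpr hle
      refine ⟨hfg.2.1, hg', hpr ▸ hfR, ?_⟩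
      rw [← hpr]
      refine hcase.imp_right (Or.imp_right fun h i hi hi' => ?_)
      exact ⟨(h i hi hi').1, BT.lt_of_lt_of_le (h i hi hi').2 hle⟩
    have hgle := BT.le_of_primitive hfg
    rcases hfg.2.2 with ⟨hpr, hle⟩ | ⟨k, hk, rfl, rfl⟩ | ⟨J, hJ, h0, rfl, rfl⟩
    · exact hlocal hpr hle
    · rcases X.dequeue_new k hfg.2.1 hg' with h | ⟨h1, h2⟩
      · exact hlocal h hgle
      · exact ⟨hfg.2.1, hg', h1.le.trans hfR, .inr (.inr h2)⟩
    · rw [X.mem] at *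
      have hempty : H.eventsAt J = ∅ := by
        refine Set.eq_empty_of_forall_notMem fun g hg => hg' ?_
        have := B.notify_joinView_mem hg.1
        rwa [hg.2] at this
      have hJh : J ∈ H.halting := X.halting_of_new _ hfg.2.1 hg'
      obtain ⟨h1, h2, h3⟩ := GroupViews.parent_spec hJ h0
      refine ⟨hfg.2.1, hg', ?_, .inr (.inl hempty)⟩
      change H.mem.removalView J ≤ R
      -- Only the process of `e` can fork: a process without events in `H` has no children by
      -- conformity, and after the last ordinary notification there is no joining left to process.
      rcases hcase with h | h | h
      · refine hR J hJh ?_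
        have h : H.mem.parent J = e.proc := h
        rw [h, ← hp] at h3
        exact_mod_cast h3.le
      · exact absurd rfl (C.parent _ h1 h J hJ h0)
      · have := (h _ h2.le h3).2
        exact absurd this.1 this.2
  have hreach : ∀ f, T.Reaches e f → f ∈ S := by
    intro f hf
    unfold Reaches at hf
    induction hf with
    | refl => exact heS
    | tail _ h ih => exact hclosed _ _ ih h
  exact ⟨X.halting ▸ hP, hSfin.subset hreach, fun f hf => X.halting ▸ hSh f (hreach f hf)⟩

theorem finite_setOf_primitive (B : H.BasicAxioms) (he : e.proc ∈ H.halting) :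
    {f | H.Primitive e f}.Finite := by
  have h1 : {f | ∃ k ∈ H.packets, e = .queue k.src k.serial ∧ f = Event.dequeue k}.Finite := by
    cases e with
    | queue P n =>
      refine ((H.targets P n).finite_toSet.image fun Q => Event.dequeue ⟨P, n, Q⟩).subset ?_
      rintro _ ⟨⟨P', n', Q⟩, hk, h, rfl⟩
      cases h
      exact ⟨Q, hk.2, rfl⟩
    | _ => simp
  have h2 : {f | H.Fork e f}.Finite := by
    cases e with
    | notify P i =>
      refine ((H.mem.finite_joinView_le i).image fun J => Event.notify J i).subset ?_
      rintro _ ⟨J, hJ, h0, h, rfl⟩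
      cases h
      exact ⟨J, ⟨hJ, le_rfl⟩, rfl⟩
    | _ => simp [Fork]
  refine (((B.firstHalting _ he).1.union h1).union h2).subset ?_
  rintro f ⟨-, hf, ⟨hp, -⟩ | h | h⟩
  · exact .inl (.inl ⟨hf, hp.symm⟩)
  · exact .inl (.inr h)
  · exact .inr h

/-- Vacuum events remain vacuum events when a lossless history is extended. -/
theorem Ext.isVacuum_of_isVacuum (B : H.BasicAxioms) (C : H.Conforming) (BT : T.BasicAxioms)
    (X : Ext H after T after') (he : e ∈ H.events) (hv : H.IsVacuum e) : T.IsVacuum e := by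
  obtain ⟨h1, h2, h3⟩ := hv
  -- A causal path can leave `H` only once. It does so by a step from one of the finitely many old
  -- successors, each with finitely many direct successors in `T`, to a new event, which is a vacuum
  -- event.
  have hpath : ∀ g, T.Reaches e g → g ∈ H.events ∧ H.Reaches e g ∨
      ∃ f, H.Reaches e f ∧ ∃ g', T.Primitive f g' ∧ g' ∉ H.events ∧ T.Reaches g' g := by
    intro g hg
    unfold Reaches at hg
    induction hg with
    | refl => exact .inl ⟨he, .refl⟩
    | @tail g h _ hgh ih =>
      rcases ih with ⟨hgm, hg⟩ | ⟨f, hf, g', hg', hn, hr⟩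
      · by_cases hm : h ∈ H.events
        · exact .inl ⟨hm, hg.tail ((X.primitive_iff hgm hm).1 hgh)⟩
        · exact .inr ⟨g, hg, h, hgh, hm, .refl⟩
      · exact .inr ⟨f, hf, g', hg', hn, hr.tail hgh⟩
  have hvac : ∀ f g', T.Primitive f g' → g' ∉ H.events → T.IsVacuum g' :=
    fun f g' h h' => X.isVacuum_of_notMem B C BT h.2.1 h'
  refine ⟨X.halting ▸ h1, ?_, fun g hg => ?_⟩
  · have hfin : (⋃ f ∈ {f | H.Reaches e f}, ⋃ g' ∈ {g' | T.Primitive f g' ∧ g' ∉ H.events},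
        {g | T.Reaches g' g}).Finite := by
      refine h2.biUnion fun f hf => Set.Finite.biUnion ?_ fun g' hg' => (hvac f g' hg'.1 hg'.2).2.1
      exact (finite_setOf_primitive BT (X.halting ▸ h3 f hf)).subset fun g' hg' => hg'.1
    refine (h2.union hfin).subset fun g hg => ?_
    rcases hpath g hg with h | ⟨f, hf, g', hg', hn, hr⟩
    · exact .inl h.2
    · right
      simp only [Set.mem_iUnion]
      exact ⟨f, hf, g', ⟨hg', hn⟩, hr⟩
  · rcases hpath g hg with h | ⟨f, hf, g', hg', hn, hr⟩
    · exact X.halting ▸ h3 g h.2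
    · exact (hvac f g' hg' hn).2.2 g hr

/-! ### Comparison of the original history with its completion. -/

section undropped

/-- The halting events that were taken back reappear when their processes are finished. -/
theorem events_subset_of_undropped (B : H.BasicAxioms) (C : H.Conforming)
    (X : Ext H.undropped after T after')
    (hF : ∀ P ∈ H.halting, ∀ i : ℕ, H.mem.removalView P = i → T.Finished P i) : H.events ⊆ T.events := by
  intro e he
  by_cases h : H.IsHaltEvent e
  · have hh := proc_mem_halting_of_isHaltEvent B C he h
    obtain ⟨P, i, hi, rfl⟩ := h
    exact (hF P hh i hi).mem
  · exact X.events ⟨he, h⟩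

variable (B : H.BasicAxioms) (C : H.Conforming) (GT : A.Good T after')
  (X : Ext H.undropped after T after')
  (hF : ∀ P ∈ H.halting, ∀ i : ℕ, H.mem.removalView P = i → T.Finished P i)
include B C GT X hF

theorem primitive_of_undropped (h : H.Primitive e f) : T.Primitive e f := by
  have hsub := events_subset_of_undropped B C X hF
  refine ⟨hsub h.1, hsub h.2.1, ?_⟩
  rcases h.2.2 with ⟨hp, hle⟩ | ⟨k, hk, rfl, rfl⟩ | h'
  · refine .inl ⟨hp, ?_⟩
    by_cases hf : H.IsHaltEvent f
    · obtain ⟨P, i, hi, rfl⟩ := hf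
      exact GT.basic.orderFoundation.halt_last P i (X.mem ▸ hi) (hsub h.2.1) e ⟨hsub h.1, hp⟩
    · have he := not_isHaltEvent_of_le B hle hf
      exact (X.le_iff e ⟨h.1, he⟩ f ⟨h.2.1, hf⟩).2 ⟨hle, he, hf⟩
  · exact .inr (.inl ⟨k, X.packets_subset (undropped_packets.symm ▸ hk), rfl, rfl⟩)
  · exact .inr (.inr (h'.congr X.mem.symm))

theorem le_of_undropped (h : H.le e f) : T.le e f := by
  obtain ⟨h1, -, h3⟩ := (B.minimalOrder e f).1 h
  have BT := GT.basic
  induction h3 with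
  | refl => exact BT.le_refl (events_subset_of_undropped B C X hF h1)
  | @tail b c hb hbc ih =>
    have hbm : b ∈ H.events := by
      rcases hbc with h | ⟨h, -⟩
      exacts [h.1, h.2.1]
    refine BT.le_trans (ih ((B.minimalOrder e b).2 ⟨h1, hbm, hb⟩)) ?_
    rcases hbc with h | ⟨h, h'⟩
    · exact BT.le_of_primitive (primitive_of_undropped B C GT X hF h)
    · exact (BT.parent _ _ (h'.congr X.mem.symm)
        (primitive_of_undropped B C GT X hF h).2.1).2.2

theorem le_iff_of_undropped (he : e ∈ H.events) (hf : f ∈ H.events)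
    (hfh : ¬ H.IsHaltEvent f) : T.le e f ↔ H.le e f := by
  refine ⟨fun h => ?_, le_of_undropped B C GT X hF⟩
  have heh : ¬ H.IsHaltEvent e := by
    intro heh
    have heT : T.IsHaltEvent e := by
      obtain ⟨P, i, hi, rfl⟩ := heh
      exact ⟨P, i, X.mem ▸ hi, rfl⟩
    exact hfh (GT.basic.isHaltEvent_maximal heT h ▸ heh)
  exact ((X.le_iff e ⟨he, heh⟩ f ⟨hf, hfh⟩).1 h).1

theorem extends_of_undropped : H.Extends T where
  frame := ⟨X.mem.symm, X.halting.symm, X.requests.symm, fun _ _ _ => by rw [X.reqContent]; rfl⟩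
  events := events_subset_of_undropped B C X hF
  multicast P n h := ⟨(X.targets P n ⟨h, not_isHaltEvent_queue⟩).symm,
    (X.content P n ⟨h, not_isHaltEvent_queue⟩).symm⟩
  order _ _ _ _ h := le_of_undropped B C GT X hF h
  order_back _ he _ hf hfh h := (le_iff_of_undropped B C GT X hF he hf hfh).1 h
  closed _ _ _ hf hfh h := (X.mem_of_reaches ⟨hf, hfh⟩ h).1.1

/-- Causality in `H` embeds into that of `T`, which gives one direction. For the other, halting
events are maximal in `T`, and any other event remains a vacuum event in `undropped`, which has
fewer causal steps, and then in its extension. -/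
theorem isVacuum_iff_of_undropped (L : H.LivenessAxiom) (he : e ∈ H.events) :
    T.IsVacuum e ↔ H.IsVacuum e := by
  constructor
  · rintro ⟨h1, h2, h3⟩
    have hr : ∀ f, H.Reaches e f → T.Reaches e f := fun f h =>
      Relation.ReflTransGen.mono (fun _ _ h => primitive_of_undropped B C GT X hF h) _ _ h
    have hh : T.halting = H.halting := X.halting
    exact ⟨hh ▸ h1, h2.subset hr, fun f hf => hh ▸ h3 f (hr f hf)⟩
  · intro hv
    by_cases heh : H.IsHaltEvent e
    · refine isVacuum_of_isHaltEvent GT.basic GT.conforming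
        (events_subset_of_undropped B C X hF he) ?_
      obtain ⟨P, i, hi, rfl⟩ := heh
      exact ⟨P, i, X.mem ▸ hi, rfl⟩
    · refine X.isVacuum_of_isVacuum (undropped_basic B L C) (undropped_conforming B C) GT.basic
        ⟨he, heh⟩ ?_
      have hr : ∀ f, H.undropped.Reaches e f → H.Reaches e f := fun f h =>
        Relation.ReflTransGen.mono
          (fun _ _ h => (undropped_primitive_iff h.1.2 h.2.1.2).1 h) _ _ h
      exact ⟨hv.1, hv.2.1.subset hr, fun f hf => hv.2.2 f (hr f hf)⟩

/-- Events of `T` outside `H` are vacuum events, and events of `H` have the same vacuum status in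
both. The order can differ only in front of halting events, which are vacuum events. -/
theorem faultEquivalent_of_undropped (L : H.LivenessAxiom) : H.FaultEquivalent T := by
  have E := extends_of_undropped B C GT X hF
  have hev : ∀ e, e ∈ H.events ∧ ¬ H.IsVacuum e ↔ e ∈ T.events ∧ ¬ T.IsVacuum e := by
    intro e
    by_cases he : e ∈ H.events
    · rw [isVacuum_iff_of_undropped B C GT X hF L he]
      simp [he, E.events he]
    · refine ⟨fun h => absurd h.1 he, fun h => absurd ?_ h.2⟩
      exact X.isVacuum_of_notMem (undropped_basic B L C) (undropped_conforming B C) GT.basic h.1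
        fun h => he h.1
  refine ⟨E.frame, Set.ext hev, ?_, fun k hk => (E.multicast _ _ hk.1.1).2, ?_⟩
  · ext k
    have := hev (.queue k.src k.serial)
    constructor
    · rintro ⟨⟨h1, h2⟩, h3⟩
      obtain ⟨h4, h5⟩ := this.1 ⟨h1, h3⟩
      exact ⟨⟨h4, (E.multicast _ _ h1).1 ▸ h2⟩, h5⟩
    · rintro ⟨⟨h1, h2⟩, h3⟩
      obtain ⟨h4, h5⟩ := this.2 ⟨h1, h3⟩
      exact ⟨⟨h4, (E.multicast _ _ h4).1 ▸ h2⟩, h5⟩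
  · intro e he f hf
    refine (le_iff_of_undropped B C GT X hF he.1 hf.1 fun h => hf.2 ?_).symm
    exact isVacuum_of_isHaltEvent B C hf.1 h

end undropped

end GroupComputation

theorem mainTheorem4 {Pid Content Msg State : Type*} (A : Protocol Pid Content Msg State)
    (hlive : A.RespectsLiveness) (hconv : A.VacuumConvergent)
    (H : GroupComputation Pid Content Msg) (hH : A.IsHistory H) (hconf : H.Conforming) :
    ∃ T : GroupComputation Pid Content Msg,
      H.Extends T ∧ H.FaultEquivalent T ∧ A.Transactional T ∧
      (T.Stunted ∨ ∀ P ∈ T.mem.procs, P ∈ T.halting ↔ T.mem.Removed P) := by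
  obtain ⟨⟨B, after, Ge⟩, L⟩ := hH
  obtain ⟨T₀, h₀⟩ := GroupComputation.undropped_tidy hlive B L hconf Ge
  obtain ⟨T, a, G, X, hn, hF⟩ := T₀.exists_finished hlive hconv h₀
  exact ⟨T, GroupComputation.extends_of_undropped B hconf G X hF,
    GroupComputation.faultEquivalent_of_undropped B hconf G X hF L,
    GroupComputation.transactional_of_finished G hn fun P hP i hi =>
      hF P (X.halting ▸ hP) i (X.mem ▸ hi),
    G.conforming.stunted_or G.basic⟩
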